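/- **Setting.** Let $m\in\mathbb N$, $N\ge 2$, and let $\Omega\subset\mathbb R^N$ be open with finite Lebesgue measure. Let $X=(X_1,\dots,X_m)$, $X_j=\sum_k c_{jk}\partial_{x_k}$, be locally Lipschitz vector fields on $\mathbb R^N$ that are Lipschitz on $\Omega$ (the latter is automatic if $\Omega$ is bounded). Write $Xu=(X_1u,\dots,X_mu)=C(x)\nabla u$, $C=(c_{jk})$, for $u\in C^1$. An absolutely continuous path $\gamma$ on $[0,T]$ is *$X$-subunit* if for a.e. $t$ one has $\dot\gamma(t)=\sum_j\theta_j(t)X_j(\gamma(t))$ with $\sum_j\theta_j(t)^2\le 1$. Assume that any two points of $\Omega$ are joined by an $X$-subunit path in $\Omega$, and let $d_X(x,y)$ be the infimum of the $T>0$ for which there is an $X$-subunit path $\gamma:[0,T]\to\mathbb R^N$ with $\gamma(0)=x$, $\gamma(T)=y$. Let $B_r=B_r(x)=\{y\in\Omega: d_X(x,y)<r\}$ for $x\in\Omega$, $r>0$. Assume moreover: * for every $x\in\Omega$: $d_X(x,y)\to0$ as $|y-x|\to0$, $y\in\Omega$; * there is $Q>2$ with $|B_r|>0$ and $|B_{2r}|\le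 2^Q|B_r|$ for all $d_X$-balls; * there are $C_P,\nu>0$ such that $\frac1{|B_r|}\int_{B_r}|u-u_r|\,dx\le C_P\,r\,\frac1{|B_{\nu r}|}\int_{B_{\nu r}}|Xu|\,dx$, where $u_r=\frac1{|B_r|}\int_{B_r}u\,dx$, for all $d_X$-balls and all $u$ that are $C^1$ in a neighbourhood of $\overline{B_{\nu r}}$, with $u$ integrable on $B_r$ and $Xu$ integrable on $B_{\nu r}$. Let $A:\Omega\to\mathbb R^{m\times m}$ be measurable, not necessarily symmetric, and $0<\alpha<\beta$ with $$\alpha|\eta|^2\le A(x)\eta\cdot\eta,\qquad |A(x)\eta|\le\beta|\eta|\qquad\text{for all }\eta\in\mathbb R^m\text{ and a.e. }x\in\Omega .$$ Let $W_0^{1,2}(\Omega,X)$ be the closure of $C_c^\infty(\Omega)$ under the norm $\|Xu\|_{L^2(\Omega)}$, realized as a space of functions: $u\in W_0^{1,2}(\Omega,X)$ with $X$-gradient $Xu\in L^2(\Omega)^m$ if $u\in L^1(\Omega)$ and there are $\varphi_n\in C_c^\infty(\Omega)$ with $\varphi_n\to u$ in $L^1(\Omega)$ and $X\varphi_n\to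 Xu$ in $L^2(\Omega)^m$. For $F\in L^2(\Omega)^m$, a *weak solution* of $$X^*(A\,Xu)=X^*F\ \text{ in }\Omega,\qquad u=0\ \text{ on }\partial\Omega$$ is a $u\in W_0^{1,2}(\Omega,X)$ with $\int_\Omega A\,Xu\cdot Xv=\int_\Omega F\cdot Xv$ for all $v\in W_0^{1,2}(\Omega,X)$. **Theorem.** Let $2\le p\le\infty$ and $F\in L^p(\Omega)^m$. Then the problem above has a unique weak solution $u\in W_0^{1,2}(\Omega,X)$ (unique up to equality almost everywhere), and * if $p>Q$, then $u\in L^\infty(\Omega)$; * if $2\le p<Q$, then $u\in L^{\frac{Qp}{Q-p}}(\Omega)$. -/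

import Mathlib

open MeasureTheory Filter Topology
open scoped ContDiff ENNReal NNReal

noncomputable section

namespace XElliptic

/-- Points of `ℝ^N`, with the Euclidean norm. -/
abbrev Sp (N : ℕ) : Type := EuclideanSpace ℝ (Fin N)

/-- A family `X = (X_1, …, X_m)` of vector fields on `ℝ^N`;
`X j x k` is the coefficient `c_{jk}(x)`. -/
abbrev Fields (m N : ℕ) : Type := Fin m → Sp N → Sp N

variable {m N : ℕ}

/-- The `X`-gradient `X u = (X_1 u, …, X_m u) = C(x) ∇u` of a differentiable function. -/
def xGrad (X : Fields m N) (u : Sp N → ℝ) (x : Sp N) : Sp m :=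
  WithLp.toLp 2 fun j => fderiv ℝ u x (X j x)

/-- `γ : [0,T] → S` is an absolutely continuous `X`-subunit path. -/
def IsSubunit (X : Fields m N) (S : Set (Sp N)) (T : ℝ) (γ : ℝ → Sp N) : Prop :=
  AbsolutelyContinuousOnInterval γ 0 T ∧ (∀ t ∈ Set.Icc 0 T, γ t ∈ S) ∧
    ∃ θ : ℝ → Fin m → ℝ, ∀ᵐ t ∂(volume.restrict (Set.Icc 0 T)),
      ∑ j, θ t j ^ 2 ≤ 1 ∧ HasDerivAt γ (∑ j, θ t j • X j (γ t)) t

/-- `Ω` is `X`-connected: any two of its points are joined by an `X`-subunit path in `Ω`. -/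
def XConnected (X : Fields m N) (Ω : Set (Sp N)) : Prop :=
  ∀ x ∈ Ω, ∀ y ∈ Ω, ∃ T > 0, ∃ γ, IsSubunit X Ω T γ ∧ γ 0 = x ∧ γ T = y

/-- The control (Carnot–Carathéodory) distance, over `X`-subunit paths in `ℝ^N`. -/
def ccDist (X : Fields m N) (x y : Sp N) : ℝ :=
  sInf {T : ℝ | 0 < T ∧ ∃ γ, IsSubunit X Set.univ T γ ∧ γ 0 = x ∧ γ T = y}

/-- The open ball of the metric space `(Ω, d_X)`. -/
def ccBall (X : Fields m N) (Ω : Set (Sp N)) (x : Sp N) (r : ℝ) : Set (Sp N) :=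
  {y | y ∈ Ω ∧ ccDist X x y < r}

/-- `|y - x| → 0` implies `d_X(x, y) → 0`, at every `x ∈ Ω`. -/
def CCContinuous (X : Fields m N) (Ω : Set (Sp N)) : Prop :=
  ∀ x ∈ Ω, Tendsto (fun y => ccDist X x y) (𝓝[Ω] x) (𝓝 0)

/-- `(Ω, d_X, Lebesgue)` is doubling with exponent `Q`. -/
def Doubling (X : Fields m N) (Ω : Set (Sp N)) (Q : ℝ) : Prop :=
  ∀ x ∈ Ω, ∀ r > 0, 0 < volume (ccBall X Ω x r) ∧
    volume (ccBall X Ω x (2 * r)) ≤ ENNReal.ofReal (2 ^ Q) * volume (ccBall X Ω x r)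

/-- The Poincaré inequality on `d_X`-balls with constants `C_P` and `ν`, for functions that are
`C¹` in a neighbourhood of the closure of the larger ball. The two integrability requirements
hold automatically when `Ω` is bounded and `1 ≤ ν`. -/
def Poincare (X : Fields m N) (Ω : Set (Sp N)) (CP ν : ℝ) : Prop :=
  ∀ x ∈ Ω, ∀ r > 0, ∀ u : Sp N → ℝ,
    (∃ U, IsOpen U ∧ closure (ccBall X Ω x (ν * r)) ⊆ U ∧ ContDiffOn ℝ 1 u U) →
    IntegrableOn u (ccBall X Ω x r) → IntegrableOn (xGrad X u) (ccBall X Ω x (ν * r)) →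
    ⨍ y in ccBall X Ω x r, |u y - ⨍ z in ccBall X Ω x r, u z| ≤
      CP * r * ⨍ y in ccBall X Ω x (ν * r), ‖xGrad X u y‖

/-- `φ ∈ C_c^∞(Ω)`. -/
def IsTest (Ω : Set (Sp N)) (φ : Sp N → ℝ) : Prop :=
  ContDiff ℝ ∞ φ ∧ HasCompactSupport φ ∧ tsupport φ ⊆ Ω

/-- `u` belongs to `W₀^{1,2}(Ω, X)`, the closure of `C_c^∞(Ω)` under `‖Xu‖_{L²(Ω)}`, and `g` is its
`X`-gradient: `u` is the `L¹`-limit of test functions whose `X`-gradients converge to `g` in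
`L²`. -/
def IsW0 (Ω : Set (Sp N)) (X : Fields m N) (u : Sp N → ℝ) (g : Sp N → Sp m) : Prop :=
  MemLp u 1 (volume.restrict Ω) ∧ MemLp g 2 (volume.restrict Ω) ∧
    ∃ φ : ℕ → Sp N → ℝ, (∀ n, IsTest Ω (φ n)) ∧
      Tendsto (fun n => eLpNorm (φ n - u) 1 (volume.restrict Ω)) atTop (𝓝 0) ∧
      Tendsto (fun n => eLpNorm (xGrad X (φ n) - g) 2 (volume.restrict Ω)) atTop (𝓝 0)

/-- `A(x) η`, as a vector of the Euclidean space `ℝ^m`. -/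
def app (M : Matrix (Fin m) (Fin m) ℝ) (η : Sp m) : Sp m :=
  WithLp.toLp 2 (M.mulVec η.ofLp)

/-- `A` is measurable on `Ω`, coercive with constant `α` and bounded with constant `β`. -/
def IsEllipticCoeff (Ω : Set (Sp N)) (A : Sp N → Matrix (Fin m) (Fin m) ℝ) (α β : ℝ) : Prop :=
  (∀ i j, AEMeasurable (fun x => A x i j) (volume.restrict Ω)) ∧
    ∀ᵐ x ∂(volume.restrict Ω), ∀ η : Sp m,
      α * ‖η‖ ^ 2 ≤ inner ℝ (app (A x) η) η ∧ ‖app (A x) η‖ ≤ β * ‖η‖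

/-- `u ∈ W₀^{1,2}(Ω, X)` is a weak solution of `X*(A Xu) = X*F` in `Ω`, `u = 0` on `∂Ω`:
`∫ A Xu · Xv = ∫ F · Xv` for every `v ∈ W₀^{1,2}(Ω, X)`. -/
def IsWeakSolution (Ω : Set (Sp N)) (X : Fields m N) (A : Sp N → Matrix (Fin m) (Fin m) ℝ)
    (F : Sp N → Sp m) (u : Sp N → ℝ) : Prop :=
  ∃ g, IsW0 Ω X u g ∧ ∀ v h, IsW0 Ω X v h →
    ∫ x in Ω, inner ℝ (app (A x) (g x)) (h x) = ∫ x in Ω, inner ℝ (F x) (h x)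

end XElliptic

end

open MeasureTheory Filter Topology
open scoped ContDiff ENNReal NNReal

noncomputable section

namespace XElliptic

variable {m N : ℕ}

/-! ### Absolutely continuous curves -/

/-! Everything rests on a Sobolev inequality ‖φ‖_q ≤ C‖Xφ‖_2 for test functions, with q = 2Q/(Q-2);
the equation enters only through one energy inequality.

Sobolev inequality. Doubling and |Ω| < ∞ make Ω bounded for d_X (`exists_ball_eq`), so |B_r| is at
least a constant times r^Q. Telescoping the Poincaré inequality over dyadic balls gives |φ(x) -
φ_{B_s}| ≤ C s M|Xφ|(x) towards small scales and |φ_{B_s} - φ_Ω| ≤ C s^{1-Q/2} ‖Xφ‖_2 towards large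
ones. Hedberg's choice of s and the L² bound for the maximal function M yield the Sobolev inequality
for φ - φ_Ω (`exists_eLpNorm_sub_average_le`).

Removing the mean. It remains to show ∫|φ| ≤ C∫|Xφ| (`exists_integral_abs_le`). Otherwise some test
functions tend to 1 in L¹(Ω) with X-gradients tending to 0, so the indicator function of Ω is
invariant under the fields. As in Bony's argument, the fields are then tangent to S, the support of
Lebesgue measure on Ωᶜ, at nearest points (`inner_nonpos_of_touching`). By Gronwall, the distance to
S changes along a subunit path by at most a factor exp(cT). Since Ω has finite d_X-diameter, its
points stay at a positive distance from S; yet S has a frontier point in the closure of Ω. This is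
`not_tendsto_one`.

Existence and uniqueness. The Sobolev inequality attaches a function to every L²-limit of test
gradients, and Lax–Milgram applies on the closed space of such limits.

Regularity. Testing with ∫₀^u ρ² and applying Sobolev to ∫₀^u ρ gives ‖∫₀^u ρ‖_q ≤ Cα⁻¹‖ρ(u)F‖_2 for
every bounded smooth ρ (`energy_estimate`). If ρ cuts off at a level, this bounds the measure of
superlevel sets and Stampacchia's lemma gives boundedness for p > Q. If ρ is a truncated power of
|u|, Hölder's inequality gives a self-bound with exponent below 1, uniform in the truncation, and
hence the exponent Qp/(Q-p) for 2 < p < Q. For p = 2 the choice ρ = 1 is enough. -/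

theorem absolutelyContinuousOnInterval_comp_lipschitz {E F : Type*} [PseudoMetricSpace E]
    [PseudoMetricSpace F] {K : ℝ≥0} {g : E → F} (hg : LipschitzWith K g) {f : ℝ → E} {a b : ℝ}
    (hf : AbsolutelyContinuousOnInterval f a b) :
    AbsolutelyContinuousOnInterval (fun t => g (f t)) a b := by
  rw [absolutelyContinuousOnInterval_iff] at hf ⊢
  intro ε hε
  obtain ⟨δ, hδ, h⟩ := hf (ε / (K + 1)) (by positivity)
  refine ⟨δ, hδ, fun I hI hI' => ?_⟩
  have h1 := h I hI hI'
  calc ∑ i ∈ Finset.range I.1, dist (g (f (I.2 i).1)) (g (f (I.2 i).2))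
      ≤ ∑ i ∈ Finset.range I.1, (K + 1) * dist (f (I.2 i).1) (f (I.2 i).2) := by
        refine Finset.sum_le_sum fun i _ => (hg.dist_le_mul _ _).trans ?_
        gcongr
        linarith
    _ = (K + 1) * ∑ i ∈ Finset.range I.1, dist (f (I.2 i).1) (f (I.2 i).2) := by
        rw [Finset.mul_sum]
    _ < (K + 1) * (ε / (K + 1)) := by gcongr
    _ = ε := by field_simp

/-- An absolutely continuous function whose derivative is at most `M` almost everywhere grows at
most with slope `M`. -/
theorem sub_le_of_ae_deriv_le {f : ℝ → ℝ} {a b M : ℝ} (hab : a ≤ b)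
    (hf : AbsolutelyContinuousOnInterval f a b)
    (h : ∀ᵐ t ∂(volume.restrict (Set.Icc a b)), ∀ f', HasDerivAt f f' t → f' ≤ M) :
    f b - f a ≤ M * (b - a) := by
  rw [← hf.integral_deriv_eq_sub]
  have h1 : ∫ x in a..b, deriv f x ≤ ∫ x in a..b, M := by
    refine intervalIntegral.integral_mono_ae_restrict hab hf.intervalIntegrable_deriv (by simp) ?_
    have h2 := hf.ae_differentiableAt
    rw [ae_restrict_iff' measurableSet_Icc] at h
    rw [EventuallyLE, ae_restrict_iff' measurableSet_Icc]
    filter_upwards [h, h2] with t ht1 ht2 ht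
    exact ht1 ht _ (ht2 (by rwa [Set.uIcc_of_le hab])).hasDerivAt
  refine h1.trans ?_
  simp [mul_comm]

/-- Gronwall's inequality for absolutely continuous functions. -/
theorem le_mul_exp_of_ae_deriv_le {g : ℝ → ℝ} {L T : ℝ} (hT : 0 ≤ T)
    (hg : AbsolutelyContinuousOnInterval g 0 T)
    (h : ∀ᵐ t ∂(volume.restrict (Set.Icc 0 T)), ∀ g', HasDerivAt g g' t → g' ≤ L * g t) :
    g T ≤ g 0 * Real.exp (L * T) := by
  -- The product exp(-Lt) g(t) has non-positive derivative almost everywhere. The hypothesis speaks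
  -- only of points where g is differentiable; differentiability of the product passes back to g on
  -- multiplying by exp(Lt).
  have he : AbsolutelyContinuousOnInterval (fun t => Real.exp (-(L * t))) 0 T :=
    ContDiffOn.absolutelyContinuousOnInterval (by fun_prop)
  have h2 := sub_le_of_ae_deriv_le (M := 0) hT (he.fun_mul hg) (by
    filter_upwards [h] with t ht f' hf'
    have he' : HasDerivAt (fun t => Real.exp (L * t)) (Real.exp (L * t) * L) t := by
      simpa using ((hasDerivAt_id t).const_mul L).exp
    have h3 := he'.mul hf'
    have h4 : (fun t => Real.exp (L * t)) * (fun t => Real.exp (-(L * t)) * g t) = g := by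
      funext s
      simp only [Pi.mul_apply]
      rw [← mul_assoc, ← Real.exp_add]
      simp
    rw [h4] at h3
    have h5 := ht _ h3
    have h6 : Real.exp (L * t) * (Real.exp (-(L * t)) * g t) = g t := congrFun h4 t
    have h7 : Real.exp (L * t) * f' ≤ 0 := by
      have : Real.exp (L * t) * L * (Real.exp (-(L * t)) * g t) = L * g t := by
        rw [← h6]; simp only [h6]; linear_combination L * h6
      linarith
    by_contra! hcon
    exact absurd h7 (not_le.2 (by positivity)))
  simp only [zero_mul, mul_zero, neg_zero, Real.exp_zero, one_mul] at h2
  rw [Real.exp_neg] at h2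
  have h3 : (Real.exp (L * T))⁻¹ * g T ≤ g 0 := by linarith
  rwa [inv_mul_le_iff₀ (Real.exp_pos _), mul_comm] at h3

/-- The mean value inequality for absolutely continuous curves in a Hilbert space. -/
theorem norm_sub_le_of_ae_hasDerivAt {E : Type*} [NormedAddCommGroup E] [InnerProductSpace ℝ E]
    {γ : ℝ → E} {a b M : ℝ} (hab : a ≤ b) (hγ : AbsolutelyContinuousOnInterval γ a b)
    (h : ∀ᵐ t ∂(volume.restrict (Set.Icc a b)), ∃ v, HasDerivAt γ v t ∧ ‖v‖ ≤ M) :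
    ‖γ b - γ a‖ ≤ M * (b - a) := by
  -- Pairing the curve with its own increment reduces the claim to the scalar case.
  set w := γ b - γ a with hw
  have h1 : AbsolutelyContinuousOnInterval (fun t => innerSL ℝ w (γ t)) a b :=
    absolutelyContinuousOnInterval_comp_lipschitz (innerSL ℝ w).lipschitz hγ
  have h2 := sub_le_of_ae_deriv_le (M := ‖w‖ * M) hab h1 (by
    filter_upwards [h] with t ht f' hf'
    obtain ⟨v, hv, hvM⟩ := ht
    have h3 : HasDerivAt (fun t => innerSL ℝ w (γ t)) (innerSL ℝ w v) t :=
      (innerSL ℝ w).hasFDerivAt.comp_hasDerivAt t hv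
    rw [hf'.unique h3, innerSL_apply_apply]
    exact (real_inner_le_norm _ _).trans (by gcongr))
  rw [← map_sub, ← hw, innerSL_apply_apply, real_inner_self_eq_norm_sq] at h2
  -- With zero increment, M ≥ 0 is still needed; it holds because the derivative bound is satisfied
  -- at some point of a nondegenerate interval.
  rcases (norm_nonneg w).eq_or_lt with h0 | h0
  · rw [← h0]
    rcases hab.eq_or_lt with rfl | hab'
    · simp
    · have : (ae (volume.restrict (Set.Icc a b))).NeBot := by
        rw [ae_neBot, Ne, Measure.restrict_eq_zero, Real.volume_Icc]
        simpa using hab'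
      obtain ⟨t, v, _, hv⟩ := h.exists
      have := (norm_nonneg v).trans hv
      have : 0 ≤ b - a := by linarith
      positivity
  · refine le_of_mul_le_mul_left ?_ h0
    linarith [h2, sq ‖w‖]

/-! ### Subunit paths and the control distance -/

theorem norm_sum_smul_le (X : Fields m N) (p : Sp N) {θ : Fin m → ℝ} (hθ : ∑ j, θ j ^ 2 ≤ 1) :
    ‖∑ j, θ j • X j p‖ ≤ ∑ j, ‖X j p‖ := by
  refine (norm_sum_le _ _).trans (Finset.sum_le_sum fun j _ => ?_)
  rw [norm_smul]
  have h1 : θ j ^ 2 ≤ 1 :=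
    (Finset.single_le_sum (f := fun j => θ j ^ 2) (fun i _ => sq_nonneg _)
      (Finset.mem_univ j)).trans hθ
  have h2 : ‖θ j‖ ≤ 1 := by
    rw [Real.norm_eq_abs]
    exact (sq_le_one_iff_abs_le_one _).1 h1
  exact mul_le_of_le_one_left (norm_nonneg _) h2

theorem IsSubunit.continuousOn {X : Fields m N} {S : Set (Sp N)} {T : ℝ} {γ : ℝ → Sp N}
    (hT : 0 ≤ T) (h : IsSubunit X S T γ) : ContinuousOn γ (Set.Icc 0 T) := by
  have := h.1.continuousOn
  rwa [Set.uIcc_of_le hT] at this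

theorem IsSubunit.norm_sub_le {X : Fields m N} {S : Set (Sp N)} {T : ℝ} {γ : ℝ → Sp N}
    (h : IsSubunit X S T γ) {a b M : ℝ} (ha : 0 ≤ a) (hab : a ≤ b) (hb : b ≤ T)
    (hM : ∀ t ∈ Set.Icc a b, ∑ j, ‖X j (γ t)‖ ≤ M) : ‖γ b - γ a‖ ≤ M * (b - a) := by
  obtain ⟨hac, -, θ, hθ⟩ := h
  refine norm_sub_le_of_ae_hasDerivAt hab (hac.mono ?_) ?_
  · rw [Set.uIcc_of_le hab, Set.uIcc_of_le (ha.trans (hab.trans hb))]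
    exact Set.Icc_subset_Icc ha hb
  · rw [ae_restrict_iff' measurableSet_Icc] at hθ ⊢
    filter_upwards [hθ] with t ht hmem
    obtain ⟨h1, h2⟩ := ht ⟨ha.trans hmem.1, hmem.2.trans hb⟩
    exact ⟨_, h2, (norm_sum_smul_le X _ h1).trans (hM t hmem)⟩

/-- The path has compact image, on which the fields are bounded, so its speed is bounded. Lipschitz
bounds survive reversal and concatenation, which is how absolute continuity of the new paths is
checked. -/
theorem IsSubunit.exists_lipschitzOnWith {X : Fields m N} (hX : ∀ j, Continuous (X j))
    {S : Set (Sp N)} {T : ℝ} {γ : ℝ → Sp N} (hT : 0 ≤ T) (h : IsSubunit X S T γ) :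
    ∃ K, LipschitzOnWith K γ (Set.Icc 0 T) := by
  have hc : ContinuousOn (fun t => ∑ j, ‖X j (γ t)‖) (Set.Icc 0 T) :=
    continuousOn_finsetSum _ fun j _ => ((hX j).comp_continuousOn (h.continuousOn hT)).norm
  obtain ⟨M, hM⟩ := isCompact_Icc.exists_bound_of_continuousOn hc
  refine ⟨M.toNNReal, LipschitzOnWith.of_dist_le_mul ?_⟩
  have key : ∀ s ∈ Set.Icc 0 T, ∀ t ∈ Set.Icc 0 T, s ≤ t →
      dist (γ s) (γ t) ≤ M.toNNReal * dist s t := by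
    intro s hs t ht hst
    rw [dist_comm, dist_eq_norm, dist_comm, Real.dist_eq, abs_of_nonneg (by linarith)]
    refine (h.norm_sub_le hs.1 hst ht.2 (M := M) fun r hr => ?_).trans ?_
    · exact (le_abs_self _).trans (hM r ⟨hs.1.trans hr.1, hr.2.trans ht.2⟩)
    · have : M ≤ (M.toNNReal : ℝ) := Real.le_coe_toNNReal M
      have : 0 ≤ t - s := by linarith
      gcongr
  intro s hs t ht
  rcases le_total s t with hst | hst
  · exact key s hs t ht hst
  · rw [dist_comm, dist_comm s]
    exact key t ht s hs hst

theorem IsSubunit.reverse {X : Fields m N} (hX : ∀ j, Continuous (X j)) {S : Set (Sp N)} {T : ℝ}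
    {γ : ℝ → Sp N} (hT : 0 ≤ T) (h : IsSubunit X S T γ) :
    IsSubunit X S T (fun t => γ (T - t)) := by
  obtain ⟨K, hK⟩ := h.exists_lipschitzOnWith hX hT
  obtain ⟨-, hS, θ, hθ⟩ := h
  have hmaps : Set.MapsTo (fun t : ℝ => T - t) (Set.Icc 0 T) (Set.Icc 0 T) :=
    fun t ht => ⟨by linarith [ht.2], by linarith [ht.1]⟩
  refine ⟨?_, fun t ht => hS _ (hmaps ht), fun t j => -θ (T - t) j, ?_⟩
  · refine LipschitzOnWith.absolutelyContinuousOnInterval (K := K) ?_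
    rw [Set.uIcc_of_le hT]
    refine LipschitzOnWith.of_dist_le_mul fun s hs t ht => ?_
    refine (hK.dist_le_mul _ (hmaps hs) _ (hmaps ht)).trans_eq ?_
    rw [dist_sub_left]
  · rw [ae_restrict_iff' measurableSet_Icc] at hθ ⊢
    have hq := (Measure.measurePreserving_sub_left (volume : Measure ℝ) T).quasiMeasurePreserving.ae hθ
    filter_upwards [hq] with t ht hmem
    obtain ⟨h1, h2⟩ := ht (hmaps hmem)
    refine ⟨by simpa using h1, ?_⟩
    have := h2.scomp t ((hasDerivAt_id t).const_sub T)
    simpa [Function.comp_def, Finset.sum_neg_distrib] using this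

theorem IsSubunit.concat {X : Fields m N} (hX : ∀ j, Continuous (X j)) {S : Set (Sp N)}
    {T₁ T₂ : ℝ} {γ₁ γ₂ : ℝ → Sp N} (hT₁ : 0 ≤ T₁) (hT₂ : 0 ≤ T₂)
    (h₁ : IsSubunit X S T₁ γ₁) (h₂ : IsSubunit X S T₂ γ₂) (h12 : γ₁ T₁ = γ₂ 0) :
    IsSubunit X S (T₁ + T₂) (fun t => if t ≤ T₁ then γ₁ t else γ₂ (t - T₁)) := by
  obtain ⟨K₁, hK₁⟩ := h₁.exists_lipschitzOnWith hX hT₁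
  obtain ⟨K₂, hK₂⟩ := h₂.exists_lipschitzOnWith hX hT₂
  obtain ⟨-, hS₁, θ₁, hθ₁⟩ := h₁
  obtain ⟨-, hS₂, θ₂, hθ₂⟩ := h₂
  set γ : ℝ → Sp N := fun t => if t ≤ T₁ then γ₁ t else γ₂ (t - T₁) with hγ
  have e1 : ∀ t, t ≤ T₁ → γ t = γ₁ t := fun t ht => if_pos ht
  have e2 : ∀ t, T₁ ≤ t → γ t = γ₂ (t - T₁) := by
    intro t ht
    rcases ht.eq_or_lt with rfl | ht
    · rw [e1 _ le_rfl, h12, sub_self]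
    · exact if_neg (not_le.2 ht)
  have d1 : ∀ s t, 0 ≤ s → s ≤ t → t ≤ T₁ → dist (γ s) (γ t) ≤ max K₁ K₂ * (t - s) := by
    intro s t hs hst ht
    rw [e1 s (hst.trans ht), e1 t ht]
    refine (hK₁.dist_le_mul _ ⟨hs, hst.trans ht⟩ _ ⟨hs.trans hst, ht⟩).trans ?_
    rw [dist_comm, Real.dist_eq, abs_of_nonneg (by linarith)]
    exact mul_le_mul_of_nonneg_right (by exact_mod_cast le_max_left _ _) (by linarith)
  have d2 : ∀ s t, T₁ ≤ s → s ≤ t → t ≤ T₁ + T₂ →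
      dist (γ s) (γ t) ≤ max K₁ K₂ * (t - s) := by
    intro s t hs hst ht
    rw [e2 s hs, e2 t (hs.trans hst)]
    refine (hK₂.dist_le_mul _ ⟨by linarith, by linarith⟩ _ ⟨by linarith, by linarith⟩).trans ?_
    rw [dist_sub_right, dist_comm, Real.dist_eq, abs_of_nonneg (by linarith)]
    exact mul_le_mul_of_nonneg_right (by exact_mod_cast le_max_right _ _) (by linarith)
  have d3 : ∀ s t, 0 ≤ s → s ≤ t → t ≤ T₁ + T₂ →
      dist (γ s) (γ t) ≤ max K₁ K₂ * (t - s) := by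
    intro s t hs hst ht
    rcases le_total t T₁ with h | h
    · exact d1 s t hs hst h
    rcases le_total T₁ s with h' | h'
    · exact d2 s t h' hst ht
    refine (dist_triangle _ (γ T₁) _).trans ?_
    linarith [d1 s T₁ hs h' le_rfl, d2 T₁ t le_rfl h ht]
  refine ⟨?_, fun t ht => ?_, fun t => if t ≤ T₁ then θ₁ t else θ₂ (t - T₁), ?_⟩
  · refine LipschitzOnWith.absolutelyContinuousOnInterval (K := max K₁ K₂) ?_
    rw [Set.uIcc_of_le (by linarith)]
    refine LipschitzOnWith.of_dist_le_mul fun s hs t ht => ?_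
    push_cast
    rcases le_total s t with hst | hst
    · rw [dist_comm s, Real.dist_eq, abs_of_nonneg (by linarith)]
      exact d3 s t hs.1 hst ht.2
    · rw [dist_comm, Real.dist_eq, abs_of_nonneg (by linarith)]
      exact d3 t s ht.1 hst hs.2
  · rcases le_total t T₁ with h | h
    · rw [e1 t h]; exact hS₁ t ⟨ht.1, h⟩
    · rw [e2 t h]; exact hS₂ _ ⟨by linarith, by linarith [ht.2]⟩
  · rw [ae_restrict_iff' measurableSet_Icc] at hθ₁ hθ₂ ⊢
    have hq :=
      (measurePreserving_sub_right (volume : Measure ℝ) T₁).quasiMeasurePreserving.ae hθ₂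
    have hne : ∀ᵐ t : ℝ, t ≠ T₁ := by simp [ae_iff]
    filter_upwards [hθ₁, hq, hne] with t ht1 ht2 hne hmem
    rcases lt_or_gt_of_ne hne with h | h
    · obtain ⟨a1, a2⟩ := ht1 ⟨hmem.1, h.le⟩
      simp only [if_pos h.le]
      refine ⟨a1, ?_⟩
      rw [e1 t h.le]
      refine a2.congr_of_eventuallyEq ?_
      filter_upwards [Iio_mem_nhds h] with s hs
      exact e1 s (le_of_lt hs)
    · obtain ⟨a1, a2⟩ := ht2 ⟨by linarith, by linarith [hmem.2]⟩
      simp only [if_neg (not_le.2 h)]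
      refine ⟨a1, ?_⟩
      rw [e2 t h.le]
      have a3 : HasDerivAt (fun s => γ₂ (s - T₁)) _ t := a2.comp_sub_const t T₁
      refine a3.congr_of_eventuallyEq ?_
      filter_upwards [Ioi_mem_nhds h] with s hs
      exact e2 s (le_of_lt hs)

theorem ccDist_nonneg (X : Fields m N) (x y : Sp N) : 0 ≤ ccDist X x y :=
  Real.sInf_nonneg fun _ h => h.1.le

theorem ccDist_le {X : Fields m N} {x y : Sp N} {T : ℝ} (hT : 0 < T) {γ : ℝ → Sp N}
    (h : IsSubunit X Set.univ T γ) (h0 : γ 0 = x) (h1 : γ T = y) : ccDist X x y ≤ T :=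
  csInf_le ⟨0, fun _ h => h.1.le⟩ ⟨hT, γ, h, h0, h1⟩

theorem ccDist_self (X : Fields m N) (x : Sp N) : ccDist X x x = 0 := by
  refine le_antisymm (le_of_forall_pos_le_add fun ε hε => ?_) (ccDist_nonneg X x x)
  rw [zero_add]
  refine ccDist_le hε (γ := fun _ => x) ⟨?_, fun _ _ => trivial, fun _ _ => 0, ?_⟩ rfl rfl
  · exact LipschitzOnWith.absolutelyContinuousOnInterval (K := 0)
      ((LipschitzWith.const x).lipschitzOnWith)
  · refine Eventually.of_forall fun t => ⟨by simp, ?_⟩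
    simpa using hasDerivAt_const t x

theorem ccDist_comm {X : Fields m N} (hX : ∀ j, Continuous (X j)) (x y : Sp N) :
    ccDist X x y = ccDist X y x := by
  have key : ∀ x y, {T : ℝ | 0 < T ∧ ∃ γ, IsSubunit X Set.univ T γ ∧ γ 0 = x ∧ γ T = y} ⊆
      {T : ℝ | 0 < T ∧ ∃ γ, IsSubunit X Set.univ T γ ∧ γ 0 = y ∧ γ T = x} := by
    rintro x y T ⟨hT, γ, hγ, h0, h1⟩
    exact ⟨hT, _, hγ.reverse hX hT.le, by simpa using h1, by simpa using h0⟩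
  unfold ccDist
  rw [Set.Subset.antisymm (key x y) (key y x)]

/-- Connectedness matters here: the real infimum of the empty set is 0, so a small value of `ccDist`
alone would not provide a path. -/
theorem exists_subunit_of_ccDist_lt {X : Fields m N} {Ω : Set (Sp N)} (hconn : XConnected X Ω)
    {x y : Sp N} (hx : x ∈ Ω) (hy : y ∈ Ω) {r : ℝ} (h : ccDist X x y < r) :
    ∃ T, 0 < T ∧ T < r ∧ ∃ γ, IsSubunit X Set.univ T γ ∧ γ 0 = x ∧ γ T = y := by
  obtain ⟨T, hT, γ, hγ, h0, h1⟩ := hconn x hx y hy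
  obtain ⟨T', hT', hlt⟩ := exists_lt_of_csInf_lt
    (s := {T : ℝ | 0 < T ∧ ∃ γ, IsSubunit X Set.univ T γ ∧ γ 0 = x ∧ γ T = y})
    ⟨T, hT, γ, ⟨hγ.1, fun _ _ => trivial, hγ.2.2⟩, h0, h1⟩ h
  exact ⟨T', hT'.1, hlt, hT'.2⟩

theorem ccDist_triangle {X : Fields m N} (hX : ∀ j, Continuous (X j)) {Ω : Set (Sp N)}
    (hconn : XConnected X Ω) {x y z : Sp N} (hx : x ∈ Ω) (hy : y ∈ Ω) (hz : z ∈ Ω) :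
    ccDist X x z ≤ ccDist X x y + ccDist X y z := by
  refine le_of_forall_pos_le_add fun ε hε => ?_
  obtain ⟨T₁, h1, h1', γ₁, g1, g1', g1''⟩ := exists_subunit_of_ccDist_lt hconn hx hy
    (show ccDist X x y < ccDist X x y + ε / 2 by linarith)
  obtain ⟨T₂, h2, h2', γ₂, g2, g2', g2''⟩ := exists_subunit_of_ccDist_lt hconn hy hz
    (show ccDist X y z < ccDist X y z + ε / 2 by linarith)
  have := ccDist_le (by linarith) (g1.concat hX h1.le h2.le g2 (g1''.trans g2'.symm))
    (x := x) (y := z) (by simp [h1.le, g1']) (by simp [not_le.2 h2, g2''])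
  linarith

theorem mem_ccBall_self {X : Fields m N} {Ω : Set (Sp N)} {x : Sp N} (hx : x ∈ Ω) {r : ℝ}
    (hr : 0 < r) : x ∈ ccBall X Ω x r :=
  ⟨hx, by rwa [ccDist_self]⟩

theorem ccBall_subset (X : Fields m N) (Ω : Set (Sp N)) (x : Sp N) (r : ℝ) :
    ccBall X Ω x r ⊆ Ω := fun _ h => h.1

theorem ccBall_mono {X : Fields m N} {Ω : Set (Sp N)} {x : Sp N} {r s : ℝ} (h : r ≤ s) :
    ccBall X Ω x r ⊆ ccBall X Ω x s := fun _ hy => ⟨hy.1, hy.2.trans_le h⟩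

theorem isOpen_ccBall {X : Fields m N} (hX : ∀ j, Continuous (X j)) {Ω : Set (Sp N)}
    (hΩ : IsOpen Ω) (hconn : XConnected X Ω) (hcont : CCContinuous X Ω) {x : Sp N} (hx : x ∈ Ω)
    (r : ℝ) : IsOpen (ccBall X Ω x r) := by
  rw [isOpen_iff_mem_nhds]
  rintro y ⟨hy, hyr⟩
  have h1 := hcont y hy
  rw [hΩ.nhdsWithin_eq hy] at h1
  filter_upwards [h1.eventually (gt_mem_nhds (show 0 < r - ccDist X x y by linarith)),
    hΩ.mem_nhds hy] with z hz hzΩ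
  exact ⟨hzΩ, by linarith [ccDist_triangle hX hconn hx hy hzΩ]⟩

/-- Balls of the control distance are small in the Euclidean sense. -/
theorem exists_ccBall_subset_ball {X : Fields m N} (hX : ∀ j, Continuous (X j)) {Ω : Set (Sp N)}
    (hconn : XConnected X Ω) {x : Sp N} (hx : x ∈ Ω) {ε : ℝ} (hε : 0 < ε) :
    ∃ r > 0, ccBall X Ω x r ⊆ Metric.ball x ε := by
  obtain ⟨M, hM⟩ := (isCompact_closedBall x ε).exists_bound_of_continuousOn
    (f := fun p => ∑ j, ‖X j p‖) (by fun_prop)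
  have hM0 : 0 ≤ M := (norm_nonneg _).trans (hM x (Metric.mem_closedBall_self hε.le))
  refine ⟨ε / (M + 1), by positivity, ?_⟩
  rintro y ⟨hy, hxy⟩
  obtain ⟨T, hT, hTr, γ, hγ, h0, h1⟩ := exists_subunit_of_ccDist_lt hconn hx hy hxy
  by_contra hcon
  rw [Metric.mem_ball, not_lt] at hcon
  have hcd : ContinuousOn (fun t => dist (γ t) x) (Set.Icc 0 T) :=
    (continuous_id.dist (continuous_const (y := x))).comp_continuousOn (hγ.continuousOn hT.le)
  -- Its least element τ is the first time at distance at least ε from x. Up to τ the speed is at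
  -- most M, so ε ≤ Mτ, contradicting τ < ε/(M+1).
  set A := Set.Icc 0 T ∩ (fun t => dist (γ t) x) ⁻¹' Set.Ici ε with hA
  have hAc : IsCompact A :=
    isCompact_Icc.of_isClosed_subset (hcd.preimage_isClosed_of_isClosed isClosed_Icc isClosed_Ici)
      Set.inter_subset_left
  have hAne : A.Nonempty := ⟨T, ⟨hT.le, le_rfl⟩, by simpa [h1] using hcon⟩
  obtain ⟨τ, hτ, hmin⟩ := hAc.exists_isLeast hAne
  have hball : ∀ t ∈ Set.Ico 0 τ, dist (γ t) x < ε := by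
    intro t ht
    by_contra! h
    exact absurd (hmin ⟨⟨ht.1, ht.2.le.trans hτ.1.2⟩, h⟩) (not_le.2 ht.2)
  have hτ0 : 0 < τ := by
    rcases hτ.1.1.eq_or_lt with h | h
    · exfalso
      have := hτ.2
      rw [← h] at this
      simp [h0] at this
      linarith
    · exact h
  have hle : ∀ t ∈ Set.Icc 0 τ, dist (γ t) x ≤ ε := by
    have hcl : closure (Set.Ico 0 τ) = Set.Icc 0 τ := closure_Ico hτ0.ne
    intro t ht
    rw [← hcl] at ht
    refine le_on_closure (fun s hs => (hball s hs).le) ?_ continuousOn_const ht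
    rw [hcl]
    exact hcd.mono (Set.Icc_subset_Icc le_rfl hτ.1.2)
  have := hγ.norm_sub_le (M := M) le_rfl hτ0.le hτ.1.2 fun t ht =>
    (le_abs_self _).trans (hM _ (hle t ht))
  rw [h0, ← dist_eq_norm, sub_zero] at this
  have h3 : ε ≤ dist (γ τ) x := hτ.2
  have h4 : τ < ε / (M + 1) := hτ.1.2.trans_lt hTr
  rw [lt_div_iff₀ (by positivity)] at h4
  nlinarith

/-! ### Doubling domains of finite measure -/

/-- An open set of finite measure which is a doubling space for its control distance. -/
structure IsDoublingDomain (X : Fields m N) (Ω : Set (Sp N)) (Q : ℝ) : Prop where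
  isOpen : IsOpen Ω
  finite : volume Ω < ⊤
  continuous : ∀ j, Continuous (X j)
  connected : XConnected X Ω
  ccContinuous : CCContinuous X Ω
  doubling : Doubling X Ω Q

namespace IsDoublingDomain

variable {X : Fields m N} {Ω : Set (Sp N)} {Q : ℝ}

theorem isOpen_ball (h : IsDoublingDomain X Ω Q) {x : Sp N} (hx : x ∈ Ω) (r : ℝ) :
    IsOpen (ccBall X Ω x r) :=
  isOpen_ccBall h.continuous h.isOpen h.connected h.ccContinuous hx r

theorem volume_ball_lt_top (h : IsDoublingDomain X Ω Q) (x : Sp N) (r : ℝ) :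
    volume (ccBall X Ω x r) < ⊤ :=
  (measure_mono (ccBall_subset X Ω x r)).trans_lt h.finite

theorem comm (h : IsDoublingDomain X Ω Q) (x y : Sp N) : ccDist X x y = ccDist X y x :=
  ccDist_comm h.continuous x y

theorem triangle (h : IsDoublingDomain X Ω Q) {x y z : Sp N} (hx : x ∈ Ω) (hy : y ∈ Ω)
    (hz : z ∈ Ω) : ccDist X x z ≤ ccDist X x y + ccDist X y z :=
  ccDist_triangle h.continuous h.connected hx hy hz

theorem doubling_pow (h : IsDoublingDomain X Ω Q) {x : Sp N} (hx : x ∈ Ω) {r : ℝ} (hr : 0 < r)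
    (n : ℕ) :
    volume (ccBall X Ω x (2 ^ n * r)) ≤ ENNReal.ofReal (2 ^ Q) ^ n * volume (ccBall X Ω x r) := by
  induction n with
  | zero => simp
  | succ n ih =>
    have h1 := (h.doubling x hx (2 ^ n * r) (by positivity)).2
    rw [← mul_assoc, ← pow_succ'] at h1
    refine h1.trans ?_
    rw [pow_succ' (ENNReal.ofReal (2 ^ Q)), mul_assoc]
    gcongr

/-- If y lies at distance s from x₀, the balls of radius s/2 about both points are disjoint and, by
doubling, of comparable measure. So |B(x₀, s/2)| takes up at most the fraction K/(K+1) of |Ω|. With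
s unbounded this would persist in the limit, where the balls exhaust Ω; this is impossible for 0 <
|Ω| < ∞. -/
theorem exists_ball_eq (h : IsDoublingDomain X Ω Q) :
    ∃ R > 0, ∀ R' ≥ R, ∀ x ∈ Ω, ccBall X Ω x R' = Ω := by
  rcases Ω.eq_empty_or_nonempty with rfl | ⟨x₀, hx₀⟩
  · exact ⟨1, one_pos, by simp⟩
  by_cases hb : ∃ R > 0, ∀ y ∈ Ω, ccDist X x₀ y < R
  · obtain ⟨R, hR, hy⟩ := hb
    refine ⟨2 * R, by positivity, fun R' hR' x hx =>
      Set.Subset.antisymm (ccBall_subset _ _ _ _) fun z hz => ⟨hz, ?_⟩⟩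
    have := h.triangle hx hx₀ hz
    rw [h.comm x x₀] at this
    linarith [hy x hx, hy z hz]
  exfalso
  push Not at hb
  set K : ℝ≥0∞ := ENNReal.ofReal (2 ^ Q) ^ 2 with hK
  have hKt : K ≠ ⊤ := by simp [hK]
  have key : ∀ n : ℕ, (K + 1) * volume (ccBall X Ω x₀ n) ≤ K * volume Ω := by
    intro n
    obtain ⟨y, hy, hny⟩ := hb (2 * (n + 1)) (by positivity)
    set s := ccDist X x₀ y with hs
    have hs0 : 0 < s := lt_of_lt_of_le (by positivity) hny
    have hdisj : Disjoint (ccBall X Ω x₀ (s / 2)) (ccBall X Ω y (s / 2)) := by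
      rw [Set.disjoint_left]
      rintro z ⟨hz, h1⟩ ⟨-, h2⟩
      have := h.triangle hx₀ hz hy
      rw [h.comm z y] at this
      linarith
    have hsub : ccBall X Ω x₀ (s / 2) ⊆ ccBall X Ω y (2 ^ 2 * (s / 2)) := by
      rintro z ⟨hz, h1⟩
      refine ⟨hz, ?_⟩
      have := h.triangle hy hx₀ hz
      rw [h.comm y x₀] at this
      linarith
    have h1 : volume (ccBall X Ω x₀ (s / 2)) ≤ K * volume (ccBall X Ω y (s / 2)) :=
      (measure_mono hsub).trans (h.doubling_pow hy (by positivity) 2)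
    have h2 : volume (ccBall X Ω x₀ (s / 2)) + volume (ccBall X Ω y (s / 2)) ≤ volume Ω := by
      rw [← measure_union hdisj (h.isOpen_ball hy _).measurableSet]
      exact measure_mono (Set.union_subset (ccBall_subset _ _ _ _) (ccBall_subset _ _ _ _))
    calc (K + 1) * volume (ccBall X Ω x₀ n)
        ≤ (K + 1) * volume (ccBall X Ω x₀ (s / 2)) := by
          gcongr
          exact ccBall_mono (by linarith)
      _ = K * volume (ccBall X Ω x₀ (s / 2)) + volume (ccBall X Ω x₀ (s / 2)) := by ring
      _ ≤ K * volume (ccBall X Ω x₀ (s / 2)) + K * volume (ccBall X Ω y (s / 2)) := by gcongr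
      _ = K * (volume (ccBall X Ω x₀ (s / 2)) + volume (ccBall X Ω y (s / 2))) := by ring
      _ ≤ K * volume Ω := by gcongr
  have hlim : Tendsto (fun n : ℕ => volume (ccBall X Ω x₀ n)) atTop (𝓝 (volume Ω)) := by
    have hU : ⋃ n : ℕ, ccBall X Ω x₀ n = Ω := by
      refine Set.Subset.antisymm (Set.iUnion_subset fun n => ccBall_subset _ _ _ _) fun z hz => ?_
      obtain ⟨n, hn⟩ := exists_nat_gt (ccDist X x₀ z)
      exact Set.mem_iUnion.2 ⟨n, hz, hn⟩
    have := tendsto_measure_iUnion_atTop (μ := volume) (s := fun n : ℕ => ccBall X Ω x₀ n)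
      (fun a b hab => ccBall_mono (by exact_mod_cast hab))
    rwa [hU] at this
  have h3 := le_of_tendsto' (ENNReal.Tendsto.const_mul hlim (Or.inr (by finiteness))) key
  have hpos : 0 < volume Ω :=
    (h.doubling x₀ hx₀ 1 one_pos).1.trans_le (measure_mono (ccBall_subset _ _ _ _))
  rw [add_mul, one_mul] at h3
  have h4 : K * volume Ω < K * volume Ω + volume Ω :=
    ENNReal.lt_add_right (ENNReal.mul_ne_top hKt h.finite.ne) hpos.ne'
  exact absurd h3 (not_le.2 h4)

/-- Doubling is iterated from radius r until the ball is all of Ω. The factor 2 pays for rounding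
R/r up to a power of 2. -/
theorem volume_le_ball (h : IsDoublingDomain X Ω Q) (hQ : 0 ≤ Q) {R : ℝ}
    (hball : ∀ R' ≥ R, ∀ x ∈ Ω, ccBall X Ω x R' = Ω) {x : Sp N} (hx : x ∈ Ω) {r : ℝ} (hr : 0 < r)
    (hrR : r ≤ R) :
    volume Ω ≤ ENNReal.ofReal ((2 * R / r) ^ Q) * volume (ccBall X Ω x r) := by
  obtain ⟨n, hn, hn'⟩ := exists_nat_pow_near (show 1 ≤ R / r by rwa [one_le_div hr])
    (one_lt_two)
  rw [div_lt_iff₀ hr] at hn'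
  have h1 := h.doubling_pow hx hr (n + 1)
  rw [hball _ hn'.le x hx] at h1
  refine h1.trans ?_
  gcongr
  rw [← ENNReal.ofReal_pow (by positivity)]
  refine ENNReal.ofReal_le_ofReal ?_
  rw [← Real.rpow_natCast, ← Real.rpow_mul (by norm_num), mul_comm Q, Real.rpow_mul (by norm_num),
    Real.rpow_natCast]
  refine Real.rpow_le_rpow (by positivity) ?_ hQ
  rw [pow_succ, mul_comm, mul_div_assoc]
  gcongr

/-! ### The maximal function -/

/-- The uncentred maximal function over control balls. -/
def maxFun (X : Fields m N) (Ω : Set (Sp N)) (f : Sp N → ℝ≥0∞) (x : Sp N) : ℝ≥0∞ :=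
  ⨆ (y : Sp N) (_ : y ∈ Ω) (r : ℝ) (_ : 0 < r) (_ : x ∈ ccBall X Ω y r),
    (∫⁻ z in ccBall X Ω y r, f z) / volume (ccBall X Ω y r)

theorem le_maxFun (f : Sp N → ℝ≥0∞) {x y : Sp N} (hy : y ∈ Ω) {r : ℝ} (hr : 0 < r)
    (hx : x ∈ ccBall X Ω y r) :
    (∫⁻ z in ccBall X Ω y r, f z) / volume (ccBall X Ω y r) ≤ maxFun X Ω f x :=
  le_iSup_of_le y <| le_iSup_of_le hy <| le_iSup_of_le r <| le_iSup_of_le hr <|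
    le_iSup_of_le hx le_rfl

theorem lt_maxFun_iff {f : Sp N → ℝ≥0∞} {x : Sp N} {t : ℝ≥0∞} :
    t < maxFun X Ω f x ↔ ∃ y ∈ Ω, ∃ r, 0 < r ∧ x ∈ ccBall X Ω y r ∧
      t < (∫⁻ z in ccBall X Ω y r, f z) / volume (ccBall X Ω y r) := by
  simp only [maxFun, lt_iSup_iff, exists_prop]

theorem measurable_maxFun (h : IsDoublingDomain X Ω Q) (f : Sp N → ℝ≥0∞) :
    Measurable (maxFun X Ω f) := by
  refine LowerSemicontinuous.measurable fun x t ht => ?_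
  obtain ⟨y, hy, r, hr, hx, hlt⟩ := lt_maxFun_iff.1 ht
  filter_upwards [(h.isOpen_ball hy r).mem_nhds hx] with z hz
  exact lt_maxFun_iff.2 ⟨y, hy, r, hr, hz, hlt⟩

theorem maxFun_le {f : Sp N → ℝ≥0∞} {C : ℝ≥0∞} (hf : ∀ x, f x ≤ C)
    (x : Sp N) : maxFun X Ω f x ≤ C := by
  refine iSup_le fun y => iSup_le fun hy => iSup_le fun r => iSup_le fun hr => iSup_le fun _ => ?_
  refine ENNReal.div_le_of_le_mul ?_
  refine (lintegral_mono hf).trans ?_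
  simp

theorem maxFun_le_add (h : IsDoublingDomain X Ω Q) {f g : Sp N → ℝ≥0∞} {C : ℝ≥0∞}
    (hf : ∀ x, f x ≤ g x + C) (x : Sp N) : maxFun X Ω f x ≤ maxFun X Ω g x + C := by
  refine iSup_le fun y => iSup_le fun hy => iSup_le fun r => iSup_le fun hr => iSup_le fun hx => ?_
  have h0 := (h.doubling y hy r hr).1
  have h1 := h.volume_ball_lt_top y r
  calc (∫⁻ z in ccBall X Ω y r, f z) / volume (ccBall X Ω y r)
      ≤ (∫⁻ z in ccBall X Ω y r, (g z + C)) / volume (ccBall X Ω y r) := by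
        gcongr
        exact hf _
    _ = (∫⁻ z in ccBall X Ω y r, g z) / volume (ccBall X Ω y r) + C := by
        rw [lintegral_add_right _ measurable_const, ENNReal.add_div, setLIntegral_const,
          ENNReal.mul_div_cancel_right h0.ne' h1.ne]
    _ ≤ maxFun X Ω g x + C := by
        gcongr
        exact le_maxFun g hy hr hx

/-- The weak type `(1,1)` inequality. -/
theorem mul_volume_lt_maxFun_le (h : IsDoublingDomain X Ω Q) (f : Sp N → ℝ≥0∞) (t : ℝ≥0∞) :
    t * volume {x | t < maxFun X Ω f x} ≤ ENNReal.ofReal (2 ^ Q) ^ 2 * ∫⁻ x in Ω, f x := by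
  obtain ⟨R, hR, hball⟩ := h.exists_ball_eq
  let B : Sp N × ℝ → Set (Sp N) := fun a => ccBall X Ω a.1 a.2
  let I : Set (Sp N × ℝ) := {a | a.1 ∈ Ω ∧ 0 < a.2 ∧ a.2 ≤ R ∧
    t < (∫⁻ z in B a, f z) / volume (B a)}
  -- Restricting to radii at most R loses nothing, since all larger balls equal Ω. If a ball of
  -- radius r' meets a selected ball of radius ρ with r' ≤ 3ρ/2, its points are within ρ + 2r' ≤ 4ρ
  -- of the selected centre. This accounts for the dilation 2² and the two doublings.
  obtain ⟨u, huI, hdisj, hcov⟩ := Vitali.exists_disjoint_subfamily_covering_enlargement B I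
    (fun a => a.2) (3 / 2) (by norm_num) (fun a ha => ha.2.1.le) R (fun a ha => ha.2.2.1)
    (fun a ha => ⟨a.1, mem_ccBall_self ha.1 ha.2.1⟩)
  have hcount : u.Countable := hdisj.countable_of_isOpen
    (fun a ha => h.isOpen_ball (huI ha).1 _)
    (fun a ha => ⟨a.1, mem_ccBall_self (huI ha).1 (huI ha).2.1⟩)
  have hsub : {x | t < maxFun X Ω f x} ⊆ ⋃ a ∈ u, ccBall X Ω a.1 (2 ^ 2 * a.2) := by
    intro x hx
    obtain ⟨y, hy, r, hr, hxy, hlt⟩ := lt_maxFun_iff.1 hx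
    obtain ⟨r', hr', hr'R, heq⟩ : ∃ r', 0 < r' ∧ r' ≤ R ∧ ccBall X Ω y r = ccBall X Ω y r' := by
      rcases le_total r R with h' | h'
      · exact ⟨r, hr, h', rfl⟩
      · exact ⟨R, hR, le_rfl, by rw [hball r h' y hy, hball R le_rfl y hy]⟩
    rw [heq] at hxy hlt
    obtain ⟨b, hbu, ⟨z, hz1, hz2⟩, hle⟩ := hcov (y, r') ⟨hy, hr', hr'R, hlt⟩
    simp only at hle
    have hb := huI hbu
    refine Set.mem_biUnion hbu ⟨hxy.1, ?_⟩
    have t1 := h.triangle hb.1 hz1.1 hxy.1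
    have t2 := h.triangle hz1.1 hy hxy.1
    rw [h.comm z y] at t2
    have a1 : ccDist X y x < r' := hxy.2
    have a2 : ccDist X y z < r' := hz1.2
    have a3 : ccDist X b.1 z < b.2 := hz2.2
    linarith
  calc t * volume {x | t < maxFun X Ω f x}
      ≤ t * ∑' a : u, volume (ccBall X Ω a.1.1 (2 ^ 2 * a.1.2)) := by
        gcongr
        exact (measure_mono hsub).trans (measure_biUnion_le _ hcount _)
    _ ≤ t * ∑' a : u, ENNReal.ofReal (2 ^ Q) ^ 2 * volume (B a.1) := by
        gcongr with a
        exact h.doubling_pow (huI a.2).1 (huI a.2).2.1 2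
    _ = ENNReal.ofReal (2 ^ Q) ^ 2 * ∑' a : u, t * volume (B a.1) := by
        rw [ENNReal.tsum_mul_left, ENNReal.tsum_mul_left]
        ring
    _ ≤ ENNReal.ofReal (2 ^ Q) ^ 2 * ∑' a : u, ∫⁻ z in B a.1, f z := by
        gcongr with a
        obtain ⟨h1, h2, -, h4⟩ := huI a.2
        exact ENNReal.mul_le_of_le_div h4.le
    _ = ENNReal.ofReal (2 ^ Q) ^ 2 * ∫⁻ z in ⋃ a ∈ u, B a, f z := by
        rw [lintegral_biUnion hcount (fun a ha => (h.isOpen_ball (huI ha).1 _).measurableSet) hdisj]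
    _ ≤ ENNReal.ofReal (2 ^ Q) ^ 2 * ∫⁻ x in Ω, f x := by
        gcongr
        exact Set.iUnion₂_subset fun a _ => ccBall_subset _ _ _ _

/-- The strong type `(2,2)` inequality. -/
theorem lintegral_maxFun_sq_le (h : IsDoublingDomain X Ω Q) {f : Sp N → ℝ} (hf : Measurable f)
    {C : ℝ} (hfC : ∀ x, f x ≤ C) :
    ∫⁻ x in Ω, maxFun X Ω (fun x => ENNReal.ofReal (f x)) x ^ 2 ≤
      8 * ENNReal.ofReal (2 ^ Q) ^ 2 * ∫⁻ x in Ω, ENNReal.ofReal (f x) ^ 2 := by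
  set F : Sp N → ℝ≥0∞ := fun x => ENNReal.ofReal (f x) with hF
  set K := ENNReal.ofReal (2 ^ Q) ^ 2 with hK
  have hFm : Measurable F := hf.ennreal_ofReal
  -- Since f is bounded above, the maximal function is finite and `toReal` loses no information.
  have hMt : ∀ x, maxFun X Ω F x ≠ ⊤ := fun x =>
    ((maxFun_le (C := ENNReal.ofReal C) (fun x => ENNReal.ofReal_le_ofReal (hfC x)) x).trans_lt
      ENNReal.ofReal_lt_top).ne
  have hlevel : ∀ t > 0, volume.restrict Ω {x | t < (maxFun X Ω F x).toReal} * ENNReal.ofReal t ≤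
      2 * K * ∫⁻ x in Ω, Set.indicator {p : ℝ × Sp N | p.1 < 2 * f p.2} (fun p => F p.2) (t, x) := by
    intro t ht
    -- The part of F above height t/2. The remainder adds at most t/2 to the maximal function, so
    -- where that of F exceeds t, that of g exceeds t/2, and the weak type bound is applied to g
    -- alone.
    set g : Sp N → ℝ≥0∞ := fun x =>
      Set.indicator {p : ℝ × Sp N | p.1 < 2 * f p.2} (fun p => F p.2) (t, x) with hg
    have hle : ∀ x, F x ≤ g x + ENNReal.ofReal (t / 2) := by
      intro x
      by_cases hx : t < 2 * f x
      · simp [hg, Set.indicator, hx]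
      · have : f x ≤ t / 2 := by linarith
        simpa [hg, Set.indicator, hx, hF] using ENNReal.ofReal_le_ofReal this
    have hsub : {x | t < (maxFun X Ω F x).toReal} ⊆
        {x | ENNReal.ofReal (t / 2) < maxFun X Ω g x} := by
      intro x hx
      have h1 : ENNReal.ofReal t < maxFun X Ω F x :=
        (ENNReal.ofReal_lt_iff_lt_toReal ht.le (hMt x)).2 hx
      have h2 := h1.trans_le (h.maxFun_le_add hle x)
      have h3 : ENNReal.ofReal t = ENNReal.ofReal (t / 2) + ENNReal.ofReal (t / 2) := by
        rw [← ENNReal.ofReal_add (by positivity) (by positivity)]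
        ring_nf
      rw [h3] at h2
      exact (ENNReal.add_lt_add_iff_right ENNReal.ofReal_ne_top).1 h2
    have h4 := h.mul_volume_lt_maxFun_le g (ENNReal.ofReal (t / 2))
    have h5 : ENNReal.ofReal t = 2 * ENNReal.ofReal (t / 2) := by
      rw [← ENNReal.ofReal_ofNat, ← ENNReal.ofReal_mul (by norm_num)]
      ring_nf
    calc volume.restrict Ω {x | t < (maxFun X Ω F x).toReal} * ENNReal.ofReal t
        ≤ volume {x | ENNReal.ofReal (t / 2) < maxFun X Ω g x} * ENNReal.ofReal t := by
          exact mul_le_mul' ((Measure.restrict_apply_le _ _).trans (measure_mono hsub)) le_rfl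
      _ = 2 * (ENNReal.ofReal (t / 2) * volume {x | ENNReal.ofReal (t / 2) < maxFun X Ω g x}) := by
          rw [h5]; ring
      _ ≤ 2 * (K * ∫⁻ x in Ω, g x) := by gcongr
      _ = _ := by ring
  have hcake := lintegral_rpow_eq_lintegral_meas_lt_mul (volume.restrict Ω)
    (f := fun x => (maxFun X Ω F x).toReal) (Eventually.of_forall fun _ => ENNReal.toReal_nonneg)
    (h.measurable_maxFun F).ennreal_toReal.aemeasurable (p := 2) (by norm_num)
  have hA : MeasurableSet {p : ℝ × Sp N | p.1 < 2 * f p.2} :=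
    measurableSet_lt measurable_fst ((hf.comp measurable_snd).const_mul 2)
  -- The constant 8 is a product of three factors 2: from the layer cake formula, from halving t,
  -- and from the length 2f(x) of the interval of t that remains after exchanging the integrals.
  calc ∫⁻ x in Ω, maxFun X Ω F x ^ 2
      = ∫⁻ x in Ω, ENNReal.ofReal ((maxFun X Ω F x).toReal ^ (2 : ℝ)) := by
        refine lintegral_congr fun x => ?_
        rw [Real.rpow_ofNat, ENNReal.ofReal_pow ENNReal.toReal_nonneg, ENNReal.ofReal_toReal (hMt x)]
    _ = ENNReal.ofReal 2 * ∫⁻ t in Set.Ioi (0 : ℝ),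
          volume.restrict Ω {x | t < (maxFun X Ω F x).toReal} * ENNReal.ofReal (t ^ (2 - 1 : ℝ)) :=
        hcake
    _ ≤ ENNReal.ofReal 2 * ∫⁻ t in Set.Ioi (0 : ℝ), 2 * K * ∫⁻ x in Ω,
          Set.indicator {p : ℝ × Sp N | p.1 < 2 * f p.2} (fun p => F p.2) (t, x) := by
        gcongr 1
        refine setLIntegral_mono' measurableSet_Ioi fun t ht => ?_
        have h1 : (2 - 1 : ℝ) = 1 := by norm_num
        rw [h1, Real.rpow_one]
        exact hlevel t ht
    _ = ENNReal.ofReal 2 * (2 * K * ∫⁻ x in Ω, ∫⁻ t in Set.Ioi (0 : ℝ),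
          Set.indicator {p : ℝ × Sp N | p.1 < 2 * f p.2} (fun p => F p.2) (t, x)) := by
        rw [lintegral_const_mul' _ _ (by finiteness), lintegral_lintegral_swap]
        exact ((hFm.comp measurable_snd).indicator hA).aemeasurable
    _ = ENNReal.ofReal 2 * (2 * K * ∫⁻ x in Ω, 2 * F x ^ 2) := by
        congr 3 with x
        have h1 : ∀ t : ℝ, Set.indicator {p : ℝ × Sp N | p.1 < 2 * f p.2} (fun p => F p.2) (t, x) =
            Set.indicator (Set.Iio (2 * f x)) (fun _ => F x) t := fun t => rfl
        simp_rw [h1]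
        rw [lintegral_indicator measurableSet_Iio, Measure.restrict_restrict measurableSet_Iio,
          setLIntegral_const, Set.Iio_inter_Ioi, Real.volume_Ioo, sub_zero,
          ENNReal.ofReal_mul (by norm_num), ENNReal.ofReal_ofNat]
        ring
    _ = 8 * K * ∫⁻ x in Ω, F x ^ 2 := by
        rw [lintegral_const_mul' _ _ (by finiteness), ENNReal.ofReal_ofNat]
        ring

end IsDoublingDomain

/-! ### Integration by parts along a Lipschitz field -/

theorem hasCompactSupport_of_support_subset_closedBall {η : Sp N → ℝ} {z : Sp N} {ρ : ℝ}
    (h : Function.support η ⊆ Metric.closedBall z ρ) : HasCompactSupport η :=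
  HasCompactSupport.intro (isCompact_closedBall z ρ) fun _ hx =>
    Function.notMem_support.1 fun h' => hx (h h')

theorem exists_lipschitzWith_mul {η w : Sp N → ℝ} {z : Sp N} {ρ : ℝ} (hη : ContDiff ℝ 1 η)
    (hsupp : Function.support η ⊆ Metric.closedBall z ρ) {K : ℝ≥0} (hw : LipschitzWith K w) :
    ∃ L, LipschitzWith L (fun y => η y * w y) := by
  have hc := hasCompactSupport_of_support_subset_closedBall hsupp
  obtain ⟨L, hL⟩ : ∃ L, LipschitzWith L η :=
    ⟨_, (ContDiff.lipschitzWith_of_hasCompactSupport hc hη one_ne_zero).choose_spec⟩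
  obtain ⟨B, hB⟩ := hc.exists_bound_of_continuous hη.continuous
  obtain ⟨B', hB'⟩ := (isCompact_closedBall z ρ).exists_bound_of_continuousOn
    hw.continuous.continuousOn
  have hB0 : 0 ≤ B := (norm_nonneg _).trans (hB z)
  -- Since w may be unbounded off the ball, the product difference is split so that w is evaluated
  -- only at the point known to lie in the ball.
  have key : ∀ x y, x ∈ Metric.closedBall z ρ →
      |η x * w x - η y * w y| ≤ (L * B' + B * K) * dist x y := by
    intro x y hx
    have e : η x * w x - η y * w y = (η x - η y) * w x + η y * (w x - w y) := by ring
    have h1 : |η x - η y| ≤ L * dist x y := by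
      simpa [Real.dist_eq] using hL.dist_le_mul x y
    have h2 : |w x - w y| ≤ K * dist x y := by
      simpa [Real.dist_eq] using hw.dist_le_mul x y
    have h3 : |w x| ≤ B' := hB' x hx
    have h4 : |η y| ≤ B := hB y
    rw [e]
    refine (abs_add_le _ _).trans ?_
    rw [abs_mul, abs_mul]
    calc |η x - η y| * |w x| + |η y| * |w x - w y|
        ≤ (L * dist x y) * B' + B * (K * dist x y) := by gcongr
      _ = _ := by ring
  refine ⟨(L * B' + B * K).toNNReal, LipschitzWith.of_dist_le_mul fun x y => ?_⟩
  rw [Real.dist_eq]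
  have hle : L * B' + B * K ≤ ((L * B' + B * K).toNNReal : ℝ) := Real.le_coe_toNNReal _
  have h0 : ∀ u, u ∉ Metric.closedBall z ρ → η u = 0 := fun u hu =>
    Function.notMem_support.1 fun h' => hu (hsupp h')
  by_cases hx : x ∈ Metric.closedBall z ρ
  · exact (key x y hx).trans (by gcongr)
  by_cases hy : y ∈ Metric.closedBall z ρ
  · rw [abs_sub_comm, dist_comm]
    exact (key y x hy).trans (by gcongr)
  · rw [h0 x hx, h0 y hy]
    simp only [zero_mul, sub_self, abs_zero]
    positivity

theorem ae_lineDeriv_mul {η w : Sp N → ℝ} (hη : ContDiff ℝ 1 η) {K : ℝ≥0}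
    (hw : LipschitzWith K w) (v : Sp N) :
    ∀ᵐ y, lineDeriv ℝ (fun y => η y * w y) y v =
      η y * lineDeriv ℝ w y v + fderiv ℝ η y v * w y := by
  filter_upwards [hw.ae_differentiableAt] with y hy
  have h1 : DifferentiableAt ℝ η y := (hη.differentiable one_ne_zero) y
  rw [(h1.fun_mul hy).lineDeriv_eq_fderiv, hy.lineDeriv_eq_fderiv, fderiv_fun_mul h1 hy]
  simp only [add_apply, smul_apply, smul_eq_mul]
  ring

theorem integrable_lineDeriv_of_support_subset {g : Sp N → ℝ} {L : ℝ≥0} (hg : LipschitzWith L g)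
    {z : Sp N} {ρ : ℝ} (hsupp : Function.support g ⊆ Metric.closedBall z ρ) (v : Sp N) :
    Integrable (fun y => lineDeriv ℝ g y v) := by
  have h1 := (hg.locallyIntegrable_lineDeriv (μ := volume) v).integrableOn_isCompact
    (isCompact_closedBall z ρ)
  rwa [integrableOn_iff_integrable_of_support_subset] at h1
  intro y hy
  by_contra hcon
  refine hy ?_
  have h2 : g =ᶠ[𝓝 y] fun _ => 0 := by
    filter_upwards [Metric.isClosed_closedBall.isOpen_compl.mem_nhds hcon] with u hu
    exact Function.notMem_support.1 fun h' => hu (hsupp h')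
  have h3 := h2.lineDeriv_eq (𝕜 := ℝ) (v := v)
  refine h3.trans ?_
  simp [lineDeriv]

theorem fderiv_apply_eq_sum {f : Sp N → ℝ} {y : Sp N} (hf : DifferentiableAt ℝ f y) (v : Sp N) :
    fderiv ℝ f y v = ∑ k, lineDeriv ℝ f y (EuclideanSpace.basisFun (Fin N) ℝ k) * v k := by
  conv_lhs => rw [← (EuclideanSpace.basisFun (Fin N) ℝ).sum_repr v]
  rw [map_sum]
  refine Finset.sum_congr rfl fun k _ => ?_
  rw [map_smul, hf.lineDeriv_eq_fderiv, smul_eq_mul, mul_comm, EuclideanSpace.basisFun_repr]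

/-- A substitute for the divergence of `η V`, for `V` locally Lipschitz. -/
theorem exists_divergence_bound {V : Sp N → Sp N} (hV : LocallyLipschitz V) (z : Sp N) (ρ : ℝ) :
    ∃ C : ℝ, 0 ≤ C ∧ ∀ η : Sp N → ℝ, ContDiff ℝ 1 η →
      Function.support η ⊆ Metric.closedBall z ρ →
      ∃ D : Sp N → ℝ, Integrable D ∧ (∀ᵐ y, |D y - fderiv ℝ η y (V y)| ≤ C * |η y|) ∧
        ∀ ψ : Sp N → ℝ, ContDiff ℝ 1 ψ → (∃ L, LipschitzWith L ψ) → (∃ B, ∀ y, ‖ψ y‖ ≤ B) →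
          ∫ y, fderiv ℝ ψ y (V y) * η y = -∫ y, ψ y * D y := by
  obtain ⟨K, hK⟩ := (hV.locallyLipschitzOn (s := Metric.closedBall z ρ)).exists_lipschitzOnWith_of_compact
    (isCompact_closedBall z ρ)
  -- Each coordinate of V is Lipschitz on the ball and extends to a globally Lipschitz function,
  -- with no change where η lives. The constant K depends on V and the ball but not on η, so η may
  -- later be chosen in terms of it.
  have hcoord : ∀ k : Fin N, ∃ w : Sp N → ℝ, LipschitzWith K w ∧
      Set.EqOn (fun y => V y k) w (Metric.closedBall z ρ) := by
    intro k
    refine LipschitzOnWith.extend_real (LipschitzOnWith.of_dist_le_mul fun x hx y hy => ?_)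
    refine le_trans ?_ (hK.dist_le_mul x hx y hy)
    rw [dist_eq_norm, dist_eq_norm]
    exact PiLp.norm_apply_le (V x - V y) k
  choose w hw hVw using hcoord
  set e := EuclideanSpace.basisFun (Fin N) ℝ with he
  refine ⟨N * K, by positivity, fun η hη hsupp => ?_⟩
  have hη0 : ∀ u, u ∉ Metric.closedBall z ρ → η u = 0 := fun u hu =>
    Function.notMem_support.1 fun h' => hu (hsupp h')
  have hg : ∀ k, ∃ L, LipschitzWith L (fun y => η y * w k y) := fun k =>
    exists_lipschitzWith_mul hη hsupp (hw k)
  have hgs : ∀ k, Function.support (fun y => η y * w k y) ⊆ Metric.closedBall z ρ := fun k =>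
    (Function.support_mul_subset_left _ _).trans hsupp
  have hint : ∀ k, Integrable (fun y => lineDeriv ℝ (fun y => η y * w k y) y (e k)) := fun k =>
    integrable_lineDeriv_of_support_subset (hg k).choose_spec (hgs k) _
  -- D is the almost everywhere divergence of ηw. It differs from the derivative of η along V by η
  -- div w, and |div w| ≤ NK.
  refine ⟨fun y => ∑ k, lineDeriv ℝ (fun y => η y * w k y) y (e k),
    integrable_finsetSum _ fun k _ => hint k, ?_, ?_⟩
  · have hall := ae_all_iff.2 fun k => ae_lineDeriv_mul hη (hw k) (e k)
    filter_upwards [hall] with y hy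
    have h1 : fderiv ℝ η y (V y) = ∑ k, fderiv ℝ η y (e k) * w k y := by
      rw [fderiv_apply_eq_sum (hη.differentiable one_ne_zero y)]
      refine Finset.sum_congr rfl fun k _ => ?_
      rw [(hη.differentiable one_ne_zero y).lineDeriv_eq_fderiv]
      by_cases hyb : y ∈ Metric.closedBall z ρ
      · rw [← hVw k hyb]
      · have h2 : η =ᶠ[𝓝 y] fun _ => 0 := by
          filter_upwards [Metric.isClosed_closedBall.isOpen_compl.mem_nhds hyb] with u hu
          exact hη0 u hu
        rw [h2.fderiv_eq]
        simp
    rw [h1, ← Finset.sum_sub_distrib]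
    refine (Finset.abs_sum_le_sum_abs _ _).trans ?_
    have h3 : ∀ k ∈ Finset.univ, |lineDeriv ℝ (fun y => η y * w k y) y (e k) -
        fderiv ℝ η y (e k) * w k y| ≤ K * |η y| := by
      intro k _
      rw [hy k, add_sub_cancel_right, abs_mul, mul_comm]
      gcongr
      have := norm_lineDeriv_le_of_lipschitz ℝ (hw k) (x₀ := y) (v := e k)
      simpa [he] using this
    refine (Finset.sum_le_sum h3).trans_eq ?_
    simp [mul_assoc]
  · rintro ψ hψ ⟨L, hL⟩ ⟨B, hB⟩
    have h1 : ∀ y, fderiv ℝ ψ y (V y) * η y =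
        ∑ k, lineDeriv ℝ ψ y (e k) * (η y * w k y) := by
      intro y
      rw [fderiv_apply_eq_sum (hψ.differentiable one_ne_zero y), Finset.sum_mul]
      refine Finset.sum_congr rfl fun k _ => ?_
      by_cases hyb : y ∈ Metric.closedBall z ρ
      · rw [← hVw k hyb]
        ring
      · rw [hη0 y hyb]
        ring
    simp_rw [h1, Finset.mul_sum]
    rw [integral_finsetSum, integral_finsetSum, ← Finset.sum_neg_distrib]
    · refine Finset.sum_congr rfl fun k _ => ?_
      rw [hL.integral_lineDeriv_mul_eq (hg k).choose_spec
        (hasCompactSupport_of_support_subset_closedBall (hgs k)), ← integral_neg]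
      refine integral_congr_ae (Eventually.of_forall fun y => ?_)
      simp only [lineDeriv_neg]
      ring
    · intro k _
      exact (hint k).bdd_mul (c := B) hψ.continuous.aestronglyMeasurable (Eventually.of_forall hB)
    · intro k _
      refine Continuous.integrable_of_hasCompactSupport ?_ ?_
      · have : (fun y => lineDeriv ℝ ψ y (e k)) = fun y => fderiv ℝ ψ y (e k) := by
          funext y
          exact (hψ.differentiable one_ne_zero y).lineDeriv_eq_fderiv
        have hc : Continuous fun y => lineDeriv ℝ ψ y (e k) := by
          rw [this]
          exact (hψ.continuous_fderiv one_ne_zero).clm_apply continuous_const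
        exact hc.mul (hη.continuous.mul (hw k).continuous)
      · exact (hasCompactSupport_of_support_subset_closedBall (hgs k)).mul_left

/-! ### Fields along which the indicator function of `Ω` is invariant are tangent to `∂Ω` -/

theorem hasDerivAt_max_zero_sq (s : ℝ) :
    HasDerivAt (fun s : ℝ => max s 0 ^ 2) (2 * max s 0) s := by
  rcases lt_trichotomy s 0 with h | rfl | h
  · rw [max_eq_right h.le, mul_zero]
    refine (hasDerivAt_const s (0 : ℝ)).congr_of_eventuallyEq ?_
    filter_upwards [Iio_mem_nhds h] with t ht
    simp [max_eq_right (Set.mem_Iio.1 ht).le]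
  · have h1 : HasDerivAt (fun s : ℝ => s ^ 2) 0 0 := by simpa using hasDerivAt_pow 2 (0 : ℝ)
    rw [max_self, mul_zero]
    rw [hasDerivAt_iff_isLittleO] at h1 ⊢
    refine Asymptotics.IsBigO.trans_isLittleO (Asymptotics.IsBigO.of_bound 1 ?_) h1
    refine Eventually.of_forall fun t => ?_
    simp only [max_self, smul_zero, sub_zero, one_mul, Real.norm_eq_abs]
    simp only [ne_eq, OfNat.ofNat_ne_zero, not_false_eq_true, zero_pow, sub_zero, abs_pow, sq_abs]
    rcases le_total t 0 with h | h
    · simp [max_eq_right h, sq_nonneg]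
    · simp [max_eq_left h]
  · rw [max_eq_left h.le]
    have h1 : HasDerivAt (fun s : ℝ => s ^ 2) (2 * s) s := by simpa using hasDerivAt_pow 2 s
    refine h1.congr_of_eventuallyEq ?_
    filter_upwards [Ioi_mem_nhds h] with t ht
    simp [max_eq_left (Set.mem_Ioi.1 ht).le]

/-- Squaring makes the positive part C¹. The derivative is of first order in the positive part and
the function of second order, so near the edge of the support the divergence error, proportional to
the function, is dominated by the derivative. -/
theorem contDiff_max_zero_sq : ContDiff ℝ 1 (fun s : ℝ => max s 0 ^ 2) := by
  rw [contDiff_one_iff_deriv]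
  refine ⟨fun s => (hasDerivAt_max_zero_sq s).differentiableAt, ?_⟩
  have : deriv (fun s : ℝ => max s 0 ^ 2) = fun s => 2 * max s 0 := by
    funext s
    exact (hasDerivAt_max_zero_sq s).deriv
  rw [this]
  fun_prop

/-- If test functions converge to `1` in `Ω` and their derivatives along `V` converge to `0`, then
the weak divergence of a compactly supported multiple of `V` has vanishing integral over `Ωᶜ`. -/
theorem integral_compl_divergence_eq_zero {Ω : Set (Sp N)} (hΩ : MeasurableSet Ω)
    (hΩfin : volume Ω < ⊤) {V : Sp N → Sp N} {φ : ℕ → Sp N → ℝ}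
    (hφ : ∀ n, IsTest Ω (φ n))
    (h1 : Tendsto (fun n => ∫ y in Ω, |φ n y - 1|) atTop (𝓝 0))
    (hVint : ∀ n, IntegrableOn (fun y => fderiv ℝ (φ n) y (V y)) Ω)
    (h2 : Tendsto (fun n => ∫ y in Ω, |fderiv ℝ (φ n) y (V y)|) atTop (𝓝 0))
    {η D : Sp N → ℝ} {B : ℝ} (hηB : ∀ y, |η y| ≤ B) (hD : Integrable D)
    (hDB : ∀ᵐ y, |D y| ≤ B)
    (hparts : ∀ ψ : Sp N → ℝ, ContDiff ℝ 1 ψ → (∃ L, LipschitzWith L ψ) → (∃ B, ∀ y, ‖ψ y‖ ≤ B) →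
          ∫ y, fderiv ℝ ψ y (V y) * η y = -∫ y, ψ y * D y) :
    ∫ y in Ωᶜ, D y = 0 := by
  have hB : 0 ≤ B := (abs_nonneg _).trans (hηB 0)
  have hone : ∫ y, D y = 0 := by
    have := hparts (fun _ => 1) contDiff_const ⟨0, LipschitzWith.const _⟩ ⟨1, fun _ => by simp⟩
    simpa using this.symm
  have hφc : ∀ n, Integrable (φ n) := fun n =>
    (hφ n).1.continuous.integrable_of_hasCompactSupport (hφ n).2.1
  have hφbd : ∀ n, ∃ C, ∀ y, ‖φ n y‖ ≤ C := fun n =>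
    (hφ n).2.1.exists_bound_of_continuous (hφ n).1.continuous
  have hsub : ∀ n y, y ∉ Ω → φ n y = 0 := fun n y hy => by
    by_contra h
    exact hy ((hφ n).2.2 (subset_tsupport _ h))
  have hsub' : ∀ n y, y ∉ Ω → fderiv ℝ (φ n) y = 0 := fun n y hy => by
    by_contra h
    exact hy ((hφ n).2.2 (support_fderiv_subset ℝ h))
  -- With ψ = 1, integration by parts gives ∫D = 0; with ψ = φ_n it gives ∫_Ω φ_n D = -∫_Ω (Vφ_n)η.
  -- Hence the integral of D over Ωᶜ equals ∫_Ω (φ_n - 1)D + ∫_Ω (Vφ_n)η, and both terms tend to 0.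
  have hbound : ∀ n, |∫ y in Ωᶜ, D y| ≤
      B * (∫ y in Ω, |φ n y - 1|) + B * ∫ y in Ω, |fderiv ℝ (φ n) y (V y)| := by
    intro n
    obtain ⟨C, hC⟩ := hφbd n
    have hψD : Integrable (fun y => φ n y * D y) :=
      hD.bdd_mul (hφ n).1.continuous.aestronglyMeasurable (Eventually.of_forall hC)
    have e1 : ∫ y, fderiv ℝ (φ n) y (V y) * η y = -∫ y, φ n y * D y :=
      hparts (φ n) ((hφ n).1.of_le (by exact_mod_cast le_top))
        ⟨_, (ContDiff.lipschitzWith_of_hasCompactSupport (hφ n).2.1 (hφ n).1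
          (by simp)).choose_spec⟩ ⟨C, hC⟩
    have e2 : ∫ y, fderiv ℝ (φ n) y (V y) * η y = ∫ y in Ω, fderiv ℝ (φ n) y (V y) * η y := by
      refine (setIntegral_eq_integral_of_forall_compl_eq_zero fun y hy => ?_).symm
      simp [hsub' n y hy]
    have e3 : ∫ y, φ n y * D y = ∫ y in Ω, φ n y * D y := by
      refine (setIntegral_eq_integral_of_forall_compl_eq_zero fun y hy => ?_).symm
      simp [hsub n y hy]
    have e4 : (∫ y in Ω, D y) + ∫ y in Ωᶜ, D y = 0 := by
      rw [← hone, integral_add_compl hΩ hD]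
    have e5 : ∫ y in Ω, (φ n y - 1) * D y = (∫ y in Ω, φ n y * D y) - ∫ y in Ω, D y := by
      rw [← integral_sub hψD.integrableOn hD.integrableOn]
      refine integral_congr_ae (Eventually.of_forall fun y => ?_)
      simp only
      ring
    have e6 : ∫ y in Ωᶜ, D y =
        (∫ y in Ω, (φ n y - 1) * D y) + ∫ y in Ω, fderiv ℝ (φ n) y (V y) * η y := by
      rw [← e2, e1, e3, e5]
      linarith
    have hφ1 : IntegrableOn (fun y => |φ n y - 1|) Ω :=
      ((hφc n).integrableOn.sub (integrableOn_const hΩfin.ne)).abs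
    rw [e6]
    refine (abs_add_le _ _).trans (add_le_add ?_ ?_)
    · rw [← integral_const_mul]
      rw [← Real.norm_eq_abs]
      refine (norm_integral_le_of_norm_le (hφ1.const_mul B) ?_)
      filter_upwards [ae_restrict_of_ae hDB] with y hy
      rw [norm_mul, mul_comm]
      gcongr
      · exact hy
      · rfl
    · rw [← integral_const_mul]
      rw [← Real.norm_eq_abs]
      refine (norm_integral_le_of_norm_le ((hVint n).abs.const_mul B) ?_)
      refine Eventually.of_forall fun y => ?_
      rw [norm_mul, mul_comm]
      gcongr
      · exact hηB y
      · rfl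
  have hlim := (h1.const_mul B).add (h2.const_mul B)
  simp only [mul_zero, add_zero] at hlim
  have := ge_of_tendsto' hlim hbound
  exact abs_nonpos_iff.1 this

/-- Suppose V(z) pointed strictly towards x. With δ = |x - z| and h(y) = δ² - |y-x|² - |y-z|², take
the bump η = ((h + ε)⁺)². On S one has |y-x| ≥ δ, so h ≤ -|y-z|² and η is concentrated near z. There
V increases η at first order in h + ε, which beats the divergence error Cη. So the weak divergence
of ηV would have positive integral over Ωᶜ, whereas `integral_compl_divergence_eq_zero` says that it
vanishes. -/
theorem inner_nonpos_of_touching {Ω : Set (Sp N)} (hΩ : MeasurableSet Ω)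
    (hΩfin : volume Ω < ⊤) {V : Sp N → Sp N} (hV : LocallyLipschitz V) {φ : ℕ → Sp N → ℝ}
    (hφ : ∀ n, IsTest Ω (φ n))
    (h1 : Tendsto (fun n => ∫ y in Ω, |φ n y - 1|) atTop (𝓝 0))
    (hVint : ∀ n, IntegrableOn (fun y => fderiv ℝ (φ n) y (V y)) Ω)
    (h2 : Tendsto (fun n => ∫ y in Ω, |fderiv ℝ (φ n) y (V y)|) atTop (𝓝 0))
    {x z : Sp N} (hz : z ∈ (volume.restrict Ωᶜ).support)
    (hx : ∀ y ∈ (volume.restrict Ωᶜ).support, dist x z ≤ dist x y) :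
    inner ℝ (V z) (x - z) ≤ 0 := by
  by_contra! hpos
  set a := inner ℝ (V z) (x - z) with ha
  set δ := dist x z with hδ
  have hδ0 : 0 ≤ δ := dist_nonneg
  obtain ⟨C, hC0, hdiv⟩ := exists_divergence_bound hV z (δ + 1)
  have hcont : Continuous fun y => inner ℝ (V y) ((x - y) + (z - y)) :=
    hV.continuous.inner (by fun_prop)
  obtain ⟨r, hr, hra⟩ : ∃ r > 0, ∀ y, dist y z < r →
      a / 2 < inner ℝ (V y) ((x - y) + (z - y)) := by
    have := hcont.continuousAt (x := z)
    have h3 : a / 2 < inner ℝ (V z) ((x - z) + (z - z)) := by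
      rw [sub_self, add_zero]
      linarith
    exact Metric.eventually_nhds_iff.1 (this.eventually (lt_mem_nhds h3))
  -- The bound 1 keeps the support of η in the ball where C was obtained. The bound r² keeps the
  -- part of it in S where V still points towards x. The last bound gives Cs ≤ a/2 for 0 ≤ s ≤ ε.
  set ε := min (min 1 (r ^ 2)) (a / (2 * (C + 1))) with hε
  have hε0 : 0 < ε := by positivity
  have hε1 : ε ≤ 1 := (min_le_left _ _).trans (min_le_left _ _)
  have hεr : ε ≤ r ^ 2 := (min_le_left _ _).trans (min_le_right _ _)
  have hεa : C * ε ≤ a / 2 := by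
    have : ε ≤ a / (2 * (C + 1)) := min_le_right _ _
    rw [le_div_iff₀ (by positivity)] at this
    nlinarith
  set h : Sp N → ℝ := fun y => δ ^ 2 - ‖y - x‖ ^ 2 - ‖y - z‖ ^ 2 with hh
  have hhd : ∀ y, HasFDerivAt h
      (-(2 • (innerSL ℝ (y - x))) - 2 • (innerSL ℝ (y - z))) y := by
    intro y
    have d1 : HasFDerivAt (fun y => ‖y - x‖ ^ 2) (2 • (innerSL ℝ (y - x))) y := by
      simpa using ((hasFDerivAt_id y).sub_const x).norm_sq
    have d2 : HasFDerivAt (fun y => ‖y - z‖ ^ 2) (2 • (innerSL ℝ (y - z))) y := by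
      simpa using ((hasFDerivAt_id y).sub_const z).norm_sq
    exact (d1.const_sub _).sub d2
  set η : Sp N → ℝ := fun y => max (h y + ε) 0 ^ 2 with hη
  have hhc : ContDiff ℝ 1 h := by
    have d1 : ContDiff ℝ 1 (fun y : Sp N => ‖y - x‖ ^ 2) := (contDiff_id.sub contDiff_const).norm_sq ℝ
    have d2 : ContDiff ℝ 1 (fun y : Sp N => ‖y - z‖ ^ 2) := (contDiff_id.sub contDiff_const).norm_sq ℝ
    exact (contDiff_const.sub d1).sub d2
  have hηc : ContDiff ℝ 1 η := contDiff_max_zero_sq.comp (hhc.add contDiff_const)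
  have hηd : ∀ y, fderiv ℝ η y (V y) =
      2 * max (h y + ε) 0 * (2 * inner ℝ (V y) ((x - y) + (z - y))) := by
    intro y
    have := (hasDerivAt_max_zero_sq (h y + ε)).comp_hasFDerivAt y ((hhd y).add_const ε)
    rw [HasFDerivAt.fderiv (f := η) this]
    simp only [smul_apply, sub_apply, neg_apply, innerSL_apply_apply, smul_eq_mul, nsmul_eq_mul]
    rw [real_inner_comm (x - y + (z - y)), ← neg_sub y x, ← neg_sub y z, inner_add_left,
      inner_neg_left, inner_neg_left]
    push_cast
    ring
  have hsupp : Function.support η ⊆ Metric.closedBall z (δ + 1) := by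
    intro y hy
    have h3 : 0 < h y + ε := by
      by_contra! hcon
      exact hy (by simp [hη, max_eq_right hcon])
    rw [Metric.mem_closedBall, dist_eq_norm]
    have h4 : ‖y - z‖ ^ 2 ≤ (δ + 1) ^ 2 := by
      simp only [hh] at h3
      nlinarith [sq_nonneg ‖y - x‖]
    exact (abs_le_of_sq_le_sq' h4 (by positivity)).2
  obtain ⟨D, hDint, hDae, hparts⟩ := hdiv η hηc hsupp
  have hηcs := hasCompactSupport_of_support_subset_closedBall hsupp
  obtain ⟨B₁, hB₁⟩ := hηcs.exists_bound_of_continuous hηc.continuous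
  have hfd : Continuous fun y => fderiv ℝ η y (V y) :=
    (hηc.continuous_fderiv one_ne_zero).clm_apply hV.continuous
  have hfdc : HasCompactSupport fun y => fderiv ℝ η y (V y) := by
    refine HasCompactSupport.mono' (hηcs.fderiv ℝ) fun y hy => subset_tsupport _ fun h0 => hy ?_
    simp [h0]
  obtain ⟨B₂, hB₂⟩ := hfdc.exists_bound_of_continuous hfd
  have hB₁0 : 0 ≤ B₁ := (norm_nonneg _).trans (hB₁ z)
  have hB₂0 : 0 ≤ B₂ := (norm_nonneg _).trans (hB₂ z)
  have hzero : ∫ y in Ωᶜ, D y = 0 := by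
    refine integral_compl_divergence_eq_zero hΩ hΩfin hφ h1 hVint h2 (B := B₁ + B₂ + C * B₁)
      (fun y => ?_) hDint ?_ hparts
    · have := hB₁ y
      rw [Real.norm_eq_abs] at this
      nlinarith
    · filter_upwards [hDae] with y hy
      have e1 := hB₁ y
      have e2 := hB₂ y
      rw [Real.norm_eq_abs] at e1 e2
      have e3 : |D y| ≤ |D y - fderiv ℝ η y (V y)| + |fderiv ℝ η y (V y)| := by
        simpa using abs_add_le (D y - fderiv ℝ η y (V y)) (fderiv ℝ η y (V y))
      have e4 : C * |η y| ≤ C * B₁ := by gcongr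
      linarith
  have hpt : ∀ᵐ y ∂(volume.restrict Ωᶜ), a / 2 * max (h y + ε) 0 ≤ D y := by
    filter_upwards [Measure.support_mem_ae (μ := volume.restrict Ωᶜ),
      ae_restrict_of_ae hDae] with y hyS hyD
    rcases le_or_gt (h y + ε) 0 with hle | hlt
    · rw [hηd y] at hyD
      simp only [hη, max_eq_right hle] at hyD ⊢
      simp at hyD
      simp [hyD]
    · have h3 : δ ≤ ‖y - x‖ := by
        rw [← dist_eq_norm, dist_comm]
        exact hx y hyS
      have h3' : δ ^ 2 ≤ ‖y - x‖ ^ 2 := by gcongr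
      have h4 : ‖y - z‖ ^ 2 < r ^ 2 := by
        simp only [hh] at hlt
        linarith
      have h5 := hra y (by rw [dist_eq_norm]; exact lt_of_pow_lt_pow_left₀ 2 hr.le h4)
      have h6 : h y + ε ≤ ε := by
        simp only [hh]
        nlinarith [sq_nonneg ‖y - z‖]
      rw [hηd y] at hyD
      simp only [hη, max_eq_left hlt.le] at hyD ⊢
      set s := h y + ε
      rw [abs_of_nonneg (sq_nonneg s)] at hyD
      have h7 := (abs_le.1 hyD).1
      have h8 : s * (a / 2) ≤ s * inner ℝ (V y) (x - y + (z - y)) := by gcongr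
      have h9 : C * s ^ 2 ≤ s * (a / 2) := by
        calc C * s ^ 2 = s * (C * s) := by ring
          _ ≤ s * (C * ε) := by gcongr
          _ ≤ s * (a / 2) := by gcongr
      nlinarith
  have hD0 : 0 ≤ᵐ[volume.restrict Ωᶜ] D := by
    filter_upwards [hpt] with y hy
    exact le_trans (by positivity) hy
  have hDz := (setIntegral_eq_zero_iff_of_nonneg_ae hD0 hDint.integrableOn).1 hzero
  -- Since z is in the support, the neighbourhood h + ε > 0 meets Ωᶜ in positive measure. But D = 0
  -- almost everywhere on Ωᶜ, and by `hpt` this forces h + ε ≤ 0 there.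
  have hz' := ((Measure.mem_support_iff_forall z).1 hz) {y | 0 < h y + ε} (by
    refine (isOpen_lt continuous_const (by fun_prop)).mem_nhds ?_
    have : h z = 0 := by simp [hh, hδ, dist_eq_norm, norm_sub_rev]
    simp [this, hε0])
  refine hz'.ne' ?_
  rw [← compl_compl {y | 0 < h y + ε}, ← mem_ae_iff]
  filter_upwards [hpt, hDz] with y hy1 hy2
  simp only [Set.mem_compl_iff, Set.mem_ofPred_eq, not_lt]
  by_contra! hcon
  rw [hy2, max_eq_left hcon.le] at hy1
  simp only [Pi.zero_apply] at hy1
  nlinarith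

/-- The hypotheses are invariant under changing the sign of V, so the one-sided bound holds for V
and for -V. -/
theorem inner_eq_zero_of_touching {Ω : Set (Sp N)} (hΩ : MeasurableSet Ω)
    (hΩfin : volume Ω < ⊤) {V : Sp N → Sp N} (hV : LocallyLipschitz V) {φ : ℕ → Sp N → ℝ}
    (hφ : ∀ n, IsTest Ω (φ n))
    (h1 : Tendsto (fun n => ∫ y in Ω, |φ n y - 1|) atTop (𝓝 0))
    (hVint : ∀ n, IntegrableOn (fun y => fderiv ℝ (φ n) y (V y)) Ω)
    (h2 : Tendsto (fun n => ∫ y in Ω, |fderiv ℝ (φ n) y (V y)|) atTop (𝓝 0))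
    {x z : Sp N} (hz : z ∈ (volume.restrict Ωᶜ).support)
    (hx : ∀ y ∈ (volume.restrict Ωᶜ).support, dist x z ≤ dist x y) :
    inner ℝ (V z) (x - z) = 0 := by
  refine le_antisymm (inner_nonpos_of_touching hΩ hΩfin hV hφ h1 hVint h2 hz hx) ?_
  have hV' : LocallyLipschitz fun y => -V y := fun y => by
    obtain ⟨K, t, ht, hK⟩ := hV y
    exact ⟨K, t, ht, hK.neg⟩
  have := inner_nonpos_of_touching hΩ hΩfin hV' hφ h1 (fun n => ?_) ?_ hz hx
  · rw [inner_neg_left] at this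
    linarith
  · simpa using (hVint n).neg
  · simpa using h2

/-- Along a subunit path the distance to `S` satisfies a differential inequality, provided the
fields are tangent to `S` at nearest points and Lipschitz near `Sᶜ`. -/
theorem infDist_le_mul_exp {X : Fields m N} {S : Set (Sp N)}
    (hS : IsClosed S) (hSne : S.Nonempty) {K : ℝ}
    (hlip : ∀ j, ∀ x ∉ S, ∀ z ∈ S, (∀ y ∈ S, dist x z ≤ dist x y) →
      inner ℝ (X j z) (x - z) = 0 ∧ ‖X j x - X j z‖ ≤ K * ‖x - z‖)
    {T : ℝ} (hT : 0 ≤ T) {γ : ℝ → Sp N} (hγ : IsSubunit X Set.univ T γ) :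
    Metric.infDist (γ T) S ≤ Metric.infDist (γ 0) S * Real.exp (m * K * T) := by
  obtain ⟨hac, -, θ, hθ⟩ := hγ
  have hgac : AbsolutelyContinuousOnInterval (fun t => Metric.infDist (γ t) S) 0 T :=
    absolutelyContinuousOnInterval_comp_lipschitz (Metric.lipschitz_infDist_pt S) hac
  refine le_mul_exp_of_ae_deriv_le hT hgac ?_
  filter_upwards [hθ] with t ht g' hg'
  obtain ⟨hθ1, hd⟩ := ht
  -- On S the distance is at its minimum 0, so its derivative, where it exists, is 0. This allows
  -- paths to run through S, as they may because `ccDist` uses paths in all of ℝ^N.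
  by_cases hmem : γ t ∈ S
  · have h0 : Metric.infDist (γ t) S = 0 := Metric.infDist_zero_of_mem hmem
    have hmin : IsLocalMin (fun t => Metric.infDist (γ t) S) t :=
      Eventually.of_forall fun s => by
        simp only [h0]
        exact Metric.infDist_nonneg
    rw [hmin.hasDerivAt_eq_zero hg', h0, mul_zero]
  · obtain ⟨z, hz, hzd⟩ := hS.exists_infDist_eq_dist hSne (γ t)
    have hnear : ∀ y ∈ S, dist (γ t) z ≤ dist (γ t) y := fun y hy => by
      rw [← hzd]
      exact Metric.infDist_le_dist_of_mem hy
    have hpos : 0 < Metric.infDist (γ t) S :=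
      (hS.notMem_iff_infDist_pos hSne).1 hmem
    have hd1 : HasDerivAt (fun s => ‖γ s - z‖ ^ 2)
        (2 * inner ℝ (γ t - z) (∑ j, θ t j • X j (γ t))) t := (hd.sub_const z).norm_sq
    have hd2 : HasDerivAt (fun s => Metric.infDist (γ s) S ^ 2)
        (2 * Metric.infDist (γ t) S * g') t := by
      simpa using hg'.fun_pow 2
    -- For fixed z the smooth function |γ - z|² lies above the squared distance to S and touches it
    -- at time t, so their derivatives agree there.
    have hmin : IsLocalMin (fun s => ‖γ s - z‖ ^ 2 - Metric.infDist (γ s) S ^ 2) t := by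
      refine Eventually.of_forall fun s => ?_
      simp only
      rw [hzd, dist_eq_norm, sub_self, sub_nonneg, ← dist_eq_norm]
      have := Metric.infDist_le_dist_of_mem hz (x := γ s)
      gcongr
      exact Metric.infDist_nonneg
    have h3 := hmin.hasDerivAt_eq_zero (hd1.sub hd2)
    have h4 : Metric.infDist (γ t) S * g' = inner ℝ (γ t - z) (∑ j, θ t j • X j (γ t)) := by
      linarith
    have h5 : inner ℝ (γ t - z) (∑ j, θ t j • X j (γ t)) ≤
        m * K * Metric.infDist (γ t) S ^ 2 := by
      rw [inner_sum]
      have : ∀ j ∈ Finset.univ, inner ℝ (γ t - z) (θ t j • X j (γ t)) ≤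
          K * Metric.infDist (γ t) S ^ 2 := by
        intro j _
        obtain ⟨e1, e2⟩ := hlip j (γ t) hmem z hz hnear
        have e3 : inner ℝ (γ t - z) (X j (γ t)) = inner ℝ (γ t - z) (X j (γ t) - X j z) := by
          rw [inner_sub_right, real_inner_comm (X j z), e1, sub_zero]
        have e4 : θ t j ^ 2 ≤ 1 :=
          (Finset.single_le_sum (f := fun j => θ t j ^ 2) (fun i _ => sq_nonneg _)
            (Finset.mem_univ j)).trans hθ1
        have e5 : |θ t j| ≤ 1 := (sq_le_one_iff_abs_le_one _).1 e4
        rw [inner_smul_right, e3]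
        refine (le_abs_self _).trans ?_
        rw [abs_mul]
        have e6 : |inner ℝ (γ t - z) (X j (γ t) - X j z)| ≤ K * Metric.infDist (γ t) S ^ 2 := by
          refine (abs_real_inner_le_norm _ _).trans ?_
          rw [hzd, dist_eq_norm]
          calc ‖γ t - z‖ * ‖X j (γ t) - X j z‖ ≤ ‖γ t - z‖ * (K * ‖γ t - z‖) := by gcongr
            _ = _ := by ring
        exact (mul_le_of_le_one_left (abs_nonneg _) e5).trans e6
      refine (Finset.sum_le_sum this).trans_eq ?_
      simp [mul_assoc]
    rw [← h4] at h5
    refine le_of_mul_le_mul_left ?_ hpos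
    linarith

/-- Constants cannot be approximated by test functions whose `X`-gradients tend to `0`. -/
theorem not_tendsto_one {X : Fields m N} {Ω : Set (Sp N)} {Q : ℝ} (h : IsDoublingDomain X Ω Q)
    (hN : 0 < N) (hΩne : Ω.Nonempty) (hXloc : ∀ j, LocallyLipschitz (X j))
    (hXlip : ∀ j, ∃ K, LipschitzOnWith K (X j) Ω) {φ : ℕ → Sp N → ℝ} (hφ : ∀ n, IsTest Ω (φ n))
    (h1 : Tendsto (fun n => ∫ y in Ω, |φ n y - 1|) atTop (𝓝 0))
    (h2 : Tendsto (fun n => ∫ y in Ω, ‖xGrad X (φ n) y‖) atTop (𝓝 0)) : False := by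
  have hΩm : MeasurableSet Ω := h.isOpen.measurableSet
  -- S is Ωᶜ with its locally null parts removed. It is disjoint from Ω, and its complement lies in
  -- the closure of Ω, to which the Lipschitz bounds extend by continuity.
  set S := (volume.restrict Ωᶜ : Measure (Sp N)).support with hS
  have hSc : IsClosed S := Measure.isClosed_support
  have hSΩ : ∀ x ∈ Ω, x ∉ S := by
    intro x hx
    rw [hS, Measure.notMem_support_iff_exists]
    exact ⟨Ω, h.isOpen.mem_nhds hx, by simp [Measure.restrict_apply hΩm]⟩
  have hSclos : ∀ x, x ∉ S → x ∈ closure Ω := by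
    intro x hx
    rw [hS, Measure.notMem_support_iff_exists] at hx
    obtain ⟨U, hU, hU0⟩ := hx
    rw [mem_closure_iff_nhds]
    intro W hW
    by_contra hcon
    have hsub : W ∩ U ⊆ U ∩ Ωᶜ := fun y hy => ⟨hy.2, fun hyΩ => hcon ⟨y, hy.1, hyΩ⟩⟩
    rw [Measure.restrict_apply' hΩm.compl] at hU0
    exact (Measure.measure_pos_of_mem_nhds volume (inter_mem hW hU)).ne' (measure_mono_null hsub hU0)
  have hSne : S.Nonempty := by
    refine Measure.nonempty_support ?_
    intro h0
    have h3 : volume (Ωᶜ : Set (Sp N)) = 0 := by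
      rw [← Measure.restrict_apply_univ, h0]; rfl
    have : Nonempty (Fin N) := ⟨⟨0, hN⟩⟩
    have h4 : volume (Set.univ : Set (Sp N)) = ⊤ := measure_univ_of_isAddLeftInvariant volume
    rw [← Set.union_compl_self Ω] at h4
    have h5 := measure_union_le (μ := volume) Ω Ωᶜ
    rw [h4, h3, add_zero] at h5
    exact absurd h.finite (not_lt.2 h5)
  -- The open ball about x reaching to z misses S, so it lies in the closure of Ω; the nearest point
  -- z is on its boundary.
  have hcl : ∀ x ∉ S, ∀ z ∈ S, (∀ y ∈ S, dist x z ≤ dist x y) → z ∈ closure Ω := by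
    intro x hx z hz hxz
    have hball : Metric.ball x (dist x z) ⊆ closure Ω := fun y hy => hSclos y fun hyS =>
      absurd (hxz y hyS) (not_le.2 (by rwa [Metric.mem_ball, dist_comm] at hy))
    have hne : dist x z ≠ 0 := fun h0 => hx (by rwa [dist_eq_zero.1 h0])
    have h3 := closure_mono hball
    rw [closure_closure, closure_ball x hne] at h3
    exact h3 (by simp [dist_comm])
  choose K hK using hXlip
  have hKcl : ∀ j, LipschitzOnWith (K j) (X j) (closure Ω) := fun j =>
    (hK j).closure (h.continuous j).continuousOn
  set L : ℝ := ∑ j, (K j : ℝ) with hL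
  have hcoord : ∀ n j y, |fderiv ℝ (φ n) y (X j y)| ≤ ‖xGrad X (φ n) y‖ := fun n j y =>
    PiLp.norm_apply_le (xGrad X (φ n) y) j
  have hfc : ∀ n j, Continuous fun y => fderiv ℝ (φ n) y (X j y) := fun n j =>
    ((hφ n).1.continuous_fderiv (by simp)).clm_apply (h.continuous j)
  have hfcs : ∀ n j, HasCompactSupport fun y => fderiv ℝ (φ n) y (X j y) := fun n j => by
    refine HasCompactSupport.mono' ((hφ n).2.1.fderiv ℝ) fun y hy => subset_tsupport _ fun h0 => hy ?_
    simp [h0]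
  have hfint : ∀ n j, Integrable fun y => fderiv ℝ (φ n) y (X j y) := fun n j =>
    (hfc n j).integrable_of_hasCompactSupport (hfcs n j)
  have hgint : ∀ n, Integrable fun y => ‖xGrad X (φ n) y‖ := by
    intro n
    refine Continuous.integrable_of_hasCompactSupport ?_ ?_
    · exact ((PiLp.continuous_toLp 2 _).comp (continuous_pi fun j => hfc n j)).norm
    · refine HasCompactSupport.mono' ((hφ n).2.1.fderiv ℝ) fun y hy =>
        subset_tsupport _ fun h0 => hy ?_
      simp only [xGrad, norm_eq_zero]
      ext j
      simp [h0]
  have hlip : ∀ j, ∀ x ∉ S, ∀ z ∈ S, (∀ y ∈ S, dist x z ≤ dist x y) →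
      inner ℝ (X j z) (x - z) = 0 ∧ ‖X j x - X j z‖ ≤ L * ‖x - z‖ := by
    intro j x hx z hz hxz
    constructor
    · refine inner_eq_zero_of_touching hΩm h.finite (hXloc j) hφ h1
        (fun n => (hfint n j).integrableOn) ?_ hz hxz
      refine squeeze_zero (fun n => by positivity) (fun n => ?_) h2
      exact setIntegral_mono (hfint n j).abs.integrableOn (hgint n).integrableOn (hcoord n j)
    · have h3 := (hKcl j).dist_le_mul x (hSclos x hx) z (hcl x hx z hz hxz)
      rw [dist_eq_norm, dist_eq_norm] at h3
      refine h3.trans ?_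
      gcongr
      exact Finset.single_le_sum (f := fun j => (K j : ℝ)) (fun i _ => (K i).2) (Finset.mem_univ j)
  have hL0 : 0 ≤ L := Finset.sum_nonneg fun i _ => (K i).2
  obtain ⟨R, hR, hball⟩ := h.exists_ball_eq
  obtain ⟨x₀, hx₀⟩ := hΩne
  have hpos : 0 < Metric.infDist x₀ S := (hSc.notMem_iff_infDist_pos hSne).1 (hSΩ x₀ hx₀)
  -- A path from y to x₀ of duration less than R exists for every y in Ω, so a single Gronwall
  -- factor serves all of Ω.
  have hlow : ∀ y ∈ Ω, Metric.infDist x₀ S ≤ Metric.infDist y S * Real.exp (m * L * R) := by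
    intro y hy
    have hy' : x₀ ∈ ccBall X Ω y R := by rwa [hball R le_rfl y hy]
    obtain ⟨T, hT, hTR, γ, hγ, g0, g1⟩ := exists_subunit_of_ccDist_lt h.connected hy hx₀ hy'.2
    have h3 := infDist_le_mul_exp hSc hSne hlip hT.le hγ
    rw [g0, g1] at h3
    refine h3.trans ?_
    have := Metric.infDist_nonneg (x := y) (s := S)
    gcongr
  -- S is neither empty nor the whole space, so it has a frontier point. Such a point lies in S and
  -- in the closure of Ω, where the lower bound for the distance persists by continuity.
  obtain ⟨z, hz⟩ : (frontier S).Nonempty := by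
    rw [nonempty_frontier_iff]
    exact ⟨hSne, fun hu => hSΩ x₀ hx₀ (by rw [hu]; trivial)⟩
  have hzS : z ∈ S := hSc.frontier_subset hz
  have hzΩ : z ∈ closure Ω := by
    have h3 : z ∈ closure Sᶜ := by
      rw [← frontier_compl] at hz
      exact frontier_subset_closure hz
    have h4 := closure_mono (show Sᶜ ⊆ closure Ω from fun x hx => hSclos x hx) h3
    rwa [closure_closure] at h4
  have h5 : Metric.infDist x₀ S ≤ Metric.infDist z S * Real.exp (m * L * R) :=
    le_on_closure hlow continuousOn_const
      ((Metric.continuous_infDist_pt S).mul continuous_const).continuousOn hzΩ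
  rw [Metric.infDist_zero_of_mem hzS, zero_mul] at h5
  linarith

/-! ### Test functions -/

theorem continuous_xGrad {X : Fields m N} (hX : ∀ j, Continuous (X j)) {φ : Sp N → ℝ}
    (hφ : ContDiff ℝ ∞ φ) : Continuous (xGrad X φ) :=
  (PiLp.continuous_toLp 2 _).comp
    (continuous_pi fun j => (hφ.continuous_fderiv (by simp)).clm_apply (hX j))

theorem support_xGrad_subset (X : Fields m N) (φ : Sp N → ℝ) :
    Function.support (xGrad X φ) ⊆ tsupport φ := by
  intro y hy
  by_contra h
  refine hy ?_
  have : fderiv ℝ φ y = 0 := by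
    by_contra h'
    exact h (support_fderiv_subset ℝ h')
  ext j
  simp [xGrad, this]

theorem hasCompactSupport_xGrad (X : Fields m N) {φ : Sp N → ℝ} (hφ : HasCompactSupport φ) :
    HasCompactSupport (xGrad X φ) :=
  HasCompactSupport.mono' hφ (support_xGrad_subset X φ)

theorem xGrad_const_mul (X : Fields m N) {φ : Sp N → ℝ} (hφ : Differentiable ℝ φ) (c : ℝ)
    (y : Sp N) : xGrad X (fun y => c * φ y) y = c • xGrad X φ y := by
  ext j
  simp [xGrad, fderiv_const_mul (hφ y)]

theorem xGrad_sub (X : Fields m N) {φ ψ : Sp N → ℝ} (hφ : Differentiable ℝ φ)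
    (hψ : Differentiable ℝ ψ) : xGrad X (φ - ψ) = xGrad X φ - xGrad X ψ := by
  funext y
  ext j
  simp [xGrad, fderiv_sub (hφ y) (hψ y)]

namespace IsTest

variable {X : Fields m N} {Ω : Set (Sp N)} {φ ψ : Sp N → ℝ}

theorem differentiable (hφ : IsTest Ω φ) : Differentiable ℝ φ := hφ.1.differentiable (by simp)

theorem integrable (hφ : IsTest Ω φ) : Integrable φ :=
  hφ.1.continuous.integrable_of_hasCompactSupport hφ.2.1

theorem integrable_xGrad (hφ : IsTest Ω φ) (hX : ∀ j, Continuous (X j)) : Integrable (xGrad X φ) :=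
  (continuous_xGrad hX hφ.1).integrable_of_hasCompactSupport (hasCompactSupport_xGrad X hφ.2.1)

theorem memLp_xGrad (hφ : IsTest Ω φ) (hX : ∀ j, Continuous (X j)) (p : ℝ≥0∞) :
    MemLp (xGrad X φ) p :=
  (continuous_xGrad hX hφ.1).memLp_of_hasCompactSupport (hasCompactSupport_xGrad X hφ.2.1)

theorem const_mul (hφ : IsTest Ω φ) (c : ℝ) : IsTest Ω (fun y => c * φ y) :=
  ⟨contDiff_const.mul hφ.1, hφ.2.1.mul_left,
    (closure_mono (Function.support_mul_subset_right _ _)).trans hφ.2.2⟩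

theorem sub (hφ : IsTest Ω φ) (hψ : IsTest Ω ψ) : IsTest Ω (φ - ψ) := by
  refine ⟨hφ.1.sub hψ.1, hφ.2.1.sub hψ.2.1, ?_⟩
  have h1 : tsupport (φ - ψ) ⊆ tsupport φ ∪ tsupport ψ := by
    rw [tsupport, tsupport, tsupport, ← closure_union]
    exact closure_mono (Function.support_sub _ _)
  exact h1.trans (Set.union_subset hφ.2.2 hψ.2.2)

end IsTest

/-! ### Averages -/

theorem abs_average_sub_le {A B : Set (Sp N)} (hAB : A ⊆ B) (hA0 : 0 < volume.real A) (hBt : volume B ≠ ⊤) {K : ℝ}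
    (hK : volume.real B ≤ K * volume.real A) {φ : Sp N → ℝ} (hφ : IntegrableOn φ B) (c : ℝ) :
    |(⨍ y in A, φ y) - c| ≤ K * ⨍ y in B, |φ y - c| := by
  have hAt : volume A ≠ ⊤ := ne_top_of_le_ne_top hBt (measure_mono hAB)
  have hB0 : 0 < volume.real B := hA0.trans_le (measureReal_mono hAB hBt)
  have hint : IntegrableOn (fun y => φ y - c) B := hφ.sub (integrableOn_const hBt)
  have h1 : (⨍ y in A, φ y) - c = (volume.real A)⁻¹ * ∫ y in A, (φ y - c) := by
    rw [setAverage_eq, integral_sub (hφ.mono_set hAB) (integrableOn_const hAt), setIntegral_const,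
      smul_eq_mul, smul_eq_mul, mul_sub, inv_mul_cancel_left₀ hA0.ne']
  have h2 : |∫ y in A, (φ y - c)| ≤ ∫ y in B, |φ y - c| :=
    (abs_integral_le_integral_abs).trans (setIntegral_mono_set hint.abs
      (Eventually.of_forall fun _ => abs_nonneg _) (Eventually.of_forall hAB))
  have h3 : 0 ≤ ∫ y in B, |φ y - c| := by positivity
  rw [h1, abs_mul, abs_of_pos (inv_pos.2 hA0), setAverage_eq, smul_eq_mul, ← mul_assoc]
  calc (volume.real A)⁻¹ * |∫ y in A, (φ y - c)|
      ≤ (volume.real A)⁻¹ * ∫ y in B, |φ y - c| := by gcongr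
    _ ≤ _ := by
      gcongr
      rw [inv_le_iff_one_le_mul₀ hA0]
      have : 1 ≤ (volume.real B)⁻¹ * (K * volume.real A) := by
        rw [← div_eq_inv_mul, one_le_div hB0]
        exact hK
      linarith

/-- The Cauchy–Schwarz inequality for averages. -/
theorem average_sq_mul_le {B : Set (Sp N)} (hB0 : 0 < volume.real B) {f : Sp N → ℝ}
    (hf : IntegrableOn f B) (hf2 : IntegrableOn (fun y => f y ^ 2) B) :
    (⨍ y in B, f y) ^ 2 * volume.real B ≤ ∫ y in B, f y ^ 2 := by
  have hBt : volume B ≠ ⊤ := fun h => by simp [measureReal_def, h] at hB0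
  set a := ⨍ y in B, f y with ha
  have h1 : 0 ≤ ∫ y in B, (f y - a) ^ 2 := by positivity
  have h2 : ∫ y in B, (f y - a) ^ 2 =
      (∫ y in B, f y ^ 2) - 2 * a * (∫ y in B, f y) + a ^ 2 * volume.real B := by
    have e : ∀ y, (f y - a) ^ 2 = (f y ^ 2 - 2 * a * f y) + a ^ 2 := fun y => by ring
    simp_rw [e]
    have hs : IntegrableOn (fun y => f y ^ 2 - 2 * a * f y) B := hf2.sub (hf.const_mul _)
    rw [integral_add hs (integrableOn_const hBt), integral_sub hf2 (hf.const_mul _), integral_const_mul, setIntegral_const, smul_eq_mul]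
    ring
  have h3 : ∫ y in B, f y = a * volume.real B := by
    rw [ha, setAverage_eq, smul_eq_mul, mul_comm, ← mul_assoc, mul_inv_cancel₀ hB0.ne', one_mul]
  rw [h2, h3] at h1
  linarith

/-- Hedberg's optimisation: s = (A/M)^{1/(1+κ)} makes the two terms equal. If M or A vanishes, s is
sent to infinity or to 0 instead. -/
theorem le_of_forall_le_add_rpow {y C M A κ : ℝ} (hM : 0 ≤ M) (hA : 0 ≤ A)
    (hκ : 0 < κ) (h : ∀ s > 0, y ≤ C * (M * s + A * s ^ (-κ))) :
    y ≤ 2 * C * (M ^ (κ / (1 + κ)) * A ^ (1 / (1 + κ))) := by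
  rcases hM.eq_or_lt with rfl | hM
  · rw [Real.zero_rpow (by positivity)]
    have h1 : Tendsto (fun s : ℝ => C * (0 * s + A * s ^ (-κ))) atTop (𝓝 (C * (0 + A * 0))) := by
      have h0 : Tendsto (fun s : ℝ => 0 * s) atTop (𝓝 0) := by simp
      exact (h0.add ((tendsto_rpow_neg_atTop hκ).const_mul A)).const_mul C
    have h2 := ge_of_tendsto h1 (by filter_upwards [eventually_gt_atTop 0] with s hs using h s hs)
    simpa using h2
  rcases hA.eq_or_lt with rfl | hA
  · rw [Real.zero_rpow (by positivity)]
    have h1 : Tendsto (fun s : ℝ => C * (M * s + 0 * s ^ (-κ))) (𝓝[>] 0) (𝓝 (C * (M * 0))) := by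
      simp only [zero_mul, add_zero]
      refine Tendsto.mono_left ?_ nhdsWithin_le_nhds
      exact ((continuous_id.const_mul M).const_mul C).tendsto 0
    have h2 := ge_of_tendsto h1 (by filter_upwards [self_mem_nhdsWithin] with s hs using h s hs)
    simpa using h2
  · have h1 := h ((A / M) ^ (1 / (1 + κ))) (by positivity)
    refine h1.trans_eq ?_
    have e1 : M * (A / M) ^ (1 / (1 + κ)) = M ^ (κ / (1 + κ)) * A ^ (1 / (1 + κ)) := by
      have : κ / (1 + κ) = 1 - 1 / (1 + κ) := by field_simp; ring
      rw [Real.div_rpow hA.le hM.le, this, Real.rpow_sub hM, Real.rpow_one]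
      field_simp
    have e2 : A * ((A / M) ^ (1 / (1 + κ))) ^ (-κ) = M ^ (κ / (1 + κ)) * A ^ (1 / (1 + κ)) := by
      have : 1 / (1 + κ) = 1 - κ / (1 + κ) := by field_simp; ring
      rw [← Real.rpow_mul (by positivity)]
      have e3 : 1 / (1 + κ) * -κ = -(κ / (1 + κ)) := by ring
      rw [e3, Real.rpow_neg (by positivity), Real.div_rpow hA.le hM.le, this, Real.rpow_sub hA,
        Real.rpow_one]
      field_simp
    rw [e1, e2]
    ring

namespace IsDoublingDomain

variable {X : Fields m N} {Ω : Set (Sp N)} {Q CP ν : ℝ} {φ : Sp N → ℝ}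

theorem volume_real_ball_pos (h : IsDoublingDomain X Ω Q) {x : Sp N} (hx : x ∈ Ω) {r : ℝ}
    (hr : 0 < r) : 0 < volume.real (ccBall X Ω x r) :=
  ENNReal.toReal_pos (h.doubling x hx r hr).1.ne' (h.volume_ball_lt_top x r).ne

theorem volume_real_ball_two_mul_le (h : IsDoublingDomain X Ω Q) {x : Sp N} (hx : x ∈ Ω) {r : ℝ}
    (hr : 0 < r) : volume.real (ccBall X Ω x (2 * r)) ≤ 2 ^ Q * volume.real (ccBall X Ω x r) := by
  have h1 := ENNReal.toReal_mono (by have := h.volume_ball_lt_top x r; finiteness)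
    (h.doubling x hx r hr).2
  rwa [ENNReal.toReal_mul, ENNReal.toReal_ofReal (by positivity)] at h1

/-! ### Consequences of the Poincaré inequality -/

theorem average_oscillation_le (h : IsDoublingDomain X Ω Q) (hP : Poincare X Ω CP ν)
    (hφ : IsTest Ω φ) {x : Sp N} (hx : x ∈ Ω) {r : ℝ} (hr : 0 < r) :
    ⨍ y in ccBall X Ω x r, |φ y - ⨍ z in ccBall X Ω x r, φ z| ≤
      CP * r * ⨍ y in ccBall X Ω x (ν * r), ‖xGrad X φ y‖ :=
  hP x hx r hr φ ⟨Set.univ, isOpen_univ, Set.subset_univ _,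
      (hφ.1.of_le (by exact_mod_cast le_top)).contDiffOn⟩
    hφ.integrable.integrableOn (hφ.integrable_xGrad h.continuous).integrableOn

theorem abs_average_sub_average_two_mul_le (h : IsDoublingDomain X Ω Q) (hP : Poincare X Ω CP ν)
    (hφ : IsTest Ω φ) {x : Sp N} (hx : x ∈ Ω) {r : ℝ} (hr : 0 < r) :
    |(⨍ y in ccBall X Ω x r, φ y) - ⨍ y in ccBall X Ω x (2 * r), φ y| ≤
      2 ^ Q * (CP * (2 * r) * ⨍ y in ccBall X Ω x (ν * (2 * r)), ‖xGrad X φ y‖) := by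
  refine (abs_average_sub_le (ccBall_mono (by linarith)) (h.volume_real_ball_pos hx hr)
    (h.volume_ball_lt_top _ _).ne (h.volume_real_ball_two_mul_le hx hr)
    hφ.integrable.integrableOn _).trans ?_
  gcongr
  exact h.average_oscillation_le hP hφ hx (by linarith)

theorem average_norm_xGrad_le_maxFun (h : IsDoublingDomain X Ω Q)
    (hφ : IsTest Ω φ) {x : Sp N} (hx : x ∈ Ω) {r : ℝ} (hr : 0 < r) :
    ⨍ y in ccBall X Ω x r, ‖xGrad X φ y‖ ≤
      (maxFun X Ω (fun y => ENNReal.ofReal ‖xGrad X φ y‖) x).toReal := by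
  obtain ⟨C, hC⟩ := (hasCompactSupport_xGrad X hφ.2.1).exists_bound_of_continuous
    (continuous_xGrad h.continuous hφ.1)
  have hMt : maxFun X Ω (fun y => ENNReal.ofReal ‖xGrad X φ y‖) x ≠ ⊤ :=
    ((maxFun_le (C := ENNReal.ofReal C) (fun x => ENNReal.ofReal_le_ofReal (hC x)) x).trans_lt
      ENNReal.ofReal_lt_top).ne
  have h1 := ENNReal.toReal_mono hMt (le_maxFun (fun y => ENNReal.ofReal ‖xGrad X φ y‖) hx hr
    (mem_ccBall_self hx hr))
  refine le_trans (le_of_eq ?_) h1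
  rw [ENNReal.toReal_div, setAverage_eq, integral_eq_lintegral_of_nonneg_ae
    (Eventually.of_forall fun _ => norm_nonneg _)
    (continuous_xGrad h.continuous hφ.1).norm.aestronglyMeasurable, smul_eq_mul, measureReal_def,
    div_eq_inv_mul]

theorem tendsto_average (h : IsDoublingDomain X Ω Q) (hφ : IsTest Ω φ)
    {x : Sp N} (hx : x ∈ Ω) {s : ℝ} (hs : 0 < s) :
    Tendsto (fun n : ℕ => ⨍ y in ccBall X Ω x (s * 2⁻¹ ^ n), φ y) atTop (𝓝 (φ x)) := by
  rw [Metric.tendsto_atTop]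
  intro ε hε
  obtain ⟨δ, hδ, hφδ⟩ := Metric.continuous_iff.1 hφ.1.continuous x (ε / 2) (by positivity)
  obtain ⟨r, hr, hball⟩ := exists_ccBall_subset_ball h.continuous h.connected hx hδ
  have hlim : Tendsto (fun n : ℕ => s * (2⁻¹ : ℝ) ^ n) atTop (𝓝 (s * 0)) :=
    (tendsto_pow_atTop_nhds_zero_of_lt_one (by norm_num) (by norm_num)).const_mul s
  rw [mul_zero] at hlim
  obtain ⟨n₀, hn₀⟩ := eventually_atTop.1 (hlim.eventually (gt_mem_nhds hr))
  refine ⟨n₀, fun n hn => ?_⟩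
  set B := ccBall X Ω x (s * 2⁻¹ ^ n) with hB
  have hB0 : 0 < volume.real B := h.volume_real_ball_pos hx (by positivity)
  have hBt := (h.volume_ball_lt_top x (s * 2⁻¹ ^ n)).ne
  have h1 := abs_average_sub_le (A := B) (B := B) subset_rfl hB0 hBt
    (K := 1) (by simp) hφ.integrable.integrableOn (φ x)
  rw [Real.dist_eq]
  refine h1.trans_lt ?_
  rw [one_mul, setAverage_eq, smul_eq_mul]
  have h2 : ∫ y in B, |φ y - φ x| ≤ ∫ y in B, ε / 2 := by
    refine setIntegral_mono_on (hφ.integrable.integrableOn.sub (integrableOn_const hBt)).abs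
      (integrableOn_const hBt) (h.isOpen_ball hx _).measurableSet fun y hy => ?_
    have h3 := hφδ y (hball (ccBall_mono (hn₀ n hn).le hy))
    rw [Real.dist_eq] at h3
    exact h3.le
  rw [setIntegral_const, smul_eq_mul] at h2
  calc (volume.real B)⁻¹ * ∫ y in B, |φ y - φ x|
      ≤ (volume.real B)⁻¹ * (volume.real B * (ε / 2)) := by gcongr
    _ = ε / 2 := by rw [inv_mul_cancel_left₀ hB0.ne']
    _ < ε := by linarith

/-- Along the balls of radius s 2⁻ⁿ consecutive averages differ by at most a constant times the
maximal function times the radius. The radii sum geometrically, and the averages converge to φ(x)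
because φ is continuous and small control balls are small in the Euclidean sense. -/
theorem abs_sub_average_le (h : IsDoublingDomain X Ω Q) (hCP : 0 < CP) (hν : 0 < ν)
    (hP : Poincare X Ω CP ν) (hφ : IsTest Ω φ) {x : Sp N} (hx : x ∈ Ω) {s : ℝ} (hs : 0 < s) :
    |φ x - ⨍ y in ccBall X Ω x s, φ y| ≤ 2 * (2 ^ Q * CP *
      (maxFun X Ω (fun y => ENNReal.ofReal ‖xGrad X φ y‖) x).toReal * s) := by
  set M := (maxFun X Ω (fun y => ENNReal.ofReal ‖xGrad X φ y‖) x).toReal with hM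
  have hM0 : 0 ≤ M := ENNReal.toReal_nonneg
  have key : ∀ n : ℕ, |(⨍ y in ccBall X Ω x (s * 2⁻¹ ^ n), φ y) - ⨍ y in ccBall X Ω x s, φ y| ≤
      2 ^ Q * CP * M * s * (2 - 2 * 2⁻¹ ^ n) := by
    intro n
    induction n with
    | zero => simp
    | succ n ih =>
      have hr : 0 < s * (2⁻¹ : ℝ) ^ (n + 1) := by positivity
      have e : 2 * (s * (2⁻¹ : ℝ) ^ (n + 1)) = s * 2⁻¹ ^ n := by
        rw [pow_succ]; ring
      have h1 := h.abs_average_sub_average_two_mul_le hP hφ hx hr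
      rw [e] at h1
      have h2 := h.average_norm_xGrad_le_maxFun hφ hx
        (show 0 < ν * (s * (2⁻¹ : ℝ) ^ n) by positivity)
      have h3 : 2 ^ Q * (CP * (s * (2⁻¹ : ℝ) ^ n) *
          ⨍ y in ccBall X Ω x (ν * (s * 2⁻¹ ^ n)), ‖xGrad X φ y‖) ≤
          2 ^ Q * (CP * (s * (2⁻¹ : ℝ) ^ n) * M) := by gcongr
      refine (abs_sub_le _ (⨍ y in ccBall X Ω x (s * 2⁻¹ ^ n), φ y) _).trans ?_
      refine (add_le_add (h1.trans h3) ih).trans_eq ?_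
      rw [pow_succ]
      ring
  refine le_of_tendsto (((h.tendsto_average hφ hx hs).sub_const _).abs)
    (Eventually.of_forall fun n => (key n).trans ?_)
  have : 0 ≤ 2 ^ Q * CP * M * s := by positivity
  have : (0 : ℝ) ≤ 2⁻¹ ^ n := by positivity
  nlinarith

/-- Cauchy–Schwarz on the ball, combined with the lower bound of order r^Q for its volume. -/
theorem exists_average_norm_xGrad_le (h : IsDoublingDomain X Ω Q) (hQ : 0 ≤ Q) (hν : 0 < ν)
    (hne : Ω.Nonempty) (R : ℝ) :
    ∃ C : ℝ, 0 < C ∧ ∀ φ, IsTest Ω φ → ∀ x ∈ Ω, ∀ r, 0 < r → r ≤ R →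
      ⨍ y in ccBall X Ω x (ν * r), ‖xGrad X φ y‖ ≤
        C * √(∫ y in Ω, ‖xGrad X φ y‖ ^ 2) * r ^ (-(Q / 2)) := by
  obtain ⟨R₀, hR₀, hball⟩ := h.exists_ball_eq
  set R' := max R₀ (ν * R) with hR'
  have hR'0 : 0 < R' := hR₀.trans_le (le_max_left _ _)
  have hΩ0 : 0 < volume.real Ω := by
    obtain ⟨x, hx⟩ := hne
    have := h.volume_real_ball_pos hx hR₀
    rwa [hball R₀ le_rfl x hx] at this
  refine ⟨(√(volume.real Ω))⁻¹ * (2 * R' / ν) ^ (Q / 2), by positivity,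
    fun φ hφ x hx r hr hrR => ?_⟩
  have hνr : 0 < ν * r := by positivity
  have hνR : ν * r ≤ R' := le_trans (by gcongr) (le_max_right _ _)
  have h1 := h.volume_le_ball hQ (fun R'' hR'' => hball R'' ((le_max_left _ _).trans hR'')) hx hνr hνR
  have h2 := ENNReal.toReal_mono (by have := h.volume_ball_lt_top x (ν * r); finiteness) h1
  rw [ENNReal.toReal_mul, ENNReal.toReal_ofReal (by positivity), ← measureReal_def,
    ← measureReal_def] at h2
  set B := ccBall X Ω x (ν * r) with hB
  have hB0 : 0 < volume.real B := h.volume_real_ball_pos hx hνr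
  have hf : Integrable fun y => ‖xGrad X φ y‖ := (hφ.integrable_xGrad h.continuous).norm
  have hf2 : Integrable fun y => ‖xGrad X φ y‖ ^ 2 :=
    ((hφ.memLp_xGrad h.continuous 2).integrable_norm_pow (by norm_num))
  have h3 := average_sq_mul_le hB0 hf.integrableOn hf2.integrableOn
  have h4 : ∫ y in B, ‖xGrad X φ y‖ ^ 2 ≤ ∫ y in Ω, ‖xGrad X φ y‖ ^ 2 :=
    setIntegral_mono_set hf2.integrableOn (Eventually.of_forall fun _ => by positivity)
      (Eventually.of_forall (ccBall_subset X Ω x (ν * r)))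
  set a := ⨍ y in B, ‖xGrad X φ y‖ with ha
  have ha0 : 0 ≤ a := by
    rw [ha, setAverage_eq, smul_eq_mul]
    positivity
  set I := ∫ y in Ω, ‖xGrad X φ y‖ ^ 2 with hI
  have hI0 : 0 ≤ I := by positivity
  have h5 : a ^ 2 * volume.real Ω ≤ (2 * R' / (ν * r)) ^ Q * I := by
    calc a ^ 2 * volume.real Ω ≤ a ^ 2 * ((2 * R' / (ν * r)) ^ Q * volume.real B) := by gcongr
      _ = (2 * R' / (ν * r)) ^ Q * (a ^ 2 * volume.real B) := by ring
      _ ≤ _ := by gcongr; exact h3.trans h4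
  have h6 : a ^ 2 ≤ ((√(volume.real Ω))⁻¹ * (2 * R' / ν) ^ (Q / 2) * √I * r ^ (-(Q / 2))) ^ 2 := by
    have e1 : ((2 * R' / ν) ^ (Q / 2)) ^ 2 = (2 * R' / ν) ^ Q := by
      rw [← Real.rpow_natCast, ← Real.rpow_mul (by positivity)]
      congr 1
      push_cast
      ring
    have e2 : (r ^ (-(Q / 2))) ^ 2 = (r ^ Q)⁻¹ := by
      rw [← Real.rpow_natCast, ← Real.rpow_mul hr.le, ← Real.rpow_neg hr.le]
      congr 1
      push_cast
      ring
    have e3 : (2 * R' / (ν * r)) ^ Q = (2 * R' / ν) ^ Q * (r ^ Q)⁻¹ := by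
      rw [← div_div, Real.div_rpow (by positivity) hr.le, div_eq_mul_inv]
    rw [mul_pow, mul_pow, mul_pow, e1, e2, inv_pow, Real.sq_sqrt hΩ0.le, Real.sq_sqrt hI0]
    rw [e3] at h5
    rw [← mul_le_mul_iff_left₀ hΩ0]
    refine h5.trans_eq ?_
    field_simp
  exact (abs_le_of_sq_le_sq' h6 (by positivity)).2

/-- Radii are doubled from s until the ball is Ω. The increments are of order (2ⁿs)^{1-Q/2}; since Q
> 2 they form a convergent geometric series dominated by the smallest scale. -/
theorem exists_abs_average_sub_le (h : IsDoublingDomain X Ω Q) (hQ : 2 < Q) (hCP : 0 < CP)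
    (hν : 0 < ν) (hP : Poincare X Ω CP ν) (hne : Ω.Nonempty) :
    ∃ C : ℝ, 0 < C ∧ ∀ φ, IsTest Ω φ → ∀ x ∈ Ω, ∀ s > 0,
      |(⨍ y in ccBall X Ω x s, φ y) - ⨍ y in Ω, φ y| ≤
        C * (√(∫ y in Ω, ‖xGrad X φ y‖ ^ 2) * s ^ (-(Q / 2 - 1))) := by
  obtain ⟨R, hR, hball⟩ := h.exists_ball_eq
  -- The last doubled radius lies between R and 2R.
  obtain ⟨C, hC, hav⟩ := h.exists_average_norm_xGrad_le (by linarith) hν hne (2 * R)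
  set q : ℝ := 2 ^ (-(Q / 2 - 1)) with hq
  have hq0 : 0 < q := by positivity
  have hq1 : q < 1 := Real.rpow_lt_one_of_one_lt_of_neg (by norm_num) (by linarith)
  have hq1' : 0 < 1 - q := by linarith
  refine ⟨2 ^ Q * CP * C / (1 - q), by positivity, fun φ hφ x hx s hs => ?_⟩
  set A := √(∫ y in Ω, ‖xGrad X φ y‖ ^ 2) with hA
  have hA0 : 0 ≤ A := Real.sqrt_nonneg _
  set S := s ^ (-(Q / 2 - 1)) with hS
  have hS0 : 0 < S := by positivity
  rcases le_or_gt R s with hsR | hsR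
  · rw [hball s hsR x hx, sub_self, abs_zero]
    positivity
  have key : ∀ n : ℕ, 2 ^ n * s ≤ 2 * R →
      |(⨍ y in ccBall X Ω x s, φ y) - ⨍ y in ccBall X Ω x (2 ^ n * s), φ y| ≤
        2 ^ Q * CP * C * A * S * ((1 - q ^ n) / (1 - q)) := by
    intro n
    induction n with
    | zero => simp
    | succ n ih =>
      intro hn
      have e : 2 ^ (n + 1) * s = 2 * (2 ^ n * s) := by rw [pow_succ]; ring
      have hpos : 0 < 2 ^ n * s := by positivity
      rw [e] at hn ⊢
      have h1 := ih (by linarith)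
      have h2 := h.abs_average_sub_average_two_mul_le hP hφ hx hpos
      have h3 := hav φ hφ x hx (2 * (2 ^ n * s)) (by positivity) hn
      have e2 : (2 * (2 ^ n * s)) * (2 * (2 ^ n * s)) ^ (-(Q / 2)) = q ^ (n + 1) * S := by
        rw [← e]
        have : -(Q / 2) = -(Q / 2 - 1) - 1 := by ring
        rw [this, Real.rpow_sub_one (by positivity), mul_div_cancel₀ _ (by positivity),
          Real.mul_rpow (by positivity) hs.le, hq, ← Real.rpow_natCast, ← Real.rpow_natCast,
          ← Real.rpow_mul (by norm_num), ← Real.rpow_mul (by norm_num)]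
        congr 2
        ring
      have h4 : 2 ^ Q * (CP * (2 * (2 ^ n * s)) *
          ⨍ y in ccBall X Ω x (ν * (2 * (2 ^ n * s))), ‖xGrad X φ y‖) ≤
          2 ^ Q * CP * C * A * S * q ^ n := by
        calc _ ≤ 2 ^ Q * (CP * (2 * (2 ^ n * s)) * (C * A * (2 * (2 ^ n * s)) ^ (-(Q / 2)))) := by
              gcongr
          _ = 2 ^ Q * CP * C * A * ((2 * (2 ^ n * s)) * (2 * (2 ^ n * s)) ^ (-(Q / 2))) := by ring
          _ = 2 ^ Q * CP * C * A * S * (q ^ n * q) := by rw [e2, pow_succ]; ring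
          _ ≤ 2 ^ Q * CP * C * A * S * (q ^ n * 1) := by gcongr
          _ = _ := by ring
      refine (abs_sub_le _ (⨍ y in ccBall X Ω x (2 ^ n * s), φ y) _).trans ?_
      refine (add_le_add h1 (h2.trans h4)).trans_eq ?_
      rw [pow_succ]
      field_simp
      ring
  obtain ⟨n, hn, hn'⟩ := exists_nat_pow_near (show 1 ≤ R / s by rw [one_le_div hs]; exact hsR.le)
    one_lt_two
  rw [div_lt_iff₀ hs] at hn'
  rw [le_div_iff₀ hs] at hn
  have h1 := key (n + 1) (by rw [pow_succ]; linarith)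
  rw [hball _ hn'.le x hx] at h1
  refine h1.trans ?_
  calc 2 ^ Q * CP * C * A * S * ((1 - q ^ (n + 1)) / (1 - q))
      ≤ 2 ^ Q * CP * C * A * S * (1 / (1 - q)) := by
        gcongr
        have : 0 < q ^ (n + 1) := by positivity
        linarith
    _ = _ := by ring

end IsDoublingDomain

/-! ### The Sobolev inequality on Ω -/

namespace IsDoublingDomain

variable {X : Fields m N} {Ω : Set (Sp N)} {Q CP ν : ℝ} {φ : Sp N → ℝ}

theorem eLpNorm_xGrad_two (h : IsDoublingDomain X Ω Q) (hφ : IsTest Ω φ) :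
    eLpNorm (xGrad X φ) 2 (volume.restrict Ω) =
      ENNReal.ofReal √(∫ y in Ω, ‖xGrad X φ y‖ ^ 2) := by
  rw [((hφ.memLp_xGrad h.continuous 2).restrict Ω).eLpNorm_eq_integral_rpow_norm (by norm_num)
    (by norm_num), Real.sqrt_eq_rpow]
  simp

/-- Write κ = Q/2 - 1 and A = ‖Xφ‖_2. The two telescoping bounds and Hedberg's optimisation bound |φ
- φ_Ω| by a multiple of M^{κ/(1+κ)} A^{1/(1+κ)}. The exponent p = 2(1+κ)/κ is the one for which the
p-th power contains M² exactly, so the L² maximal inequality applies and the powers of A add up to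
p. -/
theorem exists_eLpNorm_sub_average_le (h : IsDoublingDomain X Ω Q) (hQ : 2 < Q) (hCP : 0 < CP)
    (hν : 0 < ν) (hP : Poincare X Ω CP ν) (hne : Ω.Nonempty) :
    ∃ C : ℝ, 0 < C ∧ ∀ φ, IsTest Ω φ →
      eLpNorm (fun x => φ x - ⨍ y in Ω, φ y) (ENNReal.ofReal (2 * Q / (Q - 2)))
        (volume.restrict Ω) ≤ ENNReal.ofReal (C * √(∫ y in Ω, ‖xGrad X φ y‖ ^ 2)) := by
  obtain ⟨C₁, hC₁, hup⟩ := h.exists_abs_average_sub_le hQ hCP hν hP hne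
  set κ := Q / 2 - 1 with hκ
  have hκ0 : 0 < κ := by rw [hκ]; linarith
  set p := 2 * Q / (Q - 2) with hp
  have hQ2 : 0 < Q - 2 := by linarith
  have hp0 : 0 < p := by positivity
  have hpκ : p = 2 * (1 + κ) / κ := by
    rw [hp, hκ]
    field_simp
    ring
  set C := max (2 * (2 ^ Q * CP)) C₁ with hC
  have hC0 : 0 < C := lt_max_of_lt_right hC₁
  set K : ℝ := 8 * (2 ^ Q) ^ 2 with hK
  have hK0 : 0 < K := by positivity
  refine ⟨2 * C * K ^ p⁻¹, by positivity, fun φ hφ => ?_⟩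
  set A := √(∫ y in Ω, ‖xGrad X φ y‖ ^ 2) with hA
  have hA0 : 0 ≤ A := Real.sqrt_nonneg _
  set MF := maxFun X Ω (fun y => ENNReal.ofReal ‖xGrad X φ y‖) with hMF
  obtain ⟨C', hC'⟩ := (hasCompactSupport_xGrad X hφ.2.1).exists_bound_of_continuous
    (continuous_xGrad h.continuous hφ.1)
  have hMt : ∀ x, MF x ≠ ⊤ := fun x =>
    ((maxFun_le (C := ENNReal.ofReal C') (fun x => ENNReal.ofReal_le_ofReal (hC' x)) x).trans_lt
      ENNReal.ofReal_lt_top).ne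
  have hpt : ∀ x ∈ Ω, |φ x - ⨍ y in Ω, φ y| ^ p ≤
      (2 * C) ^ p * A ^ (2 / κ) * (MF x).toReal ^ 2 := by
    intro x hx
    have h1 := le_of_forall_le_add_rpow (y := |φ x - ⨍ y in Ω, φ y|) (C := C) (M := (MF x).toReal)
      (A := A) ENNReal.toReal_nonneg hA0 hκ0 (fun s hs => by
        refine (abs_sub_le _ (⨍ y in ccBall X Ω x s, φ y) _).trans ?_
        have e1 := h.abs_sub_average_le hCP hν hP hφ hx hs
        have e2 := hup φ hφ x hx s hs
        have e3 : 0 ≤ (MF x).toReal := ENNReal.toReal_nonneg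
        calc _ ≤ 2 * (2 ^ Q * CP * (MF x).toReal * s) + C₁ * (A * s ^ (-κ)) := add_le_add e1 e2
          _ = (2 * (2 ^ Q * CP)) * ((MF x).toReal * s) + C₁ * (A * s ^ (-κ)) := by ring
          _ ≤ C * ((MF x).toReal * s) + C * (A * s ^ (-κ)) := by
              gcongr
              · exact le_max_left _ _
              · exact le_max_right _ _
          _ = _ := by ring)
    refine (Real.rpow_le_rpow (abs_nonneg _) h1 hp0.le).trans_eq ?_
    have e3 : 0 ≤ (MF x).toReal := ENNReal.toReal_nonneg
    rw [Real.mul_rpow (by positivity) (by positivity),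
      Real.mul_rpow (x := (MF x).toReal ^ (κ / (1 + κ))) (by positivity) (by positivity),
      ← Real.rpow_mul e3, ← Real.rpow_mul hA0]
    have e4 : κ / (1 + κ) * p = (2 : ℕ) := by
      rw [hpκ]; push_cast; field_simp
    have e5 : 1 / (1 + κ) * p = 2 / κ := by
      rw [hpκ]; field_simp
    rw [e4, e5, Real.rpow_natCast]
    ring
  have hI : ∫⁻ y in Ω, ENNReal.ofReal ‖xGrad X φ y‖ ^ 2 = ENNReal.ofReal (A ^ 2) := by
    have hf2 : IntegrableOn (fun y => ‖xGrad X φ y‖ ^ 2) Ω :=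
      ((hφ.memLp_xGrad h.continuous 2).integrable_norm_pow (by norm_num)).integrableOn
    rw [hA, Real.sq_sqrt (by positivity), ofReal_integral_eq_lintegral_ofReal hf2
      (Eventually.of_forall fun _ => by positivity)]
    refine lintegral_congr fun y => ?_
    rw [ENNReal.ofReal_pow (norm_nonneg _)]
  have hmax := h.lintegral_maxFun_sq_le (f := fun y => ‖xGrad X φ y‖)
    (continuous_xGrad h.continuous hφ.1).norm.measurable hC'
  rw [hI] at hmax
  have hpne : ENNReal.ofReal p ≠ 0 := by simpa using hp0
  rw [eLpNorm_eq_lintegral_rpow_enorm_toReal hpne ENNReal.ofReal_ne_top,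
    ENNReal.toReal_ofReal hp0.le, one_div, ENNReal.rpow_inv_le_iff hp0]
  calc ∫⁻ x in Ω, ‖φ x - ⨍ y in Ω, φ y‖ₑ ^ p
      ≤ ∫⁻ x in Ω, ENNReal.ofReal ((2 * C) ^ p * A ^ (2 / κ)) * MF x ^ 2 := by
        refine setLIntegral_mono' h.isOpen.measurableSet fun x hx => ?_
        have h1 := ENNReal.ofReal_le_ofReal (hpt x hx)
        rw [ENNReal.ofReal_mul (by positivity), ENNReal.ofReal_pow ENNReal.toReal_nonneg,
          ENNReal.ofReal_toReal (hMt x), ← ENNReal.ofReal_rpow_of_nonneg (abs_nonneg _) hp0.le] at h1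
        rwa [Real.enorm_eq_ofReal_abs]
    _ = ENNReal.ofReal ((2 * C) ^ p * A ^ (2 / κ)) * ∫⁻ x in Ω, MF x ^ 2 :=
        lintegral_const_mul' _ _ ENNReal.ofReal_ne_top
    _ ≤ ENNReal.ofReal ((2 * C) ^ p * A ^ (2 / κ)) *
          (8 * ENNReal.ofReal (2 ^ Q) ^ 2 * ENNReal.ofReal (A ^ 2)) := by gcongr
    _ = ENNReal.ofReal ((2 * C * K ^ p⁻¹ * A) ^ p) := by
        rw [← ENNReal.ofReal_ofNat, ← ENNReal.ofReal_pow (by positivity),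
          ← ENNReal.ofReal_mul (by norm_num), ← ENNReal.ofReal_mul (by positivity),
          ← ENNReal.ofReal_mul (by positivity)]
        congr 1
        rw [Real.mul_rpow (by positivity) hA0, Real.mul_rpow (x := 2 * C) (by positivity) (by positivity),
          ← Real.rpow_mul hK0.le, inv_mul_cancel₀ hp0.ne', Real.rpow_one, hK]
        have e : A ^ p = A ^ (2 / κ) * A ^ 2 := by
          rw [← Real.rpow_two, ← Real.rpow_add_of_nonneg hA0 (by positivity) (by norm_num)]
          congr 1
          rw [hpκ]
          field_simp
        rw [e]
        ring
    _ = ENNReal.ofReal (2 * C * K ^ p⁻¹ * A) ^ p := by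
        rw [ENNReal.ofReal_rpow_of_nonneg (by positivity) hp0.le]

theorem exists_integral_sub_average_le (h : IsDoublingDomain X Ω Q) (hCP : 0 < CP)
    (hν : 0 < ν) (hP : Poincare X Ω CP ν) (hne : Ω.Nonempty) :
    ∃ C : ℝ, 0 < C ∧ ∀ φ, IsTest Ω φ →
      ∫ x in Ω, |φ x - ⨍ y in Ω, φ y| ≤ C * ∫ y in Ω, ‖xGrad X φ y‖ := by
  obtain ⟨R, hR, hball⟩ := h.exists_ball_eq
  obtain ⟨x, hx⟩ := hne
  -- Both B_r and B_{νr} must be all of Ω; the second entry covers ν < 1.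
  set r := max R (R / ν) with hr
  have hr0 : 0 < r := hR.trans_le (le_max_left _ _)
  have e1 : ccBall X Ω x r = Ω := hball r (le_max_left _ _) x hx
  have e2 : ccBall X Ω x (ν * r) = Ω := by
    refine hball _ ?_ x hx
    have : R / ν ≤ r := le_max_right _ _
    rw [div_le_iff₀ hν] at this
    rw [ge_iff_le, mul_comm]
    exact this
  refine ⟨CP * r, by positivity, fun φ hφ => ?_⟩
  have h1 := h.average_oscillation_le hP hφ hx hr0
  have hΩ0 := h.volume_real_ball_pos hx hr0
  rw [e1] at hΩ0
  rw [e1, e2, setAverage_eq, setAverage_eq (f := fun y => ‖xGrad X φ y‖), smul_eq_mul, smul_eq_mul] at h1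
  have h2 : (volume.real Ω)⁻¹ * ∫ x in Ω, |φ x - ⨍ y in Ω, φ y| ≤
      (volume.real Ω)⁻¹ * (CP * r * ∫ y in Ω, ‖xGrad X φ y‖) := by
    refine h1.trans_eq ?_
    ring
  exact le_of_mul_le_mul_left h2 (inv_pos.2 hΩ0)

/-- The Poincaré inequality for functions vanishing at the boundary. -/
theorem exists_integral_abs_le (h : IsDoublingDomain X Ω Q) (hN : 0 < N) (hCP : 0 < CP)
    (hν : 0 < ν) (hP : Poincare X Ω CP ν) (hne : Ω.Nonempty)
    (hXloc : ∀ j, LocallyLipschitz (X j)) (hXlip : ∀ j, ∃ K, LipschitzOnWith K (X j) Ω) :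
    ∃ C : ℝ, 0 < C ∧ ∀ φ, IsTest Ω φ →
      ∫ x in Ω, |φ x| ≤ C * ∫ y in Ω, ‖xGrad X φ y‖ := by
  obtain ⟨C, hC, hosc⟩ := h.exists_integral_sub_average_le hCP hν hP hne
  obtain ⟨R, hR, hball⟩ := h.exists_ball_eq
  have hΩ0 : 0 < volume.real Ω := by
    obtain ⟨x, hx⟩ := hne
    have := h.volume_real_ball_pos hx hR
    rwa [hball R le_rfl x hx] at this
  by_contra! hcon
  -- The factor 2C + 1 makes the oscillation at most half of ∫|φ|, so the mean carries at least the
  -- other half and cannot vanish. The factor n + 1 sends the gradient, divided by the mean, to 0.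
  have hex : ∀ n : ℕ, ∃ φ, IsTest Ω φ ∧
      (2 * C + 1) * (n + 1) * ∫ y in Ω, ‖xGrad X φ y‖ < ∫ x in Ω, |φ x| := by
    intro n
    exact hcon ((2 * C + 1) * (n + 1)) (by positivity)
  choose φ hφ hlt using hex
  set c : ℕ → ℝ := fun n => ⨍ y in Ω, φ n y with hc
  set a : ℕ → ℝ := fun n => ∫ x in Ω, |φ n x| with ha
  set g : ℕ → ℝ := fun n => ∫ y in Ω, ‖xGrad X (φ n) y‖ with hg
  have hg0 : ∀ n, 0 ≤ g n := fun n => by positivity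
  have ha0 : ∀ n, 0 < a n := fun n => lt_of_le_of_lt
    (mul_nonneg (by positivity) (hg0 n)) (hlt n)
  have hgle : ∀ n, g n ≤ a n / ((2 * C + 1) * (n + 1)) := fun n => by
    rw [le_div_iff₀ (by positivity), mul_comm]
    exact (hlt n).le
  have hfin : IsFiniteMeasure (volume.restrict Ω) := ⟨by simpa using h.finite⟩
  have hφi : ∀ n, IntegrableOn (φ n) Ω := fun n => (hφ n).integrable.integrableOn
  have hclow : ∀ n, a n / 2 ≤ |c n| * volume.real Ω := by
    intro n
    have h1 : a n ≤ (∫ x in Ω, |φ n x - c n|) + |c n| * volume.real Ω := by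
      have h2 : a n ≤ ∫ x in Ω, (|φ n x - c n| + |c n|) := by
        refine integral_mono (hφi n).abs (((hφi n).sub (integrable_const _)).abs.add
          (integrable_const _)) fun x => ?_
        simpa using abs_add_le (φ n x - c n) (c n)
      have h3 : IntegrableOn (fun x => |φ n x - c n|) Ω :=
        ((hφi n).sub (integrable_const _)).abs
      rw [integral_add h3 (integrable_const _), setIntegral_const, smul_eq_mul] at h2
      linarith
    have h3 := hosc (φ n) (hφ n)
    have h4 : C * g n ≤ a n / 2 := by
      have e : (2 * C + 1) * 1 * g n ≤ a n := by
        refine le_trans ?_ (hlt n).le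
        have : (0 : ℝ) ≤ n := Nat.cast_nonneg n
        have := hg0 n
        gcongr
        linarith
      nlinarith [hg0 n]
    linarith
  have hc0 : ∀ n, c n ≠ 0 := fun n h0 => by
    have := hclow n
    rw [h0, abs_zero, zero_mul] at this
    linarith [ha0 n]
  have hratio : ∀ n, |c n|⁻¹ * g n ≤ 2 * volume.real Ω * (1 / ((n : ℝ) + 1)) := by
    intro n
    have hcn : 0 < |c n| := abs_pos.2 (hc0 n)
    rw [inv_mul_le_iff₀ hcn]
    refine (hgle n).trans ?_
    have hn : (0 : ℝ) < n + 1 := by positivity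
    calc a n / ((2 * C + 1) * (n + 1)) ≤ a n / (1 * (n + 1)) := by
          have := (ha0 n).le
          gcongr
          linarith
      _ = 2 * (a n / 2) * (1 / ((n : ℝ) + 1)) := by field_simp
      _ ≤ 2 * (|c n| * volume.real Ω) * (1 / ((n : ℝ) + 1)) := by
          have := hclow n
          gcongr
      _ = _ := by ring
  have hlim : Tendsto (fun n : ℕ => 2 * volume.real Ω * (1 / ((n : ℝ) + 1))) atTop (𝓝 0) := by
    simpa using tendsto_one_div_add_atTop_nhds_zero_nat.const_mul (2 * volume.real Ω)
  refine not_tendsto_one h hN hne hXloc hXlip (φ := fun n y => (c n)⁻¹ * φ n y)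
    (fun n => (hφ n).const_mul _) ?_ ?_
  · refine squeeze_zero (fun n => by positivity) (fun n => ?_)
      (by simpa only [mul_zero] using hlim.const_mul C)
    have e : ∀ y, |(c n)⁻¹ * φ n y - 1| = |c n|⁻¹ * |φ n y - c n| := by
      intro y
      rw [← abs_inv, ← abs_mul, mul_sub, inv_mul_cancel₀ (hc0 n)]
    simp_rw [e]
    rw [integral_const_mul]
    calc |c n|⁻¹ * ∫ x in Ω, |φ n x - c n| ≤ |c n|⁻¹ * (C * g n) := by
          gcongr
          exact hosc (φ n) (hφ n)
      _ = C * (|c n|⁻¹ * g n) := by ring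
      _ ≤ _ := mul_le_mul_of_nonneg_left (hratio n) hC.le
  · refine squeeze_zero (fun n => by positivity) (fun n => ?_) hlim
    have e : ∀ y, ‖xGrad X (fun y => (c n)⁻¹ * φ n y) y‖ = |c n|⁻¹ * ‖xGrad X (φ n) y‖ := by
      intro y
      rw [xGrad_const_mul X (hφ n).differentiable, norm_smul, Real.norm_eq_abs, abs_inv]
    simp_rw [e]
    rw [integral_const_mul]
    exact hratio n

/-- The Sobolev inequality for test functions. -/
theorem exists_sobolev_test (h : IsDoublingDomain X Ω Q) (hN : 0 < N) (hQ : 2 < Q) (hCP : 0 < CP)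
    (hν : 0 < ν) (hP : Poincare X Ω CP ν)
    (hXloc : ∀ j, LocallyLipschitz (X j)) (hXlip : ∀ j, ∃ K, LipschitzOnWith K (X j) Ω) :
    ∃ C : ℝ, 0 < C ∧ ∀ φ, IsTest Ω φ →
      eLpNorm φ (ENNReal.ofReal (2 * Q / (Q - 2))) (volume.restrict Ω) ≤
        ENNReal.ofReal C * eLpNorm (xGrad X φ) 2 (volume.restrict Ω) := by
  rcases Ω.eq_empty_or_nonempty with rfl | hne
  · exact ⟨1, one_pos, fun φ hφ => by simp⟩
  obtain ⟨C₁, hC₁, hsob⟩ := h.exists_eLpNorm_sub_average_le hQ hCP hν hP hne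
  obtain ⟨C₂, hC₂, htr⟩ := h.exists_integral_abs_le hN hCP hν hP hne hXloc hXlip
  obtain ⟨R, hR, hball⟩ := h.exists_ball_eq
  have hΩ0 : 0 < volume.real Ω := by
    obtain ⟨x, hx⟩ := hne
    have := h.volume_real_ball_pos hx hR
    rwa [hball R le_rfl x hx] at this
  set p := 2 * Q / (Q - 2) with hp
  have hQ2 : 0 < Q - 2 := by linarith
  have hp0 : 0 < p := by positivity
  have hp1 : 1 ≤ p := by
    rw [hp, one_le_div hQ2]
    linarith
  set v := volume.real Ω with hv
  refine ⟨C₁ + C₂ * √v⁻¹ * v ^ p⁻¹, by positivity, fun φ hφ => ?_⟩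
  rw [h.eLpNorm_xGrad_two hφ, ← ENNReal.ofReal_mul (by positivity)]
  set A := √(∫ y in Ω, ‖xGrad X φ y‖ ^ 2) with hA
  have hA0 : 0 ≤ A := Real.sqrt_nonneg _
  set c := ⨍ y in Ω, φ y with hc
  -- The mean is bounded through the L¹ inequality for functions vanishing at the boundary, followed
  -- by Cauchy–Schwarz on Ω.
  have hcA : |c| ≤ C₂ * √v⁻¹ * A := by
    have h1 : |c| ≤ v⁻¹ * ∫ y in Ω, |φ y| := by
      rw [hc, setAverage_eq, smul_eq_mul, abs_mul, abs_of_pos (inv_pos.2 hΩ0)]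
      gcongr
      exact abs_integral_le_integral_abs
    have hf2 : IntegrableOn (fun y => ‖xGrad X φ y‖ ^ 2) Ω :=
      ((hφ.memLp_xGrad h.continuous 2).integrable_norm_pow (by norm_num)).integrableOn
    have h2 := average_sq_mul_le hΩ0 (hφ.integrable_xGrad h.continuous).norm.integrableOn hf2
    rw [setAverage_eq, smul_eq_mul, ← Real.sq_sqrt (x := ∫ y in Ω, ‖xGrad X φ y‖ ^ 2)
      (by positivity), ← hA, ← le_div_iff₀ hΩ0] at h2
    set G := ∫ y in Ω, ‖xGrad X φ y‖ with hG
    have h3 : v⁻¹ * G ≤ √v⁻¹ * A := by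
      refine (abs_le_of_sq_le_sq' (h2.trans_eq ?_) (by positivity)).2
      rw [mul_pow, Real.sq_sqrt (inv_pos.2 hΩ0).le, div_eq_inv_mul]
    calc |c| ≤ v⁻¹ * ∫ y in Ω, |φ y| := h1
      _ ≤ v⁻¹ * (C₂ * G) := by
          gcongr
          exact htr φ hφ
      _ = C₂ * (v⁻¹ * G) := by ring
      _ ≤ C₂ * (√v⁻¹ * A) := by gcongr
      _ = _ := by ring
  have e : φ = (fun x => φ x - c) + fun _ => c := by
    funext x
    simp
  have hconst : eLpNorm (fun _ : Sp N => c) (ENNReal.ofReal p) (volume.restrict Ω) =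
      ENNReal.ofReal (|c| * v ^ p⁻¹) := by
    rw [eLpNorm_const' _ (by simpa using hp0) ENNReal.ofReal_ne_top, ENNReal.toReal_ofReal hp0.le,
      Measure.restrict_apply_univ, Real.enorm_eq_ofReal_abs, ENNReal.ofReal_mul (abs_nonneg _), hv,
      measureReal_def, ← ENNReal.ofReal_rpow_of_nonneg ENNReal.toReal_nonneg (by positivity),
      ENNReal.ofReal_toReal h.finite.ne, one_div]
  calc eLpNorm φ (ENNReal.ofReal p) (volume.restrict Ω)
      ≤ eLpNorm (fun x => φ x - c) (ENNReal.ofReal p) (volume.restrict Ω) +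
        eLpNorm (fun _ : Sp N => c) (ENNReal.ofReal p) (volume.restrict Ω) := by
        conv_lhs => rw [e]
        refine eLpNorm_add_le ?_ aestronglyMeasurable_const (by simpa using hp1)
        exact (hφ.1.continuous.sub continuous_const).aestronglyMeasurable
    _ ≤ ENNReal.ofReal (C₁ * A) + ENNReal.ofReal (C₂ * √v⁻¹ * A * v ^ p⁻¹) := by
        rw [hconst]
        gcongr
        exact hsob φ hφ
    _ = ENNReal.ofReal ((C₁ + C₂ * √v⁻¹ * v ^ p⁻¹) * A) := by
        rw [← ENNReal.ofReal_add (by positivity) (by positivity)]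
        congr 1
        ring

end IsDoublingDomain

/-! ### The space `W₀^{1,2}` -/

theorem exists_subseq_tendsto_ae {α E : Type*} [MeasurableSpace α] [NormedAddCommGroup E]
    {μ : Measure α} {f : ℕ → α → E} {g : α → E} {p : ℝ≥0∞} (hp : p ≠ 0)
    (hf : ∀ n, AEStronglyMeasurable (f n) μ) (hg : AEStronglyMeasurable g μ)
    (h : Tendsto (fun n => eLpNorm (f n - g) p μ) atTop (𝓝 0)) :
    ∃ ns : ℕ → ℕ, StrictMono ns ∧ ∀ᵐ x ∂μ, Tendsto (fun i => f (ns i) x) atTop (𝓝 (g x)) :=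
  (tendstoInMeasure_of_tendsto_eLpNorm hp hf hg h).exists_seq_tendsto_ae

theorem integrable_inner_of_memLp {α E : Type*} [MeasurableSpace α] [NormedAddCommGroup E]
    [InnerProductSpace ℝ E] {μ : Measure α} {f g : α → E} (hf : MemLp f 2 μ) (hg : MemLp g 2 μ) :
    Integrable (fun x => inner ℝ (f x) (g x)) μ := by
  refine (L2.integrable_inner (𝕜 := ℝ) (hf.toLp f) (hg.toLp g)).congr ?_
  filter_upwards [hf.coeFn_toLp, hg.coeFn_toLp] with x h1 h2
  rw [h1, h2]

theorem eLpNorm_two_eq {α E : Type*} [MeasurableSpace α] [NormedAddCommGroup E]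
    {μ : Measure α} {f : α → E} (hf : MemLp f 2 μ) :
    eLpNorm f 2 μ = ENNReal.ofReal √(∫ x, ‖f x‖ ^ 2 ∂μ) := by
  rw [hf.eLpNorm_eq_integral_rpow_norm (by norm_num) (by norm_num), Real.sqrt_eq_rpow]
  simp

namespace IsW0

variable {X : Fields m N} {Ω : Set (Sp N)} {u v : Sp N → ℝ} {g h : Sp N → Sp m}

theorem sub (hX : ∀ j, Continuous (X j)) (hu : IsW0 Ω X u g) (hv : IsW0 Ω X v h) :
    IsW0 Ω X (u - v) (g - h) := by
  obtain ⟨hu1, hg2, φ, hφ, hφu, hφg⟩ := hu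
  obtain ⟨hv1, hh2, ψ, hψ, hψv, hψh⟩ := hv
  refine ⟨hu1.sub hv1, hg2.sub hh2, fun n => φ n - ψ n, fun n => (hφ n).sub (hψ n), ?_, ?_⟩
  · refine tendsto_of_tendsto_of_tendsto_of_le_of_le tendsto_const_nhds
      (by simpa using hφu.add hψv) (fun _ => zero_le) fun n => ?_
    have e : φ n - ψ n - (u - v) = (φ n - u) - (ψ n - v) := by abel
    rw [e]
    exact eLpNorm_sub_le ((hφ n).1.continuous.aestronglyMeasurable.sub hu1.1)
      ((hψ n).1.continuous.aestronglyMeasurable.sub hv1.1) le_rfl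
  · refine tendsto_of_tendsto_of_tendsto_of_le_of_le tendsto_const_nhds
      (by simpa using hφg.add hψh) (fun _ => zero_le) fun n => ?_
    have e : xGrad X (φ n - ψ n) - (g - h) = (xGrad X (φ n) - g) - (xGrad X (ψ n) - h) := by
      rw [xGrad_sub X (hφ n).differentiable (hψ n).differentiable]
      abel
    rw [e]
    exact eLpNorm_sub_le ((continuous_xGrad hX (hφ n).1).aestronglyMeasurable.sub hg2.1)
      ((continuous_xGrad hX (hψ n).1).aestronglyMeasurable.sub hh2.1) (by norm_num)

/-- Fatou's lemma along a subsequence converging almost everywhere. In particular the X-gradient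
determines the function. -/
theorem sobolev (hX : ∀ j, Continuous (X j)) {q C : ℝ≥0∞} (hC : C ≠ ⊤)
    (hS : ∀ φ, IsTest Ω φ → eLpNorm φ q (volume.restrict Ω) ≤
      C * eLpNorm (xGrad X φ) 2 (volume.restrict Ω))
    (hu : IsW0 Ω X u g) :
    eLpNorm u q (volume.restrict Ω) ≤ C * eLpNorm g 2 (volume.restrict Ω) := by
  obtain ⟨hu1, hg2, φ, hφ, hφu, hφg⟩ := hu
  obtain ⟨ns, hns, hae⟩ := exists_subseq_tendsto_ae one_ne_zero
    (fun n => (hφ n).1.continuous.aestronglyMeasurable) hu1.1 hφu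
  refine (Lp.eLpNorm_lim_le_liminf_eLpNorm
    (fun n => (hφ (ns n)).1.continuous.aestronglyMeasurable) u hae).trans ?_
  have hlim : Tendsto (fun n => C * (eLpNorm (xGrad X (φ (ns n)) - g) 2 (volume.restrict Ω) +
      eLpNorm g 2 (volume.restrict Ω))) atTop (𝓝 (C * (0 + eLpNorm g 2 (volume.restrict Ω)))) :=
    ENNReal.Tendsto.const_mul ((hφg.comp hns.tendsto_atTop).add tendsto_const_nhds) (Or.inr hC)
  rw [zero_add] at hlim
  rw [← hlim.liminf_eq]
  refine liminf_le_liminf (Eventually.of_forall fun n => (hS _ (hφ (ns n))).trans ?_)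
  gcongr
  have e : xGrad X (φ (ns n)) = (xGrad X (φ (ns n)) - g) + g := by abel
  conv_lhs => rw [e]
  exact eLpNorm_add_le ((continuous_xGrad hX (hφ (ns n)).1).aestronglyMeasurable.sub hg2.1)
    hg2.1 (by norm_num)

/-- The chain rule. -/
theorem comp (hX : ∀ j, Continuous (X j)) (hu : IsW0 Ω X u g) {G : ℝ → ℝ} (hG : ContDiff ℝ ∞ G)
    (hG0 : G 0 = 0) {K : ℝ} (hK : ∀ t, |deriv G t| ≤ K) :
    IsW0 Ω X (fun x => G (u x)) (fun x => deriv G (u x) • g x) := by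
  obtain ⟨hu1, hg2, φ, hφ, hφu, hφg⟩ := hu
  set μ := volume.restrict Ω with hμ
  have hK0 : 0 ≤ K := (abs_nonneg _).trans (hK 0)
  have hGd : Differentiable ℝ G := hG.differentiable (by simp)
  have hG' : Continuous (deriv G) := hG.continuous_deriv (by simp)
  have hlip : ∀ s t, |G s - G t| ≤ K * |s - t| := fun s t => by
    simpa using Convex.norm_image_sub_le_of_norm_deriv_le (s := Set.univ) (f := G) (C := K)
      (fun x _ => hGd x) (fun x _ => hK x) convex_univ (Set.mem_univ t) (Set.mem_univ s)
  have hdm : AEStronglyMeasurable (fun x => deriv G (u x)) μ :=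
    hG'.comp_aestronglyMeasurable hu1.1
  have hpm : ∀ n, AEStronglyMeasurable (fun x => deriv G (φ n x)) μ := fun n =>
    (hG'.comp (hφ n).1.continuous).aestronglyMeasurable
  have hxm : ∀ n, AEStronglyMeasurable (xGrad X (φ n)) μ := fun n =>
    (continuous_xGrad hX (hφ n).1).aestronglyMeasurable
  obtain ⟨ns, hns, hae⟩ := exists_subseq_tendsto_ae one_ne_zero
    (fun n => (hφ n).1.continuous.aestronglyMeasurable) hu1.1 hφu
  refine ⟨?_, ?_, fun n x => G (φ (ns n) x), fun n => ?_, ?_, ?_⟩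
  · refine MemLp.of_le_mul (c := K) hu1 (hG.continuous.comp_aestronglyMeasurable hu1.1)
      (Eventually.of_forall fun x => ?_)
    simpa [hG0] using hlip (u x) 0
  · refine MemLp.of_le_mul (c := K) hg2 (hdm.smul hg2.1) (Eventually.of_forall fun x => ?_)
    rw [norm_smul]
    exact mul_le_mul_of_nonneg_right (hK _) (norm_nonneg _)
  · refine ⟨hG.comp (hφ _).1, (hφ _).2.1.comp_left hG0, ?_⟩
    exact (closure_mono (Function.support_comp_subset hG0 _)).trans (hφ (ns n)).2.2
  · have h1 : Tendsto (fun n => ENNReal.ofReal K * eLpNorm (φ (ns n) - u) 1 μ) atTop (𝓝 0) := by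
      simpa using ENNReal.Tendsto.const_mul (hφu.comp hns.tendsto_atTop)
        (Or.inr (ENNReal.ofReal_ne_top (r := K)))
    refine tendsto_of_tendsto_of_tendsto_of_le_of_le tendsto_const_nhds h1
      (fun _ => zero_le) fun n => ?_
    exact eLpNorm_le_mul_eLpNorm_of_ae_le_mul
      (Eventually.of_forall fun x => hlip (φ (ns n) x) (u x)) 1
  · have hgrad : ∀ n, xGrad X (fun x => G (φ n x)) = fun x => deriv G (φ n x) • xGrad X (φ n) x := by
      intro n
      funext x
      have h1 := ((hGd (φ n x)).hasDerivAt.comp_hasFDerivAt x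
        ((hφ n).differentiable x).hasFDerivAt).fderiv
      ext j
      have h2 : fderiv ℝ (fun x => G (φ n x)) x = deriv G (φ n x) • fderiv ℝ (φ n) x := h1
      simp [xGrad, h2]
    have hsec : Tendsto (fun n => eLpNorm (fun x => (deriv G (φ (ns n) x) - deriv G (u x)) • g x) 2 μ)
        atTop (𝓝 0) := by
      have hdom : Tendsto (fun n => ∫⁻ x, ‖(deriv G (φ (ns n) x) - deriv G (u x)) • g x‖ₑ ^ (2 : ℝ) ∂μ)
          atTop (𝓝 (∫⁻ _, 0 ∂μ)) := by
        refine tendsto_lintegral_of_dominated_convergence'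
          (fun x => (ENNReal.ofReal (2 * K) * ‖g x‖ₑ) ^ (2 : ℝ)) (fun n => ?_) (fun n => ?_) ?_ ?_
        · exact (((hpm (ns n)).sub hdm).smul hg2.1).enorm.pow_const _
        · refine Eventually.of_forall fun x => ?_
          beta_reduce
          rw [enorm_smul]
          gcongr
          rw [Real.enorm_eq_ofReal_abs]
          refine ENNReal.ofReal_le_ofReal ((abs_sub _ _).trans ?_)
          linarith [hK (φ (ns n) x), hK (u x)]
        · have h1 : ∫⁻ x, ‖g x‖ₑ ^ (2 : ℝ) ∂μ < ⊤ := by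
            simpa using (lintegral_rpow_enorm_lt_top_of_eLpNorm_lt_top (by norm_num)
              (by norm_num) hg2.2)
          simp_rw [ENNReal.mul_rpow_of_nonneg _ _ (show (0 : ℝ) ≤ 2 by norm_num)]
          rw [lintegral_const_mul' _ _ (by finiteness)]
          exact ENNReal.mul_ne_top (by finiteness) h1.ne
        · filter_upwards [hae] with x hx
          have h1 : Tendsto (fun n => (deriv G (φ (ns n) x) - deriv G (u x)) • g x) atTop
              (𝓝 ((deriv G (u x) - deriv G (u x)) • g x)) :=
            (((hG'.tendsto (u x)).comp hx).sub_const _).smul_const _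
          rw [sub_self, zero_smul] at h1
          have h2 := (ENNReal.continuous_rpow_const (y := 2)).tendsto _ |>.comp
            ((continuous_enorm.tendsto _).comp h1)
          simpa [Function.comp_def] using h2
      rw [lintegral_zero] at hdom
      have h3 := (ENNReal.continuous_rpow_const (y := 1 / 2)).tendsto _ |>.comp hdom
      have e : ∀ n, eLpNorm (fun x => (deriv G (φ (ns n) x) - deriv G (u x)) • g x) 2 μ =
          (∫⁻ x, ‖(deriv G (φ (ns n) x) - deriv G (u x)) • g x‖ₑ ^ (2 : ℝ) ∂μ) ^ (1 / 2 : ℝ) :=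
        fun n => by
          rw [eLpNorm_eq_lintegral_rpow_enorm_toReal (by norm_num) (by norm_num)]
          simp
      simp_rw [e]
      simpa [Function.comp_def] using h3
    have hfst : Tendsto (fun n => ENNReal.ofReal K * eLpNorm (xGrad X (φ (ns n)) - g) 2 μ) atTop
        (𝓝 0) := by
      simpa using ENNReal.Tendsto.const_mul (hφg.comp hns.tendsto_atTop)
        (Or.inr (ENNReal.ofReal_ne_top (r := K)))
    refine tendsto_of_tendsto_of_tendsto_of_le_of_le tendsto_const_nhds
      (by simpa using hfst.add hsec) (fun _ => zero_le) fun n => ?_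
    -- The first term is controlled by |G'| ≤ K and the convergence of gradients. The second tends
    -- to 0 by dominated convergence, for which almost everywhere convergence of the functions was
    -- arranged.
    have e : (xGrad X (fun x => G (φ (ns n) x)) - fun x => deriv G (u x) • g x) =
        (fun x => deriv G (φ (ns n) x) • (xGrad X (φ (ns n)) - g) x) +
          fun x => (deriv G (φ (ns n) x) - deriv G (u x)) • g x := by
      funext x
      rw [hgrad]
      simp only [Pi.sub_apply, Pi.add_apply, smul_sub, sub_smul]
      abel
    rw [e]
    refine (eLpNorm_add_le ((hpm _).smul ((hxm _).sub hg2.1)) (((hpm _).sub hdm).smul hg2.1)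
      (by norm_num)).trans ?_
    refine add_le_add ?_ le_rfl
    refine eLpNorm_le_mul_eLpNorm_of_ae_le_mul (Eventually.of_forall fun x => ?_) 2
    rw [Pi.smul_apply', norm_smul]
    exact mul_le_mul_of_nonneg_right (hK _) (norm_nonneg _)

end IsW0

/-! ### The bilinear form -/

namespace IsEllipticCoeff

variable {Ω : Set (Sp N)} {A : Sp N → Matrix (Fin m) (Fin m) ℝ} {α β : ℝ} {g h : Sp N → Sp m}

theorem memLp_app (hA : IsEllipticCoeff Ω A α β) (hg : MemLp g 2 (volume.restrict Ω)) :
    MemLp (fun x => app (A x) (g x)) 2 (volume.restrict Ω) := by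
  refine MemLp.of_le_mul (c := β) hg ?_ ?_
  · refine AEMeasurable.aestronglyMeasurable ?_
    refine (PiLp.continuous_toLp 2 _).measurable.comp_aemeasurable
      (aemeasurable_pi_lambda _ fun i => ?_)
    simp only [Matrix.mulVec, dotProduct]
    refine Finset.aemeasurable_fun_sum _ fun j _ => (hA.1 i j).mul ?_
    have : Measurable fun w : Sp m => w j := (PiLp.continuous_apply 2 _ j).measurable
    exact this.comp_aemeasurable hg.1.aemeasurable
  · filter_upwards [hA.2] with x hx
    exact (hx (g x)).2

theorem mul_integral_sq_le (hA : IsEllipticCoeff Ω A α β) (hg : MemLp g 2 (volume.restrict Ω)) :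
    α * ∫ x in Ω, ‖g x‖ ^ 2 ≤ ∫ x in Ω, inner ℝ (app (A x) (g x)) (g x) := by
  rw [← integral_const_mul]
  refine integral_mono_ae ((hg.integrable_norm_pow (by norm_num)).const_mul α)
    (integrable_inner_of_memLp (hA.memLp_app hg) hg) ?_
  filter_upwards [hA.2] with x hx
  exact (hx (g x)).1

end IsEllipticCoeff

theorem app_add (M : Matrix (Fin m) (Fin m) ℝ) (v w : Sp m) : app M (v + w) = app M v + app M w := by
  simp [app, Matrix.mulVec_add]

theorem app_sub (M : Matrix (Fin m) (Fin m) ℝ) (v w : Sp m) : app M (v - w) = app M v - app M w := by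
  simp [app, Matrix.mulVec_sub]

theorem app_smul (M : Matrix (Fin m) (Fin m) ℝ) (c : ℝ) (v : Sp m) :
    app M (c • v) = c • app M v := by
  simp [app, Matrix.mulVec_smul]

/-! ### Existence and uniqueness -/

theorem IsTest.zero (Ω : Set (Sp N)) : IsTest Ω (0 : Sp N → ℝ) :=
  ⟨contDiff_const, HasCompactSupport.zero, by simp [tsupport]⟩

/-- The classes of `X`-gradients of test functions. -/
def testGradients {X : Fields m N} (hX : ∀ j, Continuous (X j)) (Ω : Set (Sp N)) :
    Submodule ℝ (Lp (Sp m) 2 (volume.restrict Ω)) where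
  carrier := {w | ∃ φ, ∃ hφ : IsTest Ω φ,
    w = (((hφ.memLp_xGrad hX 2).restrict Ω).toLp (xGrad X φ))}
  zero_mem' := by
    refine ⟨0, IsTest.zero Ω, ?_⟩
    refine (Lp.eq_zero_iff_ae_eq_zero.2 ?_).symm
    refine (MemLp.coeFn_toLp _).trans (Eventually.of_forall fun x => ?_)
    ext j
    simp [xGrad]
  add_mem' := by
    rintro _ _ ⟨φ, hφ, rfl⟩ ⟨ψ, hψ, rfl⟩
    refine ⟨φ - fun y => -1 * ψ y, hφ.sub (hψ.const_mul (-1)), ?_⟩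
    rw [← MemLp.toLp_add]
    refine MemLp.toLp_congr _ _ (Eventually.of_forall fun x => ?_)
    rw [xGrad_sub X hφ.differentiable (hψ.const_mul (-1)).differentiable, Pi.sub_apply,
      xGrad_const_mul X hψ.differentiable]
    simp
  smul_mem' := by
    rintro c _ ⟨φ, hφ, rfl⟩
    refine ⟨_, hφ.const_mul c, ?_⟩
    rw [← MemLp.toLp_const_smul]
    refine MemLp.toLp_congr _ _ (Eventually.of_forall fun x => ?_)
    rw [xGrad_const_mul X hφ.differentiable, Pi.smul_apply]

/-- Multiplication by the coefficient matrix on `L²`. -/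
def coeffMul {Ω : Set (Sp N)} {A : Sp N → Matrix (Fin m) (Fin m) ℝ} {α β : ℝ}
    (hA : IsEllipticCoeff Ω A α β) :
    Lp (Sp m) 2 (volume.restrict Ω) →L[ℝ] Lp (Sp m) 2 (volume.restrict Ω) :=
  LinearMap.mkContinuous
    { toFun := fun g => (hA.memLp_app (Lp.memLp g)).toLp _
      map_add' := fun g h => by
        rw [← MemLp.toLp_add]
        refine MemLp.toLp_congr _ _ ?_
        filter_upwards [Lp.coeFn_add g h] with x hx
        rw [hx, Pi.add_apply, Pi.add_apply, app_add]
      map_smul' := fun c g => by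
        rw [RingHom.id_apply, ← MemLp.toLp_const_smul]
        refine MemLp.toLp_congr _ _ ?_
        filter_upwards [Lp.coeFn_smul c g] with x hx
        rw [hx, Pi.smul_apply, Pi.smul_apply, app_smul] }
    β fun g => by
      refine Lp.norm_le_mul_norm_of_ae_le_mul ?_
      simp only [LinearMap.coe_mk, AddHom.coe_mk]
      filter_upwards [(hA.memLp_app (Lp.memLp g)).coeFn_toLp, hA.2] with x h1 h2
      rw [h1]
      exact (h2 _).2

theorem coeffMul_coeFn {Ω : Set (Sp N)} {A : Sp N → Matrix (Fin m) (Fin m) ℝ} {α β : ℝ}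
    (hA : IsEllipticCoeff Ω A α β) (g : Lp (Sp m) 2 (volume.restrict Ω)) :
    coeffMul hA g =ᵐ[volume.restrict Ω] fun x => app (A x) (g x) :=
  (hA.memLp_app (Lp.memLp g)).coeFn_toLp

theorem exists_laxMilgram {H : Type*} [NormedAddCommGroup H] [InnerProductSpace ℝ H]
    [CompleteSpace H] (V : Submodule ℝ H) (hV : IsClosed (V : Set H)) (T : H →L[ℝ] H) {α : ℝ}
    (hα : 0 < α) (hT : ∀ v, α * ‖v‖ ^ 2 ≤ inner ℝ (T v) v) (F : H) :
    ∃ v ∈ V, ∀ w ∈ V, inner ℝ (T v) w = inner ℝ F w := by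
  have : CompleteSpace V := hV.completeSpace_coe
  let B₀ : V →ₗ[ℝ] V →ₗ[ℝ] ℝ := LinearMap.mk₂ ℝ (fun v w => inner ℝ (T v) (w : H))
    (fun v v' w => by simp [inner_add_left]) (fun c v w => by simp [inner_smul_left])
    (fun v w w' => by simp [inner_add_right]) (fun c v w => by simp [inner_smul_right])
  let B : V →L[ℝ] V →L[ℝ] ℝ := B₀.mkContinuous₂ ‖T‖ fun v w => by
    refine (norm_inner_le_norm _ _).trans ?_
    exact mul_le_mul_of_nonneg_right (T.le_opNorm v) (norm_nonneg _)
  have hB : ∀ v w, B v w = inner ℝ (T v) (w : H) := fun v w => rfl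
  have hco : IsCoercive B := ⟨α, hα, fun v => by
    rw [hB, mul_assoc, ← sq]
    exact hT v⟩
  let f : V := (InnerProductSpace.toDual ℝ V).symm ((innerSL ℝ F).comp V.subtypeL)
  have hf : ∀ w : V, inner ℝ f w = inner ℝ F (w : H) := fun w => by
    simp only [f, InnerProductSpace.toDual_symm_apply]
    rfl
  refine ⟨hco.continuousLinearEquivOfBilin.symm f, Subtype.property _, fun w hw => ?_⟩
  have h1 := hco.continuousLinearEquivOfBilin_apply (hco.continuousLinearEquivOfBilin.symm f) ⟨w, hw⟩
  rw [ContinuousLinearEquiv.apply_symm_apply, hB, hf] at h1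
  exact h1.symm

/-- Test functions whose gradients are Cauchy in L² are themselves Cauchy in L¹ by the assumed
inequality, so a limit of gradients comes with a limit function. -/
theorem exists_isW0_of_mem_closure {X : Fields m N} (hX : ∀ j, Continuous (X j)) {Ω : Set (Sp N)}
    {C : ℝ≥0∞} (hC : C ≠ ⊤)
    (hS : ∀ φ, IsTest Ω φ → eLpNorm φ 1 (volume.restrict Ω) ≤
      C * eLpNorm (xGrad X φ) 2 (volume.restrict Ω))
    {w : Lp (Sp m) 2 (volume.restrict Ω)} (hw : w ∈ (testGradients hX Ω).topologicalClosure) :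
    ∃ u, IsW0 Ω X u w := by
  have hw' : w ∈ closure (testGradients hX Ω : Set (Lp (Sp m) 2 (volume.restrict Ω))) := hw
  obtain ⟨b, hb, hlim⟩ := mem_closure_iff_seq_limit.1 hw'
  choose φ hφ hbφ using hb
  have hL1 : ∀ n, MemLp (φ n) 1 (volume.restrict Ω) := fun n =>
    memLp_one_iff_integrable.2 (hφ n).integrable.integrableOn
  set a : ℕ → Lp ℝ 1 (volume.restrict Ω) := fun n => (hL1 n).toLp (φ n) with ha
  have hdist : ∀ n k, dist (a n) (a k) ≤ C.toReal * dist (b n) (b k) := by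
    intro n k
    have e1 : dist (b n) (b k) = (eLpNorm (xGrad X (φ n - φ k)) 2 (volume.restrict Ω)).toReal := by
      rw [hbφ n, hbφ k, dist_eq_norm, ← MemLp.toLp_sub, Lp.norm_toLp,
        xGrad_sub X (hφ n).differentiable (hφ k).differentiable]
    have e2 : dist (a n) (a k) = (eLpNorm (φ n - φ k) 1 (volume.restrict Ω)).toReal := by
      rw [ha, dist_eq_norm, ← MemLp.toLp_sub, Lp.norm_toLp]
    rw [e1, e2, ← ENNReal.toReal_mul]
    refine ENNReal.toReal_mono ?_ (hS _ ((hφ n).sub (hφ k)))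
    exact ENNReal.mul_ne_top hC ((((hφ n).sub (hφ k)).memLp_xGrad hX 2).restrict Ω).2.ne
  have hcau : CauchySeq a := by
    have hb' := hlim.cauchySeq
    rw [Metric.cauchySeq_iff] at hb' ⊢
    intro ε hε
    obtain ⟨n₀, h0⟩ := hb' (ε / (C.toReal + 1)) (by positivity)
    refine ⟨n₀, fun n hn k hk => (hdist n k).trans_lt ?_⟩
    have h1 := h0 n hn k hk
    rw [lt_div_iff₀ (by positivity)] at h1
    nlinarith [dist_nonneg (x := b n) (y := b k)]
  obtain ⟨u, hu⟩ := cauchySeq_tendsto_of_complete hcau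
  refine ⟨u, Lp.memLp u, Lp.memLp w, φ, hφ, ?_, ?_⟩
  · refine ((Lp.tendsto_Lp_iff_tendsto_eLpNorm' _ _).1 hu).congr fun n => eLpNorm_congr_ae ?_
    filter_upwards [(hL1 n).coeFn_toLp] with x hx
    simp only [Pi.sub_apply, ha, hx]
  · refine ((Lp.tendsto_Lp_iff_tendsto_eLpNorm' _ _).1 hlim).congr fun n => eLpNorm_congr_ae ?_
    filter_upwards [(((hφ n).memLp_xGrad hX 2).restrict Ω).coeFn_toLp] with x hx
    simp only [Pi.sub_apply, hbφ n, hx]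

theorem IsW0.toLp_mem_closure {X : Fields m N} (hX : ∀ j, Continuous (X j)) {Ω : Set (Sp N)}
    {u : Sp N → ℝ} {g : Sp N → Sp m} (hu : IsW0 Ω X u g) :
    hu.2.1.toLp g ∈ (testGradients hX Ω).topologicalClosure := by
  obtain ⟨hu1, hg2, φ, hφ, hφu, hφg⟩ := hu
  refine mem_closure_of_tendsto ((Lp.tendsto_Lp_iff_tendsto_eLpNorm'' _
    (fun n => ((hφ n).memLp_xGrad hX 2).restrict Ω) g hg2).2 hφg) ?_
  exact Eventually.of_forall fun n => ⟨φ n, hφ n, rfl⟩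

theorem exists_isWeakSolution {X : Fields m N} (hX : ∀ j, Continuous (X j)) {Ω : Set (Sp N)}
    {C : ℝ≥0∞} (hC : C ≠ ⊤)
    (hS : ∀ φ, IsTest Ω φ → eLpNorm φ 1 (volume.restrict Ω) ≤
      C * eLpNorm (xGrad X φ) 2 (volume.restrict Ω))
    {A : Sp N → Matrix (Fin m) (Fin m) ℝ} {α β : ℝ} (hα : 0 < α) (hA : IsEllipticCoeff Ω A α β)
    {F : Sp N → Sp m} (hF : MemLp F 2 (volume.restrict Ω)) :
    ∃ u, IsWeakSolution Ω X A F u := by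
  obtain ⟨w, hw, hweak⟩ := exists_laxMilgram (testGradients hX Ω).topologicalClosure
    (Submodule.isClosed_topologicalClosure _) (coeffMul hA) hα (fun v => by
      have h1 := hA.mul_integral_sq_le (Lp.memLp v)
      have h2 : ‖v‖ ^ 2 = ∫ x in Ω, ‖v x‖ ^ 2 := by
        rw [← real_inner_self_eq_norm_sq, L2.inner_def]
        simp_rw [real_inner_self_eq_norm_sq]
      rw [h2, L2.inner_def]
      refine h1.trans_eq (integral_congr_ae ?_)
      filter_upwards [coeffMul_coeFn hA v] with x hx
      rw [hx]) (hF.toLp F)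
  obtain ⟨u, hu⟩ := exists_isW0_of_mem_closure hX hC hS hw
  refine ⟨u, w, hu, fun v h hv => ?_⟩
  have h1 := hweak _ (hv.toLp_mem_closure hX)
  rw [L2.inner_def, L2.inner_def] at h1
  refine (Eq.trans (integral_congr_ae ?_) h1).trans (integral_congr_ae ?_)
  · filter_upwards [coeffMul_coeFn hA w, hv.2.1.coeFn_toLp] with x h2 h3
    rw [h2, h3]
  · filter_upwards [hF.coeFn_toLp, hv.2.1.coeFn_toLp] with x h2 h3
    rw [h2, h3]

/-- The difference of two solutions is an admissible test function. Coercivity makes its gradient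
vanish, and the Sobolev inequality then makes the function vanish. -/
theorem IsWeakSolution.ae_eq {X : Fields m N} (hX : ∀ j, Continuous (X j)) {Ω : Set (Sp N)}
    {C : ℝ≥0∞} (hC : C ≠ ⊤)
    (hS : ∀ φ, IsTest Ω φ → eLpNorm φ 1 (volume.restrict Ω) ≤
      C * eLpNorm (xGrad X φ) 2 (volume.restrict Ω))
    {A : Sp N → Matrix (Fin m) (Fin m) ℝ} {α β : ℝ} (hα : 0 < α) (hA : IsEllipticCoeff Ω A α β)
    {F : Sp N → Sp m} {u w : Sp N → ℝ} (hu : IsWeakSolution Ω X A F u)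
    (hw : IsWeakSolution Ω X A F w) : w =ᵐ[volume.restrict Ω] u := by
  obtain ⟨g, hu0, hug⟩ := hu
  obtain ⟨k, hw0, hwk⟩ := hw
  have hd := hw0.sub hX hu0
  have h1 : ∫ x in Ω, inner ℝ (app (A x) ((k - g) x)) ((k - g) x) = 0 := by
    have e : ∀ x, inner ℝ (app (A x) ((k - g) x)) ((k - g) x) =
        inner ℝ (app (A x) (k x)) ((k - g) x) - inner ℝ (app (A x) (g x)) ((k - g) x) := fun x => by
      rw [← inner_sub_left, ← app_sub, Pi.sub_apply]
    simp_rw [e]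
    rw [integral_sub (integrable_inner_of_memLp (hA.memLp_app hw0.2.1) hd.2.1)
      (integrable_inner_of_memLp (hA.memLp_app hu0.2.1) hd.2.1), hwk _ _ hd, hug _ _ hd, sub_self]
  have h2 := hA.mul_integral_sq_le hd.2.1
  rw [h1] at h2
  have h3 : ∫ x in Ω, ‖(k - g) x‖ ^ 2 = 0 := by
    refine le_antisymm ?_ (by positivity)
    by_contra! hcon
    nlinarith
  have h4 : eLpNorm (k - g) 2 (volume.restrict Ω) = 0 := by
    rw [eLpNorm_two_eq hd.2.1, h3]
    simp
  have h5 := hd.sobolev hX hC hS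
  rw [h4, mul_zero, nonpos_iff_eq_zero, eLpNorm_eq_zero_iff hd.1.1 one_ne_zero] at h5
  filter_upwards [h5] with x hx
  simpa [sub_eq_zero] using hx

/-! ### The energy estimate -/

/-- The test function ∫₀^u ρ² has X-gradient ρ(u)²Xu, and one factor ρ(u) can be moved to each side
of the form. Hence ‖ρ(u)Xu‖_2 ≤ α⁻¹‖ρ(u)F‖_2, where ρ(u)Xu is the X-gradient of ∫₀^u ρ. Smoothness
of ρ keeps compositions with test functions among the test functions. -/
theorem energy_estimate {X : Fields m N} (hX : ∀ j, Continuous (X j)) {Ω : Set (Sp N)}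
    {q C : ℝ≥0∞} (hC : C ≠ ⊤)
    (hS : ∀ φ, IsTest Ω φ → eLpNorm φ q (volume.restrict Ω) ≤
      C * eLpNorm (xGrad X φ) 2 (volume.restrict Ω))
    {A : Sp N → Matrix (Fin m) (Fin m) ℝ} {α β : ℝ} (hα : 0 < α) (hA : IsEllipticCoeff Ω A α β)
    {F : Sp N → Sp m} (hF : MemLp F 2 (volume.restrict Ω)) {u : Sp N → ℝ}
    (hu : IsWeakSolution Ω X A F u) {ρ : ℝ → ℝ} (hρ : ContDiff ℝ ∞ ρ) {K : ℝ}
    (hK : ∀ t, |ρ t| ≤ K) :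
    eLpNorm (fun x => ∫ s in 0..u x, ρ s) q (volume.restrict Ω) ≤
      C * ENNReal.ofReal α⁻¹ * eLpNorm (fun x => ρ (u x) • F x) 2 (volume.restrict Ω) := by
  obtain ⟨g, hu0, hug⟩ := hu
  have hprim : ∀ σ : ℝ → ℝ, ContDiff ℝ ∞ σ → ContDiff ℝ ∞ (fun t => ∫ s in 0..t, σ s) ∧
      deriv (fun t => ∫ s in 0..t, σ s) = σ := by
    intro σ hσ
    have hd : ∀ t, HasDerivAt (fun t => ∫ s in 0..t, σ s) (σ t) t := fun t =>
      intervalIntegral.integral_hasDerivAt_right (hσ.continuous.intervalIntegrable _ _)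
        (hσ.continuous.stronglyMeasurableAtFilter _ _) hσ.continuous.continuousAt
    have hd' : deriv (fun t => ∫ s in 0..t, σ s) = σ := funext fun t => (hd t).deriv
    refine ⟨contDiff_infty_iff_deriv.2 ⟨fun t => (hd t).differentiableAt, ?_⟩, hd'⟩
    rwa [hd']
  obtain ⟨hG, hG'⟩ := hprim ρ hρ
  obtain ⟨hH, hH'⟩ := hprim (fun t => ρ t ^ 2) (hρ.pow 2)
  have hGW := hu0.comp hX hG (by simp) (K := K) (by rwa [hG'])
  have hHW := hu0.comp hX hH (by simp) (K := K ^ 2) (fun t => by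
    rw [hH', abs_pow]
    have := hK t
    gcongr)
  rw [hG'] at hGW
  rw [hH'] at hHW
  have hρm : AEStronglyMeasurable (fun x => ρ (u x)) (volume.restrict Ω) :=
    hρ.continuous.comp_aestronglyMeasurable hu0.1.1
  have hρF : MemLp (fun x => ρ (u x) • F x) 2 (volume.restrict Ω) := by
    refine MemLp.of_le_mul (c := K) hF (hρm.smul hF.1) (Eventually.of_forall fun x => ?_)
    rw [norm_smul]
    exact mul_le_mul_of_nonneg_right (hK _) (norm_nonneg _)
  have hρg := hGW.2.1
  have h1 := hug _ _ hHW
  have h2 := hA.mul_integral_sq_le hρg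
  have e1 : ∫ x in Ω, inner ℝ (app (A x) (ρ (u x) • g x)) (ρ (u x) • g x) =
      ∫ x in Ω, inner ℝ (app (A x) (g x)) (ρ (u x) ^ 2 • g x) := by
    refine integral_congr_ae (Eventually.of_forall fun x => ?_)
    simp only [app_smul, inner_smul_left, inner_smul_right]
    simp
    ring
  have e2 : ∫ x in Ω, inner ℝ (F x) (ρ (u x) ^ 2 • g x) =
      ∫ x in Ω, inner ℝ (ρ (u x) • F x) (ρ (u x) • g x) := by
    refine integral_congr_ae (Eventually.of_forall fun x => ?_)
    simp only [inner_smul_left, inner_smul_right]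
    simp
    ring
  have hI1 : Integrable (fun x => ‖ρ (u x) • F x‖ ^ 2) (volume.restrict Ω) :=
    hρF.integrable_norm_pow (by norm_num)
  have hI2 : Integrable (fun x => ‖ρ (u x) • g x‖ ^ 2) (volume.restrict Ω) :=
    hρg.integrable_norm_pow (by norm_num)
  -- Young's inequality, weighted so that half of the coercive term absorbs the gradient.
  have h3 : ∫ x in Ω, inner ℝ (ρ (u x) • F x) (ρ (u x) • g x) ≤
      ∫ x in Ω, ((2 * α)⁻¹ * ‖ρ (u x) • F x‖ ^ 2 + α / 2 * ‖ρ (u x) • g x‖ ^ 2) := by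
    refine integral_mono (integrable_inner_of_memLp hρF hρg)
      ((hI1.const_mul _).add (hI2.const_mul _)) fun x => ?_
    refine (real_inner_le_norm _ _).trans ?_
    have h4 : 0 ≤ (2 * α)⁻¹ * (‖ρ (u x) • F x‖ - α * ‖ρ (u x) • g x‖) ^ 2 := by positivity
    have h5 : (2 * α)⁻¹ * (‖ρ (u x) • F x‖ - α * ‖ρ (u x) • g x‖) ^ 2 =
        ((2 * α)⁻¹ * ‖ρ (u x) • F x‖ ^ 2 + α / 2 * ‖ρ (u x) • g x‖ ^ 2) -
          ‖ρ (u x) • F x‖ * ‖ρ (u x) • g x‖ := by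
      field_simp
      ring
    linarith
  rw [integral_add (hI1.const_mul _) (hI2.const_mul _), integral_const_mul, integral_const_mul] at h3
  set I := ∫ x in Ω, ‖ρ (u x) • F x‖ ^ 2 with hI
  set J := ∫ x in Ω, ‖ρ (u x) • g x‖ ^ 2 with hJ
  have h6 : J ≤ (α⁻¹) ^ 2 * I := by
    have h7 : α / 2 * J ≤ (2 * α)⁻¹ * I := by linarith
    calc J = (2 / α) * (α / 2 * J) := by field_simp
      _ ≤ (2 / α) * ((2 * α)⁻¹ * I) := by gcongr
      _ = (α⁻¹) ^ 2 * I := by field_simp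
  refine (hGW.sobolev hX hC hS).trans ?_
  rw [mul_assoc]
  gcongr
  rw [eLpNorm_two_eq hρg, eLpNorm_two_eq hρF, ← ENNReal.ofReal_mul (by positivity)]
  refine ENNReal.ofReal_le_ofReal ?_
  refine Real.sqrt_le_iff.2 ⟨by positivity, ?_⟩
  rw [mul_pow, Real.sq_sqrt (by positivity)]
  exact h6

/-! ### Integrability below the critical exponent -/

/-- A sublinear right-hand side can be absorbed. The resulting bound depends only on L, v and θ,
which makes it uniform in the truncation. -/
theorem le_of_le_mul_add_rpow {θ y L v : ℝ} (hθ : θ < 1) (hy : 0 ≤ y) (hL : 0 ≤ L)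
    (hv : 0 ≤ v) (h : y ≤ L * (v + y ^ θ)) (hθ0 : 0 ≤ θ) :
    y ≤ 1 + (L * (v + 1)) ^ (1 - θ)⁻¹ := by
  have hL' : 0 ≤ (L * (v + 1)) ^ (1 - θ)⁻¹ := by positivity
  rcases le_total y 1 with h1 | h1
  · linarith
  have hy0 : 0 < y := by linarith
  have h2 : 1 ≤ y ^ θ := Real.one_le_rpow h1 hθ0
  have h3 : y ≤ L * (v + 1) * y ^ θ := by
    refine h.trans ?_
    rw [mul_assoc]
    refine mul_le_mul_of_nonneg_left ?_ hL
    nlinarith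
  have h4 : y ^ (1 - θ) ≤ L * (v + 1) := by
    rw [Real.rpow_sub hy0, Real.rpow_one, div_le_iff₀ (by positivity)]
    exact h3
  have h5 : y = (y ^ (1 - θ)) ^ (1 - θ)⁻¹ := by
    rw [← Real.rpow_mul hy, mul_inv_cancel₀ (by linarith), Real.rpow_one]
  have h6 : y ≤ (L * (v + 1)) ^ (1 - θ)⁻¹ := by
    rw [h5]
    exact Real.rpow_le_rpow (by positivity) h4 (by simp; linarith)
  linarith

/-- A bounded smooth approximation of `1 + t²`. -/
def sqTrunc (k t : ℝ) : ℝ := (1 + t ^ 2) / (1 + t ^ 2 / k)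

section sqTrunc

variable {k : ℝ}

theorem sqTrunc_neg (k t : ℝ) : sqTrunc k (-t) = sqTrunc k t := by simp [sqTrunc]

theorem contDiff_sqTrunc (hk : 1 ≤ k) : ContDiff ℝ ∞ (sqTrunc k) := by
  unfold sqTrunc
  refine ContDiff.div (by fun_prop) (by fun_prop) fun t => ?_
  positivity

theorem one_le_sqTrunc (hk : 1 ≤ k) (t : ℝ) : 1 ≤ sqTrunc k t := by
  have : t ^ 2 / k ≤ t ^ 2 := div_le_self (sq_nonneg t) hk
  rw [sqTrunc, le_div_iff₀ (by positivity)]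
  linarith

theorem sqTrunc_le (hk : 1 ≤ k) (t : ℝ) : sqTrunc k t ≤ k := by
  rw [sqTrunc, div_le_iff₀ (by positivity), mul_add, mul_div_cancel₀ _ (by positivity)]
  linarith

theorem sqTrunc_le_add (hk : 1 ≤ k) (t : ℝ) : sqTrunc k t ≤ 1 + t ^ 2 := by
  have : 0 ≤ t ^ 2 / k := by positivity
  exact div_le_self (by positivity) (by linarith)

theorem sqTrunc_le_four_mul (hk : 1 ≤ k) {s t : ℝ} (ht : 0 ≤ t) (hs : t / 2 ≤ s) :
    sqTrunc k t ≤ 4 * sqTrunc k s := by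
  have h1 : t ^ 2 ≤ 4 * s ^ 2 := by nlinarith
  rw [sqTrunc, sqTrunc, ← mul_div_assoc, div_le_div_iff₀ (by positivity) (by positivity)]
  have e : (4 * (1 + s ^ 2)) * (1 + t ^ 2 / k) - (1 + t ^ 2) * (1 + s ^ 2 / k) =
      3 + (4 * s ^ 2 - t ^ 2) + (4 * t ^ 2 - s ^ 2 + 3 * (s ^ 2 * t ^ 2)) / k := by
    field_simp
    ring
  have h2 : -(4 * s ^ 2 - t ^ 2) ≤ (4 * t ^ 2 - s ^ 2 + 3 * (s ^ 2 * t ^ 2)) / k := by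
    rw [le_div_iff₀ (by positivity)]
    have h3 : 4 * s ^ 2 - t ^ 2 ≤ (4 * s ^ 2 - t ^ 2) * k := le_mul_of_one_le_right (by linarith) hk
    nlinarith [mul_nonneg (sq_nonneg s) (sq_nonneg t), sq_nonneg t, sq_nonneg s]
  linarith

theorem tendsto_sqTrunc (t : ℝ) :
    Tendsto (fun n : ℕ => sqTrunc (n + 1) t) atTop (𝓝 (1 + t ^ 2)) := by
  have h1 : Tendsto (fun n : ℕ => t ^ 2 / ((n : ℝ) + 1)) atTop (𝓝 0) :=
    tendsto_const_nhds.div_atTop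
      (tendsto_atTop_add_const_right _ _ tendsto_natCast_atTop_atTop)
  have h2 := (tendsto_const_nhds (x := 1 + t ^ 2)).div (tendsto_const_nhds.add h1)
    (show (1 : ℝ) + 0 ≠ 0 by norm_num)
  rw [add_zero, div_one] at h2
  exact h2

theorem continuous_sqTrunc_rpow (hk : 1 ≤ k) (b : ℝ) : Continuous fun t => sqTrunc k t ^ b :=
  (contDiff_sqTrunc hk).continuous.rpow_const
    fun t => Or.inl (by linarith [one_le_sqTrunc hk t])

theorem abs_integral_sqTrunc_rpow_abs (k b t : ℝ) :
    |∫ s in 0..|t|, sqTrunc k s ^ b| = |∫ s in 0..t, sqTrunc k s ^ b| := by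
  rcases abs_choice t with h | h
  · rw [h]
  · rw [h]
    have := intervalIntegral.integral_comp_neg (a := 0) (b := -t) fun s => sqTrunc k s ^ b
    simp only [sqTrunc_neg, neg_neg, neg_zero] at this
    rw [this, intervalIntegral.integral_symm, abs_neg]

/-- Only the half [t/2, t] of the interval is kept, on which the truncation is at least a quarter of
its value at t. -/
theorem mul_sqTrunc_rpow_le (hk : 1 ≤ k) {b t : ℝ} (hb : 0 ≤ b) (ht : 0 ≤ t) :
    t / 2 * (4⁻¹ ^ b * sqTrunc k t ^ b) ≤ ∫ s in 0..t, sqTrunc k s ^ b := by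
  have hint : ∀ x y, IntervalIntegrable (fun s => sqTrunc k s ^ b) volume x y :=
    (continuous_sqTrunc_rpow hk b).intervalIntegrable
  have hpos : ∀ s, 0 ≤ sqTrunc k s := fun s => by linarith [one_le_sqTrunc hk s]
  rw [← intervalIntegral.integral_add_adjacent_intervals (hint 0 (t / 2)) (hint (t / 2) t)]
  have h1 : 0 ≤ ∫ s in 0..t / 2, sqTrunc k s ^ b :=
    intervalIntegral.integral_nonneg (by positivity) fun s _ => Real.rpow_nonneg (hpos s) _
  have h2 : ∫ _ in t / 2..t, 4⁻¹ ^ b * sqTrunc k t ^ b ≤ ∫ s in t / 2..t, sqTrunc k s ^ b := by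
    refine intervalIntegral.integral_mono_on (by linarith) (by simp) (hint _ _) fun s hs => ?_
    rw [← Real.mul_rpow (by norm_num) (hpos t)]
    refine Real.rpow_le_rpow (by have := hpos t; positivity) ?_ hb
    linarith [sqTrunc_le_four_mul hk ht hs.1]
  rw [intervalIntegral.integral_const, smul_eq_mul] at h2
  have e : t - t / 2 = t / 2 := by ring
  rw [e] at h2
  linarith

end sqTrunc

/-- The power `a` of the truncation is controlled by the power `a / (a + 1)` of its primitive. -/
theorem exists_sqTrunc_rpow_le {a : ℝ} (ha : 0 < a) : ∃ c : ℝ, 0 < c ∧ ∀ k, 1 ≤ k → ∀ t,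
    sqTrunc k t ^ (a / 2) ≤ c * (1 + |∫ s in 0..t, sqTrunc k s ^ (a / 2)| ^ (a / (a + 1))) := by
  set c₁ : ℝ := (2 * Real.sqrt 2 * 4 ^ (a / 2)) ^ (a / (a + 1)) with hc₁
  refine ⟨2 ^ (a / 2) + c₁, by positivity, fun k hk t => ?_⟩
  rw [← abs_integral_sqTrunc_rpow_abs]
  have e0 : sqTrunc k t = sqTrunc k |t| := by simp [sqTrunc]
  rw [e0]
  have ht := abs_nonneg t
  set τ := |t| with hτ
  set I := ∫ s in 0..τ, sqTrunc k s ^ (a / 2) with hI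
  set B := sqTrunc k τ with hB
  have hB1 : 1 ≤ B := one_le_sqTrunc hk τ
  have hI0 := mul_sqTrunc_rpow_le hk (show 0 ≤ a / 2 by positivity) ht
  rw [← hI, ← hB] at hI0
  have hIpos : 0 ≤ I := le_trans (by positivity) hI0
  rw [abs_of_nonneg hIpos]
  have hIθ : 0 ≤ I ^ (a / (a + 1)) := by positivity
  have hc₁0 : 0 ≤ c₁ := by positivity
  have h2 : 0 < (2 : ℝ) ^ (a / 2) := by positivity
  have hBle : B ≤ 1 + τ ^ 2 := sqTrunc_le_add hk τ
  -- For τ ≤ 1 the truncation is at most 2. For τ ≥ 1 its square root is at most √2 τ, so the lower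
  -- bound for the primitive controls B^{(a+1)/2}, and the power a/(a+1) turns this into B^{a/2}.
  rcases le_total τ 1 with h1 | h1
  · have : B ^ (a / 2) ≤ 2 ^ (a / 2) :=
      Real.rpow_le_rpow (by positivity) (by nlinarith) (by positivity)
    nlinarith [mul_nonneg hc₁0 hIθ, mul_nonneg h2.le hIθ]
  · have h3 : B ^ (1 / 2 : ℝ) ≤ Real.sqrt 2 * τ := by
      rw [← Real.sqrt_eq_rpow, Real.sqrt_le_iff]
      refine ⟨by positivity, ?_⟩
      rw [mul_pow, Real.sq_sqrt (by norm_num)]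
      nlinarith
    have h4 : B ^ ((a + 1) / 2) ≤ 2 * Real.sqrt 2 * 4 ^ (a / 2) * I := by
      have e1 : B ^ ((a + 1) / 2) = B ^ (a / 2) * B ^ (1 / 2 : ℝ) := by
        rw [← Real.rpow_add (by positivity)]
        ring_nf
      have e2 : (4 : ℝ) ^ (a / 2) * 4⁻¹ ^ (a / 2) = 1 := by
        rw [← Real.mul_rpow (by norm_num) (by norm_num)]
        norm_num
      calc B ^ ((a + 1) / 2) ≤ B ^ (a / 2) * (Real.sqrt 2 * τ) := by
            rw [e1]
            gcongr
        _ = (4 ^ (a / 2) * 4⁻¹ ^ (a / 2)) * (B ^ (a / 2) * (Real.sqrt 2 * τ)) := by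
            rw [e2, one_mul]
        _ = 2 * Real.sqrt 2 * 4 ^ (a / 2) * (τ / 2 * (4⁻¹ ^ (a / 2) * B ^ (a / 2))) := by ring
        _ ≤ _ := by gcongr
    have h5 : B ^ (a / 2) ≤ c₁ * I ^ (a / (a + 1)) := by
      rw [hc₁, ← Real.mul_rpow (by positivity) hIpos]
      have e3 : B ^ (a / 2) = (B ^ ((a + 1) / 2)) ^ (a / (a + 1)) := by
        rw [← Real.rpow_mul (by positivity)]
        congr 1
        field_simp
      rw [e3]
      exact Real.rpow_le_rpow (by positivity) h4 (by positivity)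
    nlinarith [mul_nonneg h2.le hIθ]

/-- With ρ a truncation of (1+u²)^{a/2} and G its primitive at u, Hölder gives ‖ρ(u)F‖_2 ≤
‖ρ(u)‖_σ‖F‖_P, while ρ(u) ≤ c(1 + |G|^θ) with θ = a/(a+1). Since σθ = q, the norm Y of G in L^q
satisfies Y ≤ L(V + Y^θ). As θ < 1 this bounds Y, and hence ρ(u) in L^σ, independently of the
truncation. -/
theorem memLp_of_energy_of_lt {S E : Type*} [MeasurableSpace S] {μ : Measure S} [IsFiniteMeasure μ]
    [NormedAddCommGroup E] [NormedSpace ℝ E] {u : S → ℝ} (hu : AEStronglyMeasurable u μ)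
    {F : S → E} {P a q σ : ℝ} (ha : 0 < a) (hP : 0 < P) (hσ : 1 ≤ σ) (hq : q = σ * (a / (a + 1)))
    (hPσ : σ⁻¹ + P⁻¹ = 2⁻¹) (hF : MemLp F (ENNReal.ofReal P) μ) {M : ℝ≥0∞} (hM : M ≠ ⊤)
    (hE : ∀ ρ : ℝ → ℝ, ContDiff ℝ ∞ ρ → ∀ K, (∀ t, |ρ t| ≤ K) →
      eLpNorm (fun x => ∫ s in 0..u x, ρ s) (ENNReal.ofReal q) μ ≤
        M * eLpNorm (fun x => ρ (u x) • F x) 2 μ) :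
    MemLp u (ENNReal.ofReal (σ * a)) μ := by
  obtain ⟨c, hc, hcB⟩ := exists_sqTrunc_rpow_le ha
  have hσ0 : 0 < σ := by linarith
  set θ := a / (a + 1) with hθ
  have hθ0 : 0 < θ := by positivity
  have hθ1 : θ < 1 := by
    rw [hθ, div_lt_one (by positivity)]
    linarith
  have htriple : ENNReal.HolderTriple (ENNReal.ofReal σ) (ENNReal.ofReal P) 2 := ⟨by
    rw [← ENNReal.ofReal_inv_of_pos hσ0, ← ENNReal.ofReal_inv_of_pos hP,
      ← ENNReal.ofReal_add (by positivity) (by positivity), hPσ,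
      ENNReal.ofReal_inv_of_pos (by norm_num)]
    norm_num⟩
  set V := eLpNorm (fun _ : S => (1 : ℝ)) (ENNReal.ofReal σ) μ with hV
  have hVt : V ≠ ⊤ := (memLp_const (1 : ℝ)).2.ne
  set ρ : ℕ → ℝ → ℝ := fun n t => sqTrunc (n + 1) t ^ (a / 2) with hρ
  have hn1 : ∀ n : ℕ, (1 : ℝ) ≤ n + 1 := fun n => by linarith [n.cast_nonneg (α := ℝ)]
  have hρc : ∀ n, Continuous (ρ n) := fun n => continuous_sqTrunc_rpow (hn1 n) _
  have hρs : ∀ n, ContDiff ℝ ∞ (ρ n) := fun n =>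
    (contDiff_sqTrunc (hn1 n)).rpow_const_of_ne fun t => by linarith [one_le_sqTrunc (hn1 n) t]
  have hρ0 : ∀ n t, 0 ≤ ρ n t := fun n t =>
    Real.rpow_nonneg (by linarith [one_le_sqTrunc (hn1 n) t]) _
  have hρK : ∀ n t, |ρ n t| ≤ ((n : ℝ) + 1) ^ (a / 2) := fun n t => by
    rw [abs_of_nonneg (hρ0 n t)]
    exact Real.rpow_le_rpow (by linarith [one_le_sqTrunc (hn1 n) t]) (sqTrunc_le (hn1 n) t)
      (by positivity)
  have hρm : ∀ n, AEStronglyMeasurable (fun x => ρ n (u x)) μ := fun n =>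
    (hρc n).comp_aestronglyMeasurable hu
  set G : ℕ → S → ℝ := fun n x => ∫ s in 0..u x, ρ n s with hG
  have hGm : ∀ n, AEStronglyMeasurable (G n) μ := fun n =>
    (intervalIntegral.continuous_primitive (fun x y => (hρc n).intervalIntegrable x y)
      0).comp_aestronglyMeasurable hu
  set Y : ℕ → ℝ≥0∞ := fun n => eLpNorm (G n) (ENNReal.ofReal q) μ with hY
  have hρY : ∀ n, eLpNorm (fun x => ρ n (u x)) (ENNReal.ofReal σ) μ ≤
      ENNReal.ofReal c * (V + Y n ^ θ) := by
    intro n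
    have h1 : eLpNorm (fun x => ‖G n x‖ ^ θ) (ENNReal.ofReal σ) μ = Y n ^ θ := by
      rw [eLpNorm_norm_rpow _ hθ0, ← ENNReal.ofReal_mul hσ0.le, ← hq]
    refine (eLpNorm_le_mul_eLpNorm_of_ae_le_mul (g := fun x => 1 + ‖G n x‖ ^ θ) (c := c)
      (Eventually.of_forall fun x => ?_) _).trans ?_
    · rw [Real.norm_of_nonneg (hρ0 _ _), Real.norm_of_nonneg (by positivity)]
      exact hcB _ (hn1 n) _
    · refine mul_le_mul_of_nonneg_left ?_ zero_le
      rw [← h1]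
      exact eLpNorm_add_le aestronglyMeasurable_const
        ((hGm n).norm.aemeasurable.pow_const θ).aestronglyMeasurable (by simpa using hσ)
  have hYle : ∀ n, Y n ≤ M * (eLpNorm (fun x => ρ n (u x)) (ENNReal.ofReal σ) μ *
      eLpNorm F (ENNReal.ofReal P) μ) := fun n =>
    (hE (ρ n) (hρs n) _ (hρK n)).trans (mul_le_mul_of_nonneg_left
      (eLpNorm_smul_le_mul_eLpNorm hF.1 (hρm n)) zero_le)
  -- Absorption needs Y to be finite beforehand; this holds because each truncation is bounded and
  -- the measure is finite.
  have hYt : ∀ n, Y n ≠ ⊤ := fun n => by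
    refine ne_top_of_le_ne_top (ENNReal.mul_ne_top hM (ENNReal.mul_ne_top ?_ hF.2.ne)) (hYle n)
    exact (MemLp.of_bound (hρm n) _ (Eventually.of_forall fun x => hρK n (u x))).2.ne
  set L := M * ENNReal.ofReal c * eLpNorm F (ENNReal.ofReal P) μ with hL
  have hLt : L ≠ ⊤ := ENNReal.mul_ne_top (ENNReal.mul_ne_top hM ENNReal.ofReal_ne_top) hF.2.ne
  set D := 1 + (L.toReal * (V.toReal + 1)) ^ (1 - θ)⁻¹ with hD
  have hYD : ∀ n, Y n ≤ ENNReal.ofReal D := by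
    intro n
    have h1 : Y n ≤ L * (V + Y n ^ θ) := by
      refine (hYle n).trans ?_
      calc _ ≤ M * (ENNReal.ofReal c * (V + Y n ^ θ) * eLpNorm F (ENNReal.ofReal P) μ) := by
            gcongr
            exact hρY n
        _ = _ := by
            rw [hL]
            ring
    have hYθ : Y n ^ θ ≠ ⊤ := ENNReal.rpow_ne_top_of_nonneg hθ0.le (hYt n)
    have h2 := ENNReal.toReal_mono (ENNReal.mul_ne_top hLt (ENNReal.add_ne_top.2 ⟨hVt, hYθ⟩)) h1
    rw [ENNReal.toReal_mul, ENNReal.toReal_add hVt hYθ, ← ENNReal.toReal_rpow] at h2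
    rw [← ENNReal.ofReal_toReal (hYt n)]
    exact ENNReal.ofReal_le_ofReal (le_of_le_mul_add_rpow hθ1 ENNReal.toReal_nonneg
      ENNReal.toReal_nonneg ENNReal.toReal_nonneg h2 hθ0.le)
  -- The truncation is removed by Fatou's lemma.
  have hlim : eLpNorm (fun x => (1 + u x ^ 2) ^ (a / 2)) (ENNReal.ofReal σ) μ ≤
      ENNReal.ofReal c * (V + ENNReal.ofReal D ^ θ) := by
    refine (Lp.eLpNorm_lim_le_liminf_eLpNorm hρm _ (Eventually.of_forall fun x => ?_)).trans ?_
    · exact (tendsto_sqTrunc (u x)).rpow_const (Or.inl (by positivity))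
    · refine (liminf_le_liminf (v := fun _ => ENNReal.ofReal c * (V + ENNReal.ofReal D ^ θ))
        (Eventually.of_forall fun n => (hρY n).trans ?_)).trans (by simp)
      gcongr
      exact hYD n
  have hua : eLpNorm u (ENNReal.ofReal (σ * a)) μ ^ a ≤
      ENNReal.ofReal c * (V + ENNReal.ofReal D ^ θ) := by
    rw [ENNReal.ofReal_mul hσ0.le, ← eLpNorm_norm_rpow _ ha]
    refine (eLpNorm_mono_real fun x => ?_).trans hlim
    rw [Real.norm_of_nonneg (by positivity), Real.norm_eq_abs]
    have e : |u x| ^ a = (u x ^ 2) ^ (a / 2) := by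
      rw [← sq_abs, ← Real.rpow_natCast, ← Real.rpow_mul (abs_nonneg _)]
      congr 1
      push_cast
      ring
    rw [e]
    exact Real.rpow_le_rpow (by positivity) (by linarith) (by positivity)
  refine ⟨hu, lt_top_iff_ne_top.2 fun htop => ?_⟩
  rw [htop, ENNReal.top_rpow_of_pos ha, top_le_iff] at hua
  exact ENNReal.mul_ne_top ENNReal.ofReal_ne_top
    (ENNReal.add_ne_top.2 ⟨hVt, ENNReal.rpow_ne_top_of_nonneg hθ0.le ENNReal.ofReal_ne_top⟩) hua

/-! ### Boundedness above the critical exponent -/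

/-- Stampacchia's lemma. -/
theorem exists_eq_zero_of_decay {f : ℝ → ℝ} (hf0 : ∀ h, 0 ≤ f h) (hanti : Antitone f)
    {L q δ : ℝ} (hL : 0 ≤ L) (hq : 0 < q) (hδ : 1 < δ)
    (hf : ∀ k h, 0 ≤ k → k < h → f h ≤ (L / (h - k)) ^ q * f k ^ δ) : ∃ d, f d = 0 := by
  have hδ' : 0 < δ - 1 := by linarith
  -- Along the levels d(1 - 2⁻ⁿ) the gaps halve, which costs a factor 2^{nq}. The value of τ
  -- satisfies τ^{δ-1} = 2^{-q}, so the decay τⁿ compensates for it exactly; d is then taken large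
  -- enough to start the induction.
  set τ : ℝ := 2 ^ (-(q / (δ - 1))) with hτ
  have hτ0 : 0 < τ := by positivity
  have hτ1 : τ < 1 := Real.rpow_lt_one_of_one_lt_of_neg (by norm_num)
    (neg_lt_zero.2 (by positivity))
  have hτδ : τ ^ (δ - 1) = 2 ^ (-q) := by
    rw [hτ, ← Real.rpow_mul (by norm_num)]
    congr 1
    field_simp
  set W := f 0 with hW
  have hW0 : 0 ≤ W := hf0 0
  obtain ⟨d, hd0, hd⟩ : ∃ d : ℝ, 0 < d ∧ (2 * L / d) ^ q * W ^ (δ - 1) ≤ τ := by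
    have h1 : Tendsto (fun d : ℝ => (2 * L / d) ^ q * W ^ (δ - 1)) atTop
        (𝓝 ((0 : ℝ) ^ q * W ^ (δ - 1))) :=
      ((tendsto_const_nhds.div_atTop tendsto_id).rpow_const (Or.inr hq.le)).mul_const _
    rw [Real.zero_rpow hq.ne', zero_mul] at h1
    obtain ⟨d, h2, h3⟩ := ((h1.eventually_le_const hτ0).and (eventually_gt_atTop 0)).exists
    exact ⟨d, h3, h2⟩
  have hstep : ∀ n : ℕ, f (d * (1 - 2⁻¹ ^ n)) ≤ W * τ ^ n := by
    intro n
    induction n with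
    | zero => simp [hW]
    | succ n ih =>
      have h2n : (0 : ℝ) < 2⁻¹ ^ n := by positivity
      have h2n1 : (2⁻¹ : ℝ) ^ n ≤ 1 := pow_le_one₀ (by norm_num) (by norm_num)
      have e1 : d * (1 - 2⁻¹ ^ (n + 1)) - d * (1 - 2⁻¹ ^ n) = d * 2⁻¹ ^ n / 2 := by
        rw [pow_succ]
        ring
      have h3 := hf (d * (1 - 2⁻¹ ^ n)) (d * (1 - 2⁻¹ ^ (n + 1)))
        (mul_nonneg hd0.le (by linarith)) (by
          rw [← sub_pos, e1]
          positivity)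
      rw [e1] at h3
      have e2 : L / (d * 2⁻¹ ^ n / 2) = 2 * L / d * 2 ^ n := by
        rw [inv_pow]
        field_simp
      have hWτ : 0 ≤ W * τ ^ n := by positivity
      have e3 : (W * τ ^ n) ^ δ = W ^ (δ - 1) * (τ ^ n) ^ (δ - 1) * (W * τ ^ n) := by
        rw [← Real.mul_rpow hW0 (by positivity), ← Real.rpow_add_one' hWτ (by linarith)]
        simp
      have e4 : ((2 : ℝ) ^ n) ^ q * (τ ^ n) ^ (δ - 1) = 1 := by
        rw [← Real.rpow_natCast τ, ← Real.rpow_mul hτ0.le, mul_comm (n : ℝ), Real.rpow_mul hτ0.le,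
          hτδ, ← Real.rpow_natCast 2 n, ← Real.rpow_mul (by norm_num),
          ← Real.rpow_mul (by norm_num), ← Real.rpow_add (by norm_num)]
        ring_nf
        simp
      calc _ ≤ (2 * L / d * 2 ^ n) ^ q * (W * τ ^ n) ^ δ := by
            rw [← e2]
            refine h3.trans ?_
            have := hf0 (d * (1 - 2⁻¹ ^ n))
            gcongr
        _ = (2 * L / d) ^ q * W ^ (δ - 1) * (((2 : ℝ) ^ n) ^ q * (τ ^ n) ^ (δ - 1)) *
              (W * τ ^ n) := by
            rw [Real.mul_rpow (by positivity) (by positivity), e3]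
            ring
        _ ≤ τ * 1 * (W * τ ^ n) := by
            rw [e4]
            gcongr
        _ = _ := by ring
  refine ⟨d, le_antisymm ?_ (hf0 d)⟩
  have h5 : Tendsto (fun n : ℕ => W * τ ^ n) atTop (𝓝 0) := by
    simpa using (tendsto_pow_atTop_nhds_zero_of_lt_one hτ0.le hτ1).const_mul W
  refine ge_of_tendsto' h5 fun n => (hanti ?_).trans (hstep n)
  have : (0 : ℝ) < 2⁻¹ ^ n := by positivity
  nlinarith

/-- A smooth even function with values in `[0, 1]` that vanishes on `[-k, k]` and equals one
outside `(-h, h)`. -/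
def smoothTail (k h t : ℝ) : ℝ := Real.smoothTransition ((t ^ 2 - k ^ 2) / (h ^ 2 - k ^ 2))

section smoothTail

variable {k h : ℝ}

theorem contDiff_smoothTail (k h : ℝ) : ContDiff ℝ ∞ (smoothTail k h) := by
  have : ContDiff ℝ ∞ Real.smoothTransition := Real.smoothTransition.contDiff
  unfold smoothTail
  fun_prop

theorem smoothTail_nonneg (k h t : ℝ) : 0 ≤ smoothTail k h t := Real.smoothTransition.nonneg _

theorem smoothTail_le_one (k h t : ℝ) : smoothTail k h t ≤ 1 := Real.smoothTransition.le_one _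

theorem smoothTail_eq_zero (hk : 0 ≤ k) (hkh : k < h) {t : ℝ} (ht : |t| ≤ k) :
    smoothTail k h t = 0 := by
  refine Real.smoothTransition.zero_of_nonpos (div_nonpos_of_nonpos_of_nonneg ?_ ?_)
  · rw [← sq_abs t]
    nlinarith [abs_nonneg t]
  · nlinarith

theorem smoothTail_eq_one (hk : 0 ≤ k) (hkh : k < h) {t : ℝ} (ht : h ≤ |t|) :
    smoothTail k h t = 1 := by
  refine Real.smoothTransition.one_of_one_le ((one_le_div (by nlinarith)).2 ?_)
  rw [← sq_abs t]
  nlinarith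

theorem abs_integral_smoothTail_abs (k h t : ℝ) :
    |∫ s in 0..|t|, smoothTail k h s| = |∫ s in 0..t, smoothTail k h s| := by
  rcases abs_choice t with h1 | h1
  · rw [h1]
  · rw [h1]
    have := intervalIntegral.integral_comp_neg (a := 0) (b := -t) fun s => smoothTail k h s
    have e : ∀ s, smoothTail k h (-s) = smoothTail k h s := fun s => by simp [smoothTail]
    simp only [e, neg_neg, neg_zero] at this
    rw [this, intervalIntegral.integral_symm, abs_neg]

theorem sub_le_abs_integral_smoothTail (hk : 0 ≤ k) (hkh : k < h) {t : ℝ} (ht : h ≤ |t|) :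
    |t| - h ≤ |∫ s in 0..t, smoothTail k h s| := by
  rw [← abs_integral_smoothTail_abs]
  refine le_trans ?_ (le_abs_self _)
  have hint : ∀ x y, IntervalIntegrable (smoothTail k h) volume x y :=
    (contDiff_smoothTail k h).continuous.intervalIntegrable
  rw [← intervalIntegral.integral_add_adjacent_intervals (hint 0 h) (hint h |t|)]
  have h1 : 0 ≤ ∫ s in 0..h, smoothTail k h s :=
    intervalIntegral.integral_nonneg (by linarith) fun s _ => smoothTail_nonneg k h s
  have h2 : ∫ s in h..|t|, smoothTail k h s = ∫ _ in h..|t|, (1 : ℝ) := by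
    refine intervalIntegral.integral_congr fun s hs => ?_
    rw [Set.uIcc_of_le ht] at hs
    exact smoothTail_eq_one hk hkh (hs.1.trans (le_abs_self s))
  rw [h2, intervalIntegral.integral_const]
  simp
  linarith

end smoothTail

/-- Chebyshev's inequality for the primitive of a cut-off, and Hölder for F on the superlevel set,
bound |{|u| > h}| by a multiple of (h-k)^{-q} |{|u| > k}|^{γq} with γ = 1/2 - 1/p. Stampacchia's
lemma applies because γq > 1. -/
theorem memLp_top_of_energy {S E : Type*} [MeasurableSpace S] {μ : Measure S} [IsFiniteMeasure μ]
    [NormedAddCommGroup E] [NormedSpace ℝ E] {u : S → ℝ} (hu : AEStronglyMeasurable u μ)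
    {F : S → E} {p : ℝ≥0∞} {q : ℝ} (hq : 0 < q) (hp : 2 ≤ p) (hpq : 1 < (1 / 2 - 1 / p.toReal) * q)
    (hF : MemLp F p μ) {M : ℝ≥0∞} (hM : M ≠ ⊤)
    (hE : ∀ ρ : ℝ → ℝ, ContDiff ℝ ∞ ρ → ∀ K, (∀ t, |ρ t| ≤ K) →
      eLpNorm (fun x => ∫ s in 0..u x, ρ s) (ENNReal.ofReal q) μ ≤
        M * eLpNorm (fun x => ρ (u x) • F x) 2 μ) :
    MemLp u ⊤ μ := by
  wlog hum : Measurable u generalizing u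
  · refine (this hu.stronglyMeasurable_mk.aestronglyMeasurable (fun ρ hρ K hK => ?_)
      hu.stronglyMeasurable_mk.measurable).ae_eq hu.ae_eq_mk.symm
    refine (eLpNorm_congr_ae ?_).trans_le ((hE ρ hρ K hK).trans_eq ?_)
    · filter_upwards [hu.ae_eq_mk] with x hx
      rw [hx]
    · congr 1
      refine eLpNorm_congr_ae ?_
      filter_upwards [hu.ae_eq_mk] with x hx
      rw [hx]
  set γ := 1 / 2 - 1 / p.toReal with hγ
  have hγ0 : 0 < γ := by
    by_contra! hcon
    nlinarith
  set A : ℝ → Set S := fun h => {x | h < |u x|} with hA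
  have hAm : ∀ h, MeasurableSet (A h) := fun h => measurableSet_lt measurable_const hum.abs
  have hAt : ∀ h, μ (A h) ≠ ⊤ := fun h => measure_ne_top _ _
  set R := M * eLpNorm F p μ with hR
  have hRt : R ≠ ⊤ := ENNReal.mul_ne_top hM hF.2.ne
  have hkey : ∀ k h, 0 ≤ k → k < h →
      ENNReal.ofReal ((h - k) / 2) ^ q * μ (A h) ≤ (R * μ (A k) ^ γ) ^ q := by
    intro k h hk hkh
    -- The cut-off vanishes up to k and equals 1 from the midpoint on, so its primitive has modulus
    -- at least (h-k)/2 wherever |u| > h.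
    have hmid : k < (h + k) / 2 := by linarith
    have hρc := (contDiff_smoothTail k ((h + k) / 2)).continuous
    have hGm : AEStronglyMeasurable (fun x => ∫ s in 0..u x, smoothTail k ((h + k) / 2) s) μ :=
      (intervalIntegral.continuous_primitive (fun x y => hρc.intervalIntegrable x y)
        0).comp_aestronglyMeasurable hu
    have h1 := mul_meas_ge_le_pow_eLpNorm' μ (p := ENNReal.ofReal q) (by simpa using hq)
      ENNReal.ofReal_ne_top hGm (ENNReal.ofReal ((h - k) / 2))
    rw [ENNReal.toReal_ofReal hq.le] at h1
    have h2 : A h ⊆ {x | ENNReal.ofReal ((h - k) / 2) ≤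
        ‖∫ s in 0..u x, smoothTail k ((h + k) / 2) s‖ₑ} := by
      intro x hx
      have hx' : h < |u x| := hx
      rw [Set.mem_ofPred_eq, Real.enorm_eq_ofReal_abs]
      refine ENNReal.ofReal_le_ofReal (le_trans ?_
        (sub_le_abs_integral_smoothTail hk hmid (by linarith)))
      linarith
    have h3 : eLpNorm (fun x => smoothTail k ((h + k) / 2) (u x) • F x) 2 μ ≤
        eLpNorm F p μ * μ (A k) ^ γ := by
      calc _ ≤ eLpNorm ((A k).indicator F) 2 μ := by
            refine eLpNorm_mono fun x => ?_
            by_cases hx : x ∈ A k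
            · rw [Set.indicator_of_mem hx, norm_smul, Real.norm_of_nonneg (smoothTail_nonneg _ _ _)]
              exact mul_le_of_le_one_left (norm_nonneg _) (smoothTail_le_one _ _ _)
            · rw [smoothTail_eq_zero hk hmid (not_lt.1 hx)]
              simp
        _ = eLpNorm F 2 (μ.restrict (A k)) := eLpNorm_indicator_eq_eLpNorm_restrict (hAm k)
        _ ≤ eLpNorm F p (μ.restrict (A k)) * μ.restrict (A k) Set.univ ^ γ := by
            have := eLpNorm_le_eLpNorm_mul_rpow_measure_univ hp (hF.1.restrict (s := A k))
            rwa [ENNReal.toReal_ofNat] at this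
        _ ≤ _ := by
            rw [Measure.restrict_apply_univ]
            exact mul_le_mul_of_nonneg_right (eLpNorm_restrict_le _ _ _ _) zero_le
    refine (mul_le_mul_of_nonneg_left (measure_mono h2) zero_le).trans (h1.trans ?_)
    refine ENNReal.rpow_le_rpow ?_ hq.le
    refine (hE _ (contDiff_smoothTail k _) 1 fun t => ?_).trans ?_
    · rw [abs_of_nonneg (smoothTail_nonneg _ _ _)]
      exact smoothTail_le_one _ _ _
    · rw [hR, mul_assoc]
      exact mul_le_mul_of_nonneg_left h3 zero_le
  obtain ⟨d, hd⟩ := exists_eq_zero_of_decay (f := fun h => (μ (A h)).toReal)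
    (L := 2 * R.toReal) (q := q) (δ := γ * q) (fun h => ENNReal.toReal_nonneg)
    (fun k h hkh => ENNReal.toReal_mono (hAt k) (measure_mono fun x hx => lt_of_le_of_lt hkh hx))
    (by positivity) hq hpq (fun k h hk hkh => by
      have hhk : 0 < h - k := by linarith
      have h1 := ENNReal.toReal_mono (ENNReal.rpow_ne_top_of_nonneg hq.le (ENNReal.mul_ne_top hRt
        (ENNReal.rpow_ne_top_of_nonneg hγ0.le (hAt k)))) (hkey k h hk hkh)
      rw [ENNReal.toReal_mul, ← ENNReal.toReal_rpow, ← ENNReal.toReal_rpow, ENNReal.toReal_mul,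
        ← ENNReal.toReal_rpow, ENNReal.toReal_ofReal (by positivity),
        Real.mul_rpow ENNReal.toReal_nonneg (by positivity),
        ← Real.rpow_mul ENNReal.toReal_nonneg] at h1
      have e : 2 * R.toReal / (h - k) = R.toReal / ((h - k) / 2) := by field_simp
      rw [e, Real.div_rpow ENNReal.toReal_nonneg (by positivity), div_mul_eq_mul_div,
        le_div_iff₀ (by positivity), mul_comm]
      exact h1)
  refine memLp_top_of_bound hu d ?_
  have h0 : μ (A d) = 0 := ((ENNReal.toReal_eq_zero_iff _).1 hd).resolve_right (hAt d)
  rw [ae_iff]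
  simpa [hA] using h0

/-! ### Regularity of weak solutions -/

section regularity

variable {X : Fields m N} {Ω : Set (Sp N)} {Q : ℝ} {C : ℝ≥0∞}
  {A : Sp N → Matrix (Fin m) (Fin m) ℝ} {α β : ℝ} {p : ℝ≥0∞} {F : Sp N → Sp m} {u : Sp N → ℝ}

theorem IsWeakSolution.memLp_top (hX : ∀ j, Continuous (X j)) (hΩ : volume Ω < ⊤) (hQ : 2 < Q)
    (hC : C ≠ ⊤)
    (hS : ∀ φ, IsTest Ω φ → eLpNorm φ (ENNReal.ofReal (2 * Q / (Q - 2))) (volume.restrict Ω) ≤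
      C * eLpNorm (xGrad X φ) 2 (volume.restrict Ω))
    (hα : 0 < α) (hA : IsEllipticCoeff Ω A α β) (hp : 2 ≤ p) (hF : MemLp F p (volume.restrict Ω))
    (hu : IsWeakSolution Ω X A F u) (hQp : ENNReal.ofReal Q < p) :
    MemLp u ⊤ (volume.restrict Ω) := by
  have : IsFiniteMeasure (volume.restrict Ω) := ⟨by rwa [Measure.restrict_apply_univ]⟩
  have hum : AEStronglyMeasurable u (volume.restrict Ω) := by
    obtain ⟨g, hg, -⟩ := hu
    exact hg.1.1
  have hQ2 : 0 < Q - 2 := by linarith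
  refine memLp_top_of_energy hum (by positivity) hp ?_ hF
    (ENNReal.mul_ne_top hC ENNReal.ofReal_ne_top) fun ρ hρ K hK =>
      energy_estimate hX hC hS hα hA (hF.mono_exponent hp) hu hρ hK
  have h1 : 1 / p.toReal < 1 / Q := by
    -- For p = ⊤ the conventions `⊤.toReal = 0` and 1/0 = 0 give the correct reciprocal exponent.
    rcases eq_or_ne p ⊤ with rfl | hpt
    · simp
      linarith
    · refine one_div_lt_one_div_of_lt (by linarith) ?_
      rwa [← ENNReal.ofReal_lt_iff_lt_toReal (by linarith) hpt]
  -- Q is exactly the critical value of p at which the exponent in Stampacchia's lemma equals 1.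
  have h2 : (1 / 2 - 1 / Q) * (2 * Q / (Q - 2)) = 1 := by
    have : Q ≠ 0 := by linarith
    field_simp
  refine h2.symm.trans_lt ?_
  exact mul_lt_mul_of_pos_right (by linarith) (by positivity)

theorem IsWeakSolution.memLp (hX : ∀ j, Continuous (X j)) (hΩ : volume Ω < ⊤) (hQ : 2 < Q)
    (hC : C ≠ ⊤)
    (hS : ∀ φ, IsTest Ω φ → eLpNorm φ (ENNReal.ofReal (2 * Q / (Q - 2))) (volume.restrict Ω) ≤
      C * eLpNorm (xGrad X φ) 2 (volume.restrict Ω))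
    (hα : 0 < α) (hA : IsEllipticCoeff Ω A α β) (hp : 2 ≤ p) (hF : MemLp F p (volume.restrict Ω))
    (hu : IsWeakSolution Ω X A F u) (hpQ : p < ENNReal.ofReal Q) :
    MemLp u (ENNReal.ofReal (Q * p.toReal / (Q - p.toReal))) (volume.restrict Ω) := by
  have : IsFiniteMeasure (volume.restrict Ω) := ⟨by rwa [Measure.restrict_apply_univ]⟩
  have hum : AEStronglyMeasurable u (volume.restrict Ω) := by
    obtain ⟨g, hg, -⟩ := hu
    exact hg.1.1
  have hE := fun ρ hρ K hK =>
    energy_estimate hX hC hS hα hA (hF.mono_exponent hp) hu (ρ := ρ) hρ (K := K) hK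
  have hM : C * ENNReal.ofReal α⁻¹ ≠ ⊤ := ENNReal.mul_ne_top hC ENNReal.ofReal_ne_top
  rcases hp.eq_or_lt with rfl | hp2
  · have h1 := hE (fun _ => 1) contDiff_const 1 (fun _ => by simp)
    simp only [intervalIntegral.integral_const, sub_zero, smul_eq_mul, mul_one, one_smul] at h1
    rw [ENNReal.toReal_ofNat, mul_comm]
    exact ⟨hum, h1.trans_lt (ENNReal.mul_lt_top hM.lt_top hF.2)⟩
  · have hpt : p ≠ ⊤ := hpQ.ne_top
    obtain ⟨P, hP⟩ : ∃ P, P = p.toReal := ⟨_, rfl⟩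
    have hpP : p = ENNReal.ofReal P := by rw [hP, ENNReal.ofReal_toReal hpt]
    have hP2 : 2 < P := by
      rw [hP]
      exact (ENNReal.toReal_lt_toReal (by simp) hpt).2 hp2
    have hPQ : P < Q := by
      rw [hpP] at hpQ
      exact (ENNReal.ofReal_lt_ofReal_iff (by linarith)).1 hpQ
    have d1 : 0 < P - 2 := by linarith
    have d2 : 0 < Q - P := by linarith
    have d3 : 0 < Q - 2 := by linarith
    have d4 : 0 < P := by linarith
    have d5 : 0 < Q := by linarith
    -- The first factor is σ, the Hölder complement of P with respect to 2. The second is a,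
    -- determined by σ a/(a+1) = 2Q/(Q-2).
    have e1 : Q * P / (Q - P) = 2 * P / (P - 2) * (Q * (P - 2) / (2 * (Q - P))) := by field_simp
    rw [← hP, e1]
    rw [hpP] at hF
    refine memLp_of_energy_of_lt hum (P := P) (q := 2 * Q / (Q - 2)) (by positivity) (by linarith)
      ?_ ?_ ?_ hF hM hE
    · rw [one_le_div d1]
      linarith
    · have e2 : Q * (P - 2) / (2 * (Q - P)) + 1 = P * (Q - 2) / (2 * (Q - P)) := by
        field_simp
        ring
      rw [e2]
      field_simp
    · field_simp
      ring

end regularity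

end XElliptic

end

/-! ### The theorem -/

theorem theorem4p6 {m N : ℕ} (hN : 2 ≤ N)
    (Ω : Set (XElliptic.Sp N)) (hΩ : IsOpen Ω) (hΩfin : volume Ω < ⊤)
    (X : XElliptic.Fields m N)
    (hXloc : ∀ j, LocallyLipschitz (X j)) (hXlip : ∀ j, ∃ K, LipschitzOnWith K (X j) Ω)
    (hconn : XElliptic.XConnected X Ω) (hcont : XElliptic.CCContinuous X Ω)
    (Q : ℝ) (hQ : 2 < Q) (hdoubling : XElliptic.Doubling X Ω Q)
    (CP ν : ℝ) (hCP : 0 < CP) (hν : 0 < ν) (hpoincare : XElliptic.Poincare X Ω CP ν)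
    (A : XElliptic.Sp N → Matrix (Fin m) (Fin m) ℝ) (α β : ℝ) (hα : 0 < α) (hαβ : α < β)
    (hA : XElliptic.IsEllipticCoeff Ω A α β)
    (p : ℝ≥0∞) (hp : 2 ≤ p)
    (F : XElliptic.Sp N → XElliptic.Sp m) (hF : MemLp F p (volume.restrict Ω)) :
    ∃ u : XElliptic.Sp N → ℝ,
      XElliptic.IsWeakSolution Ω X A F u ∧
      (∀ w, XElliptic.IsWeakSolution Ω X A F w → w =ᵐ[volume.restrict Ω] u) ∧
      (ENNReal.ofReal Q < p → MemLp u ⊤ (volume.restrict Ω)) ∧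
      (p < ENNReal.ofReal Q →
        MemLp u (ENNReal.ofReal (Q * p.toReal / (Q - p.toReal))) (volume.restrict Ω)) := by
  have hX : ∀ j, Continuous (X j) := fun j => (hXloc j).continuous
  have hdom : XElliptic.IsDoublingDomain X Ω Q :=
    ⟨hΩ, hΩfin, hX, hconn, hcont, hdoubling⟩
  obtain ⟨C, hC, hS⟩ := hdom.exists_sobolev_test (by lia) hQ hCP hν hpoincare hXloc hXlip
  have hQ2 : 0 < Q - 2 := by linarith
  have : IsFiniteMeasure (volume.restrict Ω) := ⟨by rwa [Measure.restrict_apply_univ]⟩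
  have hq1 : (1 : ℝ≥0∞) ≤ ENNReal.ofReal (2 * Q / (Q - 2)) := by
    rw [ENNReal.one_le_ofReal, one_le_div hQ2]
    linarith
  -- Since Ω has finite measure, Hölder lowers the Sobolev exponent to 1, the norm in which `IsW0`
  -- realises its elements as functions.
  obtain ⟨D, hD, hS1⟩ : ∃ D : ℝ≥0∞, D ≠ ⊤ ∧ ∀ φ, XElliptic.IsTest Ω φ →
      eLpNorm φ 1 (volume.restrict Ω) ≤
        D * eLpNorm (XElliptic.xGrad X φ) 2 (volume.restrict Ω) := by
    set V := volume.restrict Ω Set.univ ^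
      (1 / (1 : ℝ≥0∞).toReal - 1 / (ENNReal.ofReal (2 * Q / (Q - 2))).toReal) with hV
    have hVt : V ≠ ⊤ := by
      refine ENNReal.rpow_ne_top_of_nonneg ?_ (measure_ne_top _ _)
      rw [ENNReal.toReal_one, sub_nonneg, ENNReal.toReal_ofReal (by positivity)]
      refine one_div_le_one_div_of_le one_pos ?_
      rwa [ENNReal.one_le_ofReal] at hq1
    refine ⟨ENNReal.ofReal C * V, ENNReal.mul_ne_top ENNReal.ofReal_ne_top hVt, fun φ hφ => ?_⟩
    calc _ ≤ _ := eLpNorm_le_eLpNorm_mul_rpow_measure_univ hq1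
          hφ.1.continuous.aestronglyMeasurable
      _ ≤ _ := mul_le_mul_of_nonneg_right (hS φ hφ) zero_le
      _ = _ := mul_right_comm _ _ _
  obtain ⟨u, hu⟩ := XElliptic.exists_isWeakSolution hX hD hS1 hα hA (hF.mono_exponent hp)
  exact ⟨u, hu, fun w hw => hu.ae_eq hX hD hS1 hα hA hw,
    hu.memLp_top hX hΩfin hQ ENNReal.ofReal_ne_top hS hα hA hp hF,
    hu.memLp hX hΩfin hQ ENNReal.ofReal_ne_top hS hα hA hp hF⟩
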